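/- Let $l\in\{1,2\}$ and $\rho>0$. In $L^2(0,\infty)$ with $(v,u)=\int_0^\infty\bar v\,u\,dr$ let $T_l u=-u''+\frac{l(l+1)}{r^2}u$, and let $\mathcal S_l^0$ be the set of functions $u$, smooth on $(0,\infty)$, which vanish at $0$ together with all their derivatives and satisfy $(u,u)+(T_l^2u,T_l^2u)<\infty$. Put $D_lw=r^{l+1}\bigl(\frac1r\frac{d}{dr}\bigr)^l\frac wr$, $$g_{l+}=D_l\bigl(e^{e^{5\pi i/8}\rho r}-e^{e^{9\pi i/8}\rho r}\bigr),\quad g_{l-}=D_l\bigl(e^{e^{7\pi i/8}\rho r}-e^{e^{11\pi i/8}\rho r}\bigr),\quad h_l^a=\frac{e^{ia}}{2i\rho^4}g_{l+}-\frac{e^{-ia}}{2i\rho^4}g_{l-}.$$ Then: 1. The operator $T_l^2$ on $\mathcal S_l^0$ is densely defined and symmetric, and the orthogonal complements of the ranges of $T_l^2+i\rho^4$ and $T_l^2-i\rho^4$ on $\mathcal S_l^0$ are the lines spanned by the non-zero $L^2$-functions $g_{l+}$ and $g_{l-}$, respectively. Its closure is $T_l^2$ on the functions of finite graph norm with $u(0)=u'(0)=u''(0)=u'''(0)=0$.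 2. The self-adjoint extensions of $T_l^2$ form a one-parameter family $T_{la}^2$, $0\le a<\pi$ (each extension occurs for exactly one $a$). The extension $T_{la}^2$ has the Cayley transform $U_a$, a unitary operator with $U_a(T_{la}^2+i\rho^4)u=(T_{la}^2-i\rho^4)u$ for $u$ in the domain, which extends the Cayley transform of $T_l^2$ and satisfies $U_ae^{ia}g_{l+}=e^{-ia}g_{l-}$. The element $h_l^a$ lies in the domain of $T_{la}^2$, and $(T_{la}^2+i\rho^4)h_l^a=e^{ia}g_{l+}$, $(T_{la}^2-i\rho^4)h_l^a=e^{-ia}g_{l-}$. The direct sum $\mathcal S_l^a=\mathcal S_l^0\dotplus\mathbb C h_l^a$ is an essential domain (a core) of $T_{la}^2$, and the domain of $T_{la}^2$ is the direct sum of the domain of the closure of $T_l^2|_{\mathcal S_l^0}$ and $\mathbb C h_l^a$. 3. For $0\le a<\pi$, $a\ne\pi/4$, let $\kappa=\kappa(a)$ be the real number with $$\kappa=-\rho\,\frac{\cos(a+\pi/8)}{\sin(a-\pi/4)}\quad(l=1),\qquad \kappa^3=-\rho^3\,\frac{\cos(a-\pi/8)}{\sin(a-\pi/4)}\quad(l=2).$$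 The map $a\mapsto\kappa(a)$ is a bijection from $[0,\pi)\setminus\{\pi/4\}$ onto $\mathbb R$. For $a\neq\pi/4$ the domain of $T_{la}^2$ consists exactly of the functions $u$ of finite graph norm $(u,u)+(T_l^2u,T_l^2u)<\infty$ (with $u\in C^3(0,\infty)$ and $u'''$ locally absolutely continuous) for which $u,u',u'',u'''$ have limits at $0$ that satisfy $$l=1:\quad u(0)=u'''(0)=0,\quad u''(0)=-\tfrac{2\sqrt2}{3}\,\kappa\,u'(0);\qquad l=2:\quad u'(0)=u''(0)=0,\quad u'''(0)=-\tfrac{2\sqrt2}{5}\,\kappa^3\,u(0).$$ For $a=\pi/4$ (that is, $\kappa=\infty$) the last condition is replaced by $u'(0)=0$ if $l=1$ and by $u(0)=0$ if $l=2$. On its domain $T_{la}^2$ acts as the differential operation $T_l^2$. -/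

import Mathlib

open MeasureTheory Set Filter Topology
open scoped ContDiff

noncomputable section

namespace RadialBilaplace

/-- Lebesgue measure on the open half-axis `(0, ∞)`. -/
abbrev μ₀ : Measure ℝ := volume.restrict (Ioi (0 : ℝ))

/-- The Hilbert space `L²(0, ∞)` with the scalar product `(v, u) = ∫ conj v * u dr`. -/
abbrev HSpace : Type := Lp ℂ 2 μ₀

/-- The class in `L²(0, ∞)` of a square integrable function (and `0` for other functions). -/
def toH (u : ℝ → ℂ) : HSpace :=
  open Classical in if h : MemLp u 2 μ₀ then h.toLp u else 0

/-- The differential operation `T_l u = - u'' + l (l + 1) / r² u`. -/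
def radialOp (l : ℕ) (u : ℝ → ℂ) : ℝ → ℂ := fun r =>
  -deriv (deriv u) r + ((l : ℂ) * ((l : ℂ) + 1) / (r : ℂ) ^ 2) * u r

/-- The differential operation `D_l w = r^(l+1) ((1/r) d/dr)^l (w / r)`. -/
def besselOp (l : ℕ) (w : ℝ → ℂ) : ℝ → ℂ := fun r =>
  (r : ℂ) ^ (l + 1) *
    ((fun (f : ℝ → ℂ) (s : ℝ) => deriv f s / (s : ℂ))^[l] (fun s : ℝ => w s / (s : ℂ))) r

/-- The exponential `r ↦ exp (e^(iθ) ρ r)`. -/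
def expRay (ρ θ : ℝ) : ℝ → ℂ := fun r =>
  Complex.exp (Complex.exp ((θ : ℂ) * Complex.I) * (ρ : ℂ) * (r : ℂ))

/-- `g_{l+} = D_l (exp (e^(5πi/8) ρ r) - exp (e^(9πi/8) ρ r))`. -/
def gPlus (l : ℕ) (ρ : ℝ) : ℝ → ℂ :=
  besselOp l (fun r => expRay ρ (5 * Real.pi / 8) r - expRay ρ (9 * Real.pi / 8) r)

/-- `g_{l-} = D_l (exp (e^(7πi/8) ρ r) - exp (e^(11πi/8) ρ r))`. -/
def gMinus (l : ℕ) (ρ : ℝ) : ℝ → ℂ :=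
  besselOp l (fun r => expRay ρ (7 * Real.pi / 8) r - expRay ρ (11 * Real.pi / 8) r)

/-- `h_l^a = e^(ia) / (2iρ⁴) g_{l+} - e^(-ia) / (2iρ⁴) g_{l-}`. -/
def hElem (l : ℕ) (ρ a : ℝ) : ℝ → ℂ := fun r =>
  Complex.exp ((a : ℂ) * Complex.I) / (2 * Complex.I * (ρ : ℂ) ^ 4) * gPlus l ρ r
    - Complex.exp (-((a : ℂ) * Complex.I)) / (2 * Complex.I * (ρ : ℂ) ^ 4) * gMinus l ρ r

/-! ### Helper facts on the differential operation -/

lemma eqOn_deriv {u v : ℝ → ℂ} (h : EqOn u v (Ioi 0)) : EqOn (deriv u) (deriv v) (Ioi 0) :=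
  h.deriv isOpen_Ioi

lemma eqOn_radialOp (l : ℕ) {u v : ℝ → ℂ} (h : EqOn u v (Ioi 0)) :
    EqOn (radialOp l u) (radialOp l v) (Ioi 0) := by
  intro r hr
  simp only [radialOp, eqOn_deriv (eqOn_deriv h) hr, h hr]

lemma contDiffOn_deriv {u : ℝ → ℂ} (h : ContDiffOn ℝ ∞ u (Ioi 0)) :
    ContDiffOn ℝ ∞ (deriv u) (Ioi 0) :=
  h.deriv_of_isOpen isOpen_Ioi (by simp)

lemma diffAt {u : ℝ → ℂ} (h : ContDiffOn ℝ ∞ u (Ioi 0)) {r : ℝ} (hr : r ∈ Ioi (0 : ℝ)) :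
    DifferentiableAt ℝ u r :=
  (h.differentiableOn (by simp)).differentiableAt (isOpen_Ioi.mem_nhds hr)

lemma contDiffOn_radialOp (l : ℕ) {u : ℝ → ℂ} (h : ContDiffOn ℝ ∞ u (Ioi 0)) :
    ContDiffOn ℝ ∞ (radialOp l u) (Ioi 0) := by
  refine (contDiffOn_deriv (contDiffOn_deriv h)).neg.add (ContDiffOn.mul ?_ h)
  have hden : ContDiffOn ℝ ∞ (fun r : ℝ => (r : ℂ) ^ 2) (Ioi 0) := by
    exact (Complex.ofRealCLM.contDiff.contDiffOn).pow 2
  have hne : ∀ r ∈ Ioi (0 : ℝ), (r : ℂ) ^ 2 ≠ 0 := by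
    intro r hr
    have : (r : ℂ) ≠ 0 := by exact_mod_cast (ne_of_gt hr)
    exact pow_ne_zero 2 this
  simp only [div_eq_mul_inv]
  exact contDiffOn_const.mul (hden.inv hne)

lemma radialOp_add (l : ℕ) {u v : ℝ → ℂ} (hu : ContDiffOn ℝ ∞ u (Ioi 0))
    (hv : ContDiffOn ℝ ∞ v (Ioi 0)) :
    EqOn (radialOp l (u + v)) (radialOp l u + radialOp l v) (Ioi 0) := by
  have h1 : EqOn (deriv (u + v)) (deriv u + deriv v) (Ioi 0) := fun r hr =>
    deriv_add (diffAt hu hr) (diffAt hv hr)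
  have h2 : EqOn (deriv (deriv (u + v))) (deriv (deriv u) + deriv (deriv v)) (Ioi 0) := by
    intro r hr
    rw [eqOn_deriv h1 hr]
    exact deriv_add (diffAt (contDiffOn_deriv hu) hr) (diffAt (contDiffOn_deriv hv) hr)
  intro r hr
  simp only [radialOp, h2 hr, Pi.add_apply]
  ring

lemma radialOp_smul (l : ℕ) (c : ℂ) (u : ℝ → ℂ) :
    radialOp l (c • u) = c • radialOp l u := by
  have h1 : ∀ w : ℝ → ℂ, deriv (c • w) = c • deriv w := by
    intro w
    ext r
    simp [deriv_const_smul_field c w]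
  ext r
  simp only [radialOp, h1, Pi.smul_apply, smul_eq_mul]
  ring

lemma radialOp_sq_add (l : ℕ) {u v : ℝ → ℂ} (hu : ContDiffOn ℝ ∞ u (Ioi 0))
    (hv : ContDiffOn ℝ ∞ v (Ioi 0)) :
    EqOn (radialOp l (radialOp l (u + v)))
      (radialOp l (radialOp l u) + radialOp l (radialOp l v)) (Ioi 0) :=
  (eqOn_radialOp l (radialOp_add l hu hv)).trans
    (radialOp_add l (contDiffOn_radialOp l hu) (contDiffOn_radialOp l hv))

lemma ae_of_eqOn {u v : ℝ → ℂ} (h : EqOn u v (Ioi 0)) : u =ᵐ[μ₀] v :=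
  (ae_restrict_mem measurableSet_Ioi).mono fun _ hr => h hr

/-! ### The symmetric operator -/

/-- `S_l^0`: functions that are smooth on `(0, ∞)`, vanish at `0` together with all their
derivatives, and have finite graph norm `(u, u) + (T_l² u, T_l² u)`. -/
def S0 (l : ℕ) : Submodule ℂ (ℝ → ℂ) where
  carrier := {u | ContDiffOn ℝ ∞ u (Ioi 0) ∧
    (∀ n : ℕ, Tendsto (iteratedDeriv n u) (𝓝[>] 0) (𝓝 0)) ∧
    MemLp u 2 μ₀ ∧ MemLp (radialOp l (radialOp l u)) 2 μ₀}
  zero_mem' := by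
    have h0 : radialOp l (0 : ℝ → ℂ) = 0 := by
      have := radialOp_smul l 0 0
      simpa using this
    refine ⟨contDiffOn_const, fun n => ?_, MemLp.zero, ?_⟩
    · have : iteratedDeriv n (0 : ℝ → ℂ) = fun _ => 0 := by
        ext r
        simp
      rw [this]
      exact tendsto_const_nhds
    · rw [h0, h0]
      exact MemLp.zero
  add_mem' := by
    rintro u v ⟨hu, hu0, hu2, huT⟩ ⟨hv, hv0, hv2, hvT⟩
    refine ⟨hu.add hv, fun n => ?_, hu2.add hv2, ?_⟩
    · have h := (hu0 n).add (hv0 n)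
      rw [add_zero] at h
      refine h.congr' ?_
      filter_upwards [self_mem_nhdsWithin] with r hr
      have hn : ((n : ℕ∞) : WithTop ℕ∞) ≤ ∞ := by exact_mod_cast le_top
      have hu' := (hu.contDiffAt (isOpen_Ioi.mem_nhds hr)).of_le hn
      have hv' := (hv.contDiffAt (isOpen_Ioi.mem_nhds hr)).of_le hn
      exact (iteratedDeriv_add hu' hv').symm
    · exact (memLp_congr_ae (ae_of_eqOn (radialOp_sq_add l hu hv))).2 (huT.add hvT)
  smul_mem' := by
    rintro c u ⟨hu, hu0, hu2, huT⟩
    refine ⟨hu.const_smul c, fun n => ?_, hu2.const_smul c, ?_⟩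
    · have h := (hu0 n).const_smul c
      rw [smul_zero] at h
      refine h.congr' ?_
      filter_upwards with r
      simp [iteratedDeriv_const_smul_field]
    · rw [radialOp_smul, radialOp_smul]
      exact huT.const_smul c

/-- The graph in `L² × L²` of the differential operation `T_l²` on `S_l^0`. -/
def minGraph (l : ℕ) : Submodule ℂ (HSpace × HSpace) where
  carrier := {p | ∃ u ∈ S0 l, p.1 =ᵐ[μ₀] u ∧ p.2 =ᵐ[μ₀] radialOp l (radialOp l u)}
  zero_mem' := by
    refine ⟨0, (S0 l).zero_mem, Lp.coeFn_zero _ _ _, ?_⟩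
    have h0 : radialOp l (0 : ℝ → ℂ) = 0 := by
      have := radialOp_smul l 0 0
      simpa using this
    rw [h0, h0]
    exact Lp.coeFn_zero _ _ _
  add_mem' := by
    rintro p q ⟨u, hu, hp1, hp2⟩ ⟨v, hv, hq1, hq2⟩
    refine ⟨u + v, (S0 l).add_mem hu hv, ?_, ?_⟩
    · exact (Lp.coeFn_add _ _).trans (hp1.add hq1)
    · exact ((Lp.coeFn_add _ _).trans (hp2.add hq2)).trans
        (ae_of_eqOn (radialOp_sq_add l hu.1 hv.1)).symm
  smul_mem' := by
    rintro c p ⟨u, hu, hp1, hp2⟩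
    refine ⟨c • u, (S0 l).smul_mem c hu, ?_, ?_⟩
    · exact (Lp.coeFn_smul _ _).trans (hp1.const_smul c)
    · rw [radialOp_smul, radialOp_smul]
      exact (Lp.coeFn_smul _ _).trans (hp2.const_smul c)

/-- The symmetric operator `T_l²` in `L²(0, ∞)` with domain `S_l^0`. -/
def minOp (l : ℕ) : HSpace →ₗ.[ℂ] HSpace := (minGraph l).toLinearPMap

/-- The operator `minOp l` is really given by the differential operation. -/
lemma mem_graph_minOp (l : ℕ) (x y : HSpace) :
    (x, y) ∈ (minOp l).graph ↔
      ∃ u ∈ S0 l, x =ᵐ[μ₀] u ∧ y =ᵐ[μ₀] radialOp l (radialOp l u) := by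
  have key : ∀ p : HSpace × HSpace, p ∈ minGraph l → p.1 = 0 → p.2 = 0 := by
    rintro ⟨x, y⟩ ⟨u, hu, h1, h2⟩ hx
    simp only at h1 h2 hx ⊢
    subst hx
    have h3 : u =ᵐ[μ₀] (0 : ℝ → ℂ) := h1.symm.trans (Lp.coeFn_zero _ _ _)
    have h4 : EqOn u 0 (Ioi 0) :=
      Measure.eqOn_open_of_ae_eq h3 isOpen_Ioi hu.1.continuousOn continuousOn_const
    have h0 : radialOp l (0 : ℝ → ℂ) = 0 := by
      have := radialOp_smul l 0 0
      simpa using this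
    have h5 := eqOn_radialOp l (eqOn_radialOp l h4)
    rw [h0, h0] at h5
    exact Lp.ext ((h2.trans (ae_of_eqOn h5)).trans (Lp.coeFn_zero _ _ _).symm)
  rw [minOp, Submodule.toLinearPMap_graph_eq _ key]
  rfl

/-- The range of `T + c` for an operator `T` with a domain. -/
def shiftedRange (T : HSpace →ₗ.[ℂ] HSpace) (c : ℂ) : Submodule ℂ HSpace :=
  LinearMap.range (T.toFun + c • T.domain.subtype)

/-! ### Functions of finite graph norm and boundary conditions -/

/-- Functions on `(0, ∞)` on which the graph norm `(u, u) + (T_l² u, T_l² u)` makes sense and is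
finite: `u''` is continuously differentiable, `u'''` is locally absolutely continuous, and
`u`, `T_l² u` are square integrable. -/
structure FiniteGraphNorm (l : ℕ) (u : ℝ → ℂ) : Prop where
  contDiffOn : ContDiffOn ℝ 3 u (Ioi 0)
  absCont : ∀ x y : ℝ, 0 < x → x < y → AbsolutelyContinuousOnInterval (iteratedDeriv 3 u) x y
  memLp : MemLp u 2 μ₀
  memLp_sq : MemLp (radialOp l (radialOp l u)) 2 μ₀

/-- `u(0), u'(0), u''(0), u'''(0)` exist, as limits at `0+`, and are the entries of `b`. -/
def HasBoundaryValues (u : ℝ → ℂ) (b : Fin 4 → ℂ) : Prop :=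
  ∀ k : Fin 4, Tendsto (iteratedDeriv (k : ℕ) u) (𝓝[>] 0) (𝓝 (b k))

/-- The boundary conditions with real parameter `κ`:
`u(0) = u'''(0) = 0`, `u''(0) = -(2√2/3) κ u'(0)` for `l = 1`, and
`u'(0) = u''(0) = 0`, `u'''(0) = -(2√2/5) κ³ u(0)` for `l = 2`. -/
def BoundaryCond (l : ℕ) (κ : ℝ) (u : ℝ → ℂ) : Prop :=
  ∃ b : Fin 4 → ℂ, HasBoundaryValues u b ∧
    ((l = 1 ∧ b 0 = 0 ∧ b 3 = 0 ∧ b 2 = -((2 * √2 / 3 * κ : ℝ) : ℂ) * b 1) ∨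
     (l = 2 ∧ b 1 = 0 ∧ b 2 = 0 ∧ b 3 = -((2 * √2 / 5 * κ ^ 3 : ℝ) : ℂ) * b 0))

/-- The boundary conditions for `κ = ∞`:
`u(0) = u'''(0) = 0`, `u'(0) = 0` for `l = 1`, and
`u'(0) = u''(0) = 0`, `u(0) = 0` for `l = 2`. -/
def BoundaryCondInfty (l : ℕ) (u : ℝ → ℂ) : Prop :=
  ∃ b : Fin 4 → ℂ, HasBoundaryValues u b ∧
    ((l = 1 ∧ b 0 = 0 ∧ b 3 = 0 ∧ b 1 = 0) ∨
     (l = 2 ∧ b 1 = 0 ∧ b 2 = 0 ∧ b 0 = 0))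

/-- The real cube root. -/
def cubeRoot (x : ℝ) : ℝ := Real.sign x * |x| ^ (1 / 3 : ℝ)

/-- The parameter `κ = κ(a)`, for `a ≠ π/4`:
`κ = -ρ cos (a + π/8) / sin (a - π/4)` for `l = 1`, and
`κ³ = -ρ³ cos (a - π/8) / sin (a - π/4)` for `l = 2`. -/
def kappa (l : ℕ) (ρ a : ℝ) : ℝ :=
  if l = 1 then -ρ * (Real.cos (a + Real.pi / 8) / Real.sin (a - Real.pi / 4))
  else cubeRoot (-ρ ^ 3 * (Real.cos (a - Real.pi / 8) / Real.sin (a - Real.pi / 4)))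

/-- The graph of `A` is that of the differential operation `T_l²` on the functions of finite
graph norm that satisfy the condition `P`. -/
def IsRealizedOn (l : ℕ) (A : HSpace →ₗ.[ℂ] HSpace) (P : (ℝ → ℂ) → Prop) : Prop :=
  ∀ x y : HSpace, (x, y) ∈ A.graph ↔
    ∃ u : ℝ → ℂ, FiniteGraphNorm l u ∧ P u ∧ x =ᵐ[μ₀] u ∧ y =ᵐ[μ₀] radialOp l (radialOp l u)

/-- `A` has a unitary Cayley transform `U_a`: it extends the Cayley transform
`(T_l² + iρ⁴) u ↦ (T_l² - iρ⁴) u` of `T_l²` on `S_l^0`, it maps `e^(ia) g_{l+}` to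
`e^(-ia) g_{l-}`, and it is the map `(A + iρ⁴) u ↦ (A - iρ⁴) u`. -/
def HasCayleyTransform (l : ℕ) (ρ a : ℝ) (A : HSpace →ₗ.[ℂ] HSpace) : Prop :=
  ∃ U : HSpace ≃ₗᵢ[ℂ] HSpace,
    (∀ x : (minOp l).domain,
      U (minOp l x + (Complex.I * (ρ : ℂ) ^ 4) • (x : HSpace)) =
        minOp l x - (Complex.I * (ρ : ℂ) ^ 4) • (x : HSpace)) ∧
    U (Complex.exp ((a : ℂ) * Complex.I) • toH (gPlus l ρ)) =
      Complex.exp (-((a : ℂ) * Complex.I)) • toH (gMinus l ρ) ∧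
    (∀ x : A.domain,
      U (A x + (Complex.I * (ρ : ℂ) ^ 4) • (x : HSpace)) =
        A x - (Complex.I * (ρ : ℂ) ^ 4) • (x : HSpace))

end RadialBilaplace

end

/-!
For `u` of finite graph norm, `T_l² u = f` is treated as a first-order system for the
quasi-derivatives `u`, `u'`, `p = T_l u`, `p'` with right-hand side `f ∈ L²` (`IsQuasi`). Two such
functions have a Lagrange bracket whose derivative is the integrand of Green's formula, so everything
depends on the behaviour of the quasi-derivatives at the two ends of `(0, ∞)`.

*At infinity* all quasi-derivatives tend to `0`: test the equation on `[r, r + 1]` with polynomials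
(`tendsto_atTop_of_isQuasi`). *At the origin* variation of constants writes `u` in terms of the
homogeneous solutions `r ^ (l + 1)`, `r ^ (2 - l)`, `r ^ (-l)`, `r ^ (l + 3)`, with coefficients that
are brackets of `u` with these powers (`exists_expansionOne`, `exists_expansionTwo`). Square
integrability excludes `r ^ (-l)`, and `r ^ (l + 3)` is invisible in derivatives of order at most
three. Hence `u, u', u'', u'''` have limits `(0, β, α, 0)` if `l = 1` and `(β, 0, 0, α)` if `l = 2`
(`exists_boundaryValues`, `bvec`), and Green's formula takes the form
`(u, T_l² v) - (T_l² u, v) = (2 l + 1) (conj β_u α_v - conj α_u β_v)` (`inner_green`).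

The adjoint of the minimal operator is the differential operation on all functions of finite graph
norm (`mem_graph_adjoint_minOp`), because weak solutions of `T_l² v = f` are classical up to a null
set (`exists_isQuasi_of_weak`). So `(β, α)` is a linear map of the domain of the adjoint onto `ℂ²`
which turns the asymmetry of the adjoint into the standard symplectic form. This is what
`BoundaryMap` abstracts, and extension theory becomes linear algebra in `ℂ²`: the closure is given by
`β = α = 0` (`BoundaryMap.mem_graph_closure_iff`); the self-adjoint extensions are the Lagrangian
lines, which are the lines `s α = t β` with real `(s, t) ≠ 0` (`BoundaryMap.isSelfAdjoint_ext`,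
`BoundaryMap.exists_eq_ext`); one element with boundary values on the line spans the domain of the
extension modulo that of the closure (`BoundaryMap.domain_ext`, `BoundaryMap.hasCore_ext`); and an
eigenvector of the adjoint with non-zero imaginary eigenvalue spans its eigenspace, since the form is
definite there (`BoundaryMap.mem_span_of_eigenvector`). The Cayley transform exists for every
self-adjoint operator (`exists_cayley`).

It remains to compute. The functions `g_{l±}` are differences of two decaying solutions of
`T_l² g = ± i ρ⁴ g`; the singular terms `r ^ (-l)` cancel in the difference, and Taylor expansion
gives the boundary values in terms of powers of `e^(iπ/8)` (`represents_gPlus`, `represents_gMinus`).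
The boundary values of `h_l^a` are then a non-zero multiple of the real vector `(condS a, condT l ρ a)`
with `condS a = sin (a - π / 4)` (`represents_hElem`). Both coordinates are shifted sines of `a` with
phases that differ modulo `π`, so each real line occurs for exactly one `a ∈ [0, π)`
(`exists_condS_mul_eq`, `eq_of_condS_mul_condT`), and `κ` is, up to a constant and the power `2 l - 1`,
the slope of that line (`condT_eq_kappaPow`).
-/


namespace RadialBilaplace

/-! ### Absolutely continuous complex functions -/

/-- Absolute continuity passes to functions with smaller increments. -/
lemma absCont_of_dist_le {X Y : Type*} [PseudoMetricSpace X] [PseudoMetricSpace Y]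
    {f : ℝ → X} {g : ℝ → Y} {a b : ℝ} (hf : AbsolutelyContinuousOnInterval f a b)
    (h : ∀ x y, dist (g x) (g y) ≤ dist (f x) (f y)) :
    AbsolutelyContinuousOnInterval g a b :=
  squeeze_zero (fun _ => Finset.sum_nonneg fun _ _ => dist_nonneg)
    (fun _ => Finset.sum_le_sum fun _ _ => h _ _) hf

lemma absCont_congr {X : Type*} [PseudoMetricSpace X]
    {f g : ℝ → X} {a b : ℝ} (hf : AbsolutelyContinuousOnInterval f a b)
    (h : EqOn f g (uIcc a b)) : AbsolutelyContinuousOnInterval g a b := by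
  rw [absolutelyContinuousOnInterval_iff] at hf ⊢
  intro ε hε
  obtain ⟨δ, hδ, H⟩ := hf ε hε
  refine ⟨δ, hδ, fun E hE hEδ => ?_⟩
  have := H E hE hEδ
  rwa [Finset.sum_congr rfl fun i hi => by rw [h (hE.1 i hi).1, h (hE.1 i hi).2]] at this

lemma absCont_re {f : ℝ → ℂ} {a b : ℝ} (hf : AbsolutelyContinuousOnInterval f a b) :
    AbsolutelyContinuousOnInterval (fun x => (f x).re) a b :=
  absCont_of_dist_le hf fun x y => by
    rw [Real.dist_eq, Complex.dist_eq, ← Complex.sub_re]; exact Complex.abs_re_le_norm _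

lemma absCont_im {f : ℝ → ℂ} {a b : ℝ} (hf : AbsolutelyContinuousOnInterval f a b) :
    AbsolutelyContinuousOnInterval (fun x => (f x).im) a b :=
  absCont_of_dist_le hf fun x y => by
    rw [Real.dist_eq, Complex.dist_eq, ← Complex.sub_im]; exact Complex.abs_im_le_norm _

lemma absCont_ofReal {f : ℝ → ℝ} {a b : ℝ} (hf : AbsolutelyContinuousOnInterval f a b) :
    AbsolutelyContinuousOnInterval (fun x => (f x : ℂ)) a b :=
  absCont_of_dist_le hf fun x y => by
    rw [Real.dist_eq, Complex.dist_eq, ← Complex.ofReal_sub, Complex.norm_real, Real.norm_eq_abs]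

lemma absCont_of_re_im {f : ℝ → ℂ} {a b : ℝ}
    (h1 : AbsolutelyContinuousOnInterval (fun x => (f x).re) a b)
    (h2 : AbsolutelyContinuousOnInterval (fun x => (f x).im) a b) :
    AbsolutelyContinuousOnInterval f a b :=
  absCont_congr ((absCont_ofReal h1).add ((absCont_ofReal h2).const_smul Complex.I))
    fun x _ => by simp [mul_comm Complex.I, Complex.re_add_im]

lemma absCont_mul {f g : ℝ → ℂ} {a b : ℝ} (hf : AbsolutelyContinuousOnInterval f a b)
    (hg : AbsolutelyContinuousOnInterval g a b) :
    AbsolutelyContinuousOnInterval (fun x => f x * g x) a b := hf.smul hg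

lemma absCont_conj {f : ℝ → ℂ} {a b : ℝ} (hf : AbsolutelyContinuousOnInterval f a b) :
    AbsolutelyContinuousOnInterval (fun x => (starRingEnd ℂ) (f x)) a b :=
  absCont_of_dist_le hf fun x y => by
    rw [Complex.dist_eq, Complex.dist_eq, ← map_sub, RCLike.norm_conj]

lemma hasDerivAt_re {f : ℝ → ℂ} {f' : ℂ} {x : ℝ} (h : HasDerivAt f f' x) :
    HasDerivAt (fun x => (f x).re) f'.re x :=
  (Complex.reCLM.hasFDerivAt (x := f x)).comp_hasDerivAt x h

lemma hasDerivAt_im {f : ℝ → ℂ} {f' : ℂ} {x : ℝ} (h : HasDerivAt f f' x) :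
    HasDerivAt (fun x => (f x).im) f'.im x :=
  (Complex.imCLM.hasFDerivAt (x := f x)).comp_hasDerivAt x h

lemma hasDerivAt_conj {f : ℝ → ℂ} {f' : ℂ} {x : ℝ} (h : HasDerivAt f f' x) :
    HasDerivAt (fun x => (starRingEnd ℂ) (f x)) ((starRingEnd ℂ) f') x :=
  (Complex.conjCLE.toContinuousLinearMap.hasFDerivAt (x := f x)).comp_hasDerivAt x h

lemma hasDerivAt_of_re_im {f : ℝ → ℂ} {x a b : ℝ}
    (h1 : HasDerivAt (fun x => (f x).re) a x) (h2 : HasDerivAt (fun x => (f x).im) b x) :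
    HasDerivAt f (a + b * Complex.I) x := by
  have := h1.ofReal_comp.add (h2.ofReal_comp.mul_const Complex.I)
  refine this.congr_of_eventuallyEq (Eventually.of_forall fun y => ?_)
  simp

lemma absCont_ae_differentiableAt {f : ℝ → ℂ} {a b : ℝ}
    (hf : AbsolutelyContinuousOnInterval f a b) :
    ∀ᵐ x : ℝ, x ∈ uIcc a b → DifferentiableAt ℝ f x := by
  filter_upwards [(absCont_re hf).ae_differentiableAt, (absCont_im hf).ae_differentiableAt]
    with x h1 h2 hx
  exact (hasDerivAt_of_re_im (h1 hx).hasDerivAt (h2 hx).hasDerivAt).differentiableAt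

lemma intervalIntegrable_of_re_im {f : ℝ → ℂ} {a b : ℝ}
    (h1 : IntervalIntegrable (fun x => (f x).re) volume a b)
    (h2 : IntervalIntegrable (fun x => (f x).im) volume a b) :
    IntervalIntegrable f volume a b := by
  have k1 : IntervalIntegrable (fun x => ((f x).re : ℂ)) volume a b := ⟨h1.1.ofReal, h1.2.ofReal⟩
  have k2 : IntervalIntegrable (fun x => ((f x).im : ℂ)) volume a b := ⟨h2.1.ofReal, h2.2.ofReal⟩
  refine (k1.add (k2.mul_const Complex.I)).congr fun x _ => ?_
  simp

/-- The fundamental theorem of calculus for absolutely continuous complex functions. -/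
lemma absCont_ftc {f g : ℝ → ℂ} {a b : ℝ} (hf : AbsolutelyContinuousOnInterval f a b)
    (h : ∀ᵐ x : ℝ, x ∈ uIcc a b → HasDerivAt f (g x) x) :
    IntervalIntegrable g volume a b ∧ ∫ x in a..b, g x = f b - f a := by
  have h1 := (absCont_re hf).intervalIntegrable_deriv
  have h2 := (absCont_im hf).intervalIntegrable_deriv
  have e1 : ∀ᵐ x : ℝ, x ∈ uIoc a b → deriv (fun x => (f x).re) x = (g x).re := by
    filter_upwards [h] with x hx hx'
    exact (hasDerivAt_re (hx (uIoc_subset_uIcc hx'))).deriv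
  have e2 : ∀ᵐ x : ℝ, x ∈ uIoc a b → deriv (fun x => (f x).im) x = (g x).im := by
    filter_upwards [h] with x hx hx'
    exact (hasDerivAt_im (hx (uIoc_subset_uIcc hx'))).deriv
  have i1 : IntervalIntegrable (fun x => (g x).re) volume a b :=
    h1.congr_ae ((ae_restrict_iff' measurableSet_uIoc).2 e1)
  have i2 : IntervalIntegrable (fun x => (g x).im) volume a b :=
    h2.congr_ae ((ae_restrict_iff' measurableSet_uIoc).2 e2)
  have hg := intervalIntegrable_of_re_im i1 i2
  refine ⟨hg, ?_⟩
  have j1 := (absCont_re hf).integral_deriv_eq_sub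
  have j2 := (absCont_im hf).integral_deriv_eq_sub
  rw [intervalIntegral.integral_congr_ae e1] at j1
  rw [intervalIntegral.integral_congr_ae e2] at j2
  have k1 := Complex.reCLM.intervalIntegral_comp_comm hg
  have k2 := Complex.imCLM.intervalIntegral_comp_comm hg
  simp only [Complex.reCLM_apply, Complex.imCLM_apply] at k1 k2
  apply Complex.ext
  · rw [← k1, j1, Complex.sub_re]
  · rw [← k2, j2, Complex.sub_im]

lemma absCont_primitive {f : ℝ → ℂ} {a b c : ℝ} (h : IntervalIntegrable f volume a b)
    (hc : c ∈ uIcc a b) : AbsolutelyContinuousOnInterval (fun x => ∫ v in c..x, f v) a b := by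
  have hr : IntervalIntegrable (fun x => (f x).re) volume a b :=
    ⟨h.1.re, h.2.re⟩
  have hi : IntervalIntegrable (fun x => (f x).im) volume a b :=
    ⟨h.1.im, h.2.im⟩
  have sub : ∀ x ∈ uIcc a b, IntervalIntegrable f volume c x := fun x hx =>
    h.mono_set (uIcc_subset_uIcc hc hx)
  apply absCont_of_re_im
  · refine absCont_congr (hr.absolutelyContinuousOnInterval_intervalIntegral hc) fun x hx => ?_
    exact Complex.reCLM.intervalIntegral_comp_comm (sub x hx)
  · refine absCont_congr (hi.absolutelyContinuousOnInterval_intervalIntegral hc) fun x hx => ?_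
    exact Complex.imCLM.intervalIntegral_comp_comm (sub x hx)

lemma absCont_of_hasDerivAt {f f' : ℝ → ℂ} {a b : ℝ} (h : ∀ x ∈ uIcc a b, HasDerivAt f (f' x) x)
    (hc : ContinuousOn f' (uIcc a b)) : AbsolutelyContinuousOnInterval f a b := by
  have hi : IntervalIntegrable f' volume a b := hc.intervalIntegrable
  have h0 := absCont_primitive hi (left_mem_uIcc)
  have h1 : AbsolutelyContinuousOnInterval (fun _ : ℝ => f a) a b :=
    (contDiff_const.contDiffOn).absolutelyContinuousOnInterval
  refine absCont_congr (h0.add h1) fun x hx => ?_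
  have hs : uIcc a x ⊆ uIcc a b := uIcc_subset_uIcc left_mem_uIcc hx
  have := intervalIntegral.integral_eq_sub_of_hasDerivAt (fun y hy => h y (hs hy))
    (hi.mono_set hs)
  simp [this]

/-! ### The fourth-order equation as a first-order system -/

/-- The centrifugal potential `l (l + 1) / r²`. -/
noncomputable def pot (l : ℕ) (r : ℝ) : ℂ := (l : ℂ) * ((l : ℂ) + 1) / (r : ℂ) ^ 2

/-- The derivative of the centrifugal potential. -/
noncomputable def pot1 (l : ℕ) (r : ℝ) : ℂ := -2 * ((l : ℂ) * ((l : ℂ) + 1)) / (r : ℂ) ^ 3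

/-- The equation `T_l² u = f` on `(0, ∞)` as a first-order system for the quasi-derivatives
`u`, `u1 = u'`, `p = T_l u` and `p1 = p'`; only `p1` is required to be absolutely continuous instead
of continuously differentiable, so that `f` need only be locally integrable. -/
structure IsQuasi (l : ℕ) (u u1 p p1 f : ℝ → ℂ) : Prop where
  d0 : ∀ r : ℝ, 0 < r → HasDerivAt u (u1 r) r
  d1 : ∀ r : ℝ, 0 < r → HasDerivAt u1 (pot l r * u r - p r) r
  d2 : ∀ r : ℝ, 0 < r → HasDerivAt p (p1 r) r
  ac : ∀ x y : ℝ, 0 < x → 0 < y → AbsolutelyContinuousOnInterval p1 x y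
  d3 : ∀ᵐ r : ℝ, 0 < r → HasDerivAt p1 (pot l r * p r - f r) r

lemma hasDerivAt_pot (l : ℕ) {r : ℝ} (hr : 0 < r) : HasDerivAt (pot l) (pot1 l r) r := by
  have hr' : (r : ℂ) ≠ 0 := by exact_mod_cast hr.ne'
  have h1 : HasDerivAt (fun x : ℝ => (x : ℂ) ^ 2) (2 * (r : ℂ)) r := by
    simpa using (hasDerivAt_id r).ofReal_comp.fun_pow 2
  have := (h1.inv (pow_ne_zero 2 hr')).const_mul ((l : ℂ) * ((l : ℂ) + 1))
  refine (this.congr_of_eventuallyEq (Eventually.of_forall fun y => ?_)).congr_deriv ?_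
  · simp [pot, div_eq_mul_inv]
  · simp only [pot1]; field_simp

lemma contDiffOn_const_div_pow (c : ℂ) (n : ℕ) :
    ContDiffOn ℝ 1 (fun r : ℝ => c / (r : ℂ) ^ n) (Ioi 0) := by
  have hden : ContDiffOn ℝ 1 (fun r : ℝ => (r : ℂ) ^ n) (Ioi 0) :=
    (Complex.ofRealCLM.contDiff.contDiffOn).pow n
  simp only [div_eq_mul_inv]
  refine contDiffOn_const.mul (hden.inv fun r hr => pow_ne_zero n ?_)
  exact_mod_cast (ne_of_gt hr : r ≠ 0)

lemma continuousOn_pot (l : ℕ) : ContinuousOn (pot l) (Ioi 0) :=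
  (contDiffOn_const_div_pow _ 2).continuousOn

lemma continuousOn_pot1 (l : ℕ) : ContinuousOn (pot1 l) (Ioi 0) :=
  (contDiffOn_const_div_pow _ 3).continuousOn

lemma radialOp_eq (l : ℕ) (u : ℝ → ℂ) (r : ℝ) :
    radialOp l u r = -deriv (deriv u) r + pot l r * u r := rfl

lemma uIcc_subset_Ioi {x y : ℝ} (hx : 0 < x) (hy : 0 < y) : uIcc x y ⊆ Ioi 0 := fun _ hz =>
  lt_of_lt_of_le (lt_min hx hy) hz.1

/-- A property that holds almost everywhere on every compact subinterval of `(0, ∞)` holds almost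
everywhere on `(0, ∞)`. -/
lemma ae_pos_of_forall_uIcc {P : ℝ → Prop}
    (h : ∀ x y : ℝ, 0 < x → 0 < y → ∀ᵐ r : ℝ, r ∈ uIcc x y → P r) :
    ∀ᵐ r : ℝ, 0 < r → P r := by
  have h1 : ∀ᵐ r : ℝ, ∀ n : ℕ, r ∈ uIcc (1 / ((n : ℝ) + 1)) ((n : ℝ) + 1) → P r := by
    rw [ae_all_iff]
    exact fun n => h _ _ (by positivity) (by positivity)
  filter_upwards [h1] with r hr hr0
  obtain ⟨n, hn⟩ := exists_nat_gt (max r (1 / r))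
  have hn1 : r < n := lt_of_le_of_lt (le_max_left _ _) hn
  have hn2 : 1 / r < n := lt_of_le_of_lt (le_max_right _ _) hn
  refine hr n ?_
  rw [mem_uIcc]
  left
  constructor
  · rw [div_le_iff₀ (by positivity)]
    rw [div_lt_iff₀ hr0] at hn2
    nlinarith
  · linarith

namespace IsQuasi

variable {l : ℕ} {u u1 p p1 f v v1 s s1 g : ℝ → ℂ}

lemma deriv_u (h : IsQuasi l u u1 p p1 f) : EqOn (deriv u) u1 (Ioi 0) := fun _ hr =>
  (h.d0 _ hr).deriv

lemma deriv_deriv_u (h : IsQuasi l u u1 p p1 f) :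
    EqOn (deriv (deriv u)) (fun r => pot l r * u r - p r) (Ioi 0) := fun r hr => by
  rw [eqOn_deriv h.deriv_u hr, (h.d1 r hr).deriv]

lemma radialOp_u (h : IsQuasi l u u1 p p1 f) : EqOn (radialOp l u) p (Ioi 0) := fun r hr => by
  rw [radialOp_eq, h.deriv_deriv_u hr]; ring

lemma radialOp_p (h : IsQuasi l u u1 p p1 f) : ∀ᵐ r : ℝ, 0 < r → radialOp l p r = f r := by
  filter_upwards [h.d3] with r hr hr0
  have e : EqOn (deriv p) p1 (Ioi 0) := fun r hr => (h.d2 r hr).deriv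
  rw [radialOp_eq, eqOn_deriv e (mem_Ioi.2 hr0), (hr hr0).deriv]; ring

lemma radialOp_sq (h : IsQuasi l u u1 p p1 f) : radialOp l (radialOp l u) =ᵐ[μ₀] f := by
  rw [EventuallyEq, ae_restrict_iff' measurableSet_Ioi]
  filter_upwards [h.radialOp_p] with r hr hr0
  rw [eqOn_radialOp l h.radialOp_u hr0, hr hr0]

lemma continuousOn_u (h : IsQuasi l u u1 p p1 f) : ContinuousOn u (Ioi 0) := fun _ hr =>
  (h.d0 _ hr).continuousAt.continuousWithinAt

lemma continuousOn_u1 (h : IsQuasi l u u1 p p1 f) : ContinuousOn u1 (Ioi 0) := fun _ hr =>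
  (h.d1 _ hr).continuousAt.continuousWithinAt

lemma continuousOn_p (h : IsQuasi l u u1 p p1 f) : ContinuousOn p (Ioi 0) := fun _ hr =>
  (h.d2 _ hr).continuousAt.continuousWithinAt

lemma continuousOn_p1 (h : IsQuasi l u u1 p p1 f) : ContinuousOn p1 (Ioi 0) := fun r hr => by
  have hr0 : 0 < r := hr
  have hac := (h.ac (r / 2) (r + 1) (by positivity) (by positivity)).continuousOn
  refine (hac.continuousAt ?_).continuousWithinAt
  rw [uIcc_of_le (by linarith)]
  exact Icc_mem_nhds (by linarith) (by linarith)

lemma hasDerivAt_u2 (h : IsQuasi l u u1 p p1 f) {r : ℝ} (hr : 0 < r) :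
    HasDerivAt (fun r => pot l r * u r - p r) (pot1 l r * u r + pot l r * u1 r - p1 r) r :=
  ((hasDerivAt_pot l hr).mul (h.d0 r hr)).sub (h.d2 r hr)

lemma iteratedDeriv_two (h : IsQuasi l u u1 p p1 f) :
    EqOn (iteratedDeriv 2 u) (fun r => pot l r * u r - p r) (Ioi 0) := by
  rw [iteratedDeriv_succ, iteratedDeriv_one]; exact h.deriv_deriv_u

lemma iteratedDeriv_three (h : IsQuasi l u u1 p p1 f) :
    EqOn (iteratedDeriv 3 u) (fun r => pot1 l r * u r + pot l r * u1 r - p1 r) (Ioi 0) := by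
  intro r hr
  rw [iteratedDeriv_succ, eqOn_deriv h.iteratedDeriv_two hr, (h.hasDerivAt_u2 hr).deriv]

lemma contDiffOn (h : IsQuasi l u u1 p p1 f) : ContDiffOn ℝ 3 u (Ioi 0) := by
  have key : ∀ (w w1 : ℝ → ℂ) (n : ℕ), (∀ r : ℝ, 0 < r → HasDerivAt w (w1 r) r) →
      ContDiffOn ℝ n w1 (Ioi 0) → ContDiffOn ℝ (n + 1 : ℕ) w (Ioi 0) := by
    intro w w1 n hw hw1
    push_cast
    rw [contDiffOn_succ_iff_deriv_of_isOpen isOpen_Ioi]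
    refine ⟨fun r hr => (hw r hr).differentiableAt.differentiableWithinAt, by simp, ?_⟩
    exact hw1.congr fun r hr => (hw r hr).deriv
  have c3 : ContinuousOn (fun r => pot1 l r * u r + pot l r * u1 r - p1 r) (Ioi 0) :=
    (((continuousOn_pot1 l).mul h.continuousOn_u).add
      ((continuousOn_pot l).mul h.continuousOn_u1)).sub h.continuousOn_p1
  have := key _ _ 2 h.d0 (key _ _ 1 h.d1 (key _ _ 0 (fun r hr => h.hasDerivAt_u2 hr)
    (by simpa using c3)))
  exact_mod_cast this

lemma absCont_u (h : IsQuasi l u u1 p p1 f) {x y : ℝ} (hx : 0 < x) (hy : 0 < y) :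
    AbsolutelyContinuousOnInterval u x y :=
  absCont_of_hasDerivAt (fun r hr => h.d0 r (uIcc_subset_Ioi hx hy hr))
    (h.continuousOn_u1.mono (uIcc_subset_Ioi hx hy))

lemma absCont_u1 (h : IsQuasi l u u1 p p1 f) {x y : ℝ} (hx : 0 < x) (hy : 0 < y) :
    AbsolutelyContinuousOnInterval u1 x y :=
  absCont_of_hasDerivAt (fun r hr => h.d1 r (uIcc_subset_Ioi hx hy hr))
    ((((continuousOn_pot l).mul h.continuousOn_u).sub h.continuousOn_p).mono
      (uIcc_subset_Ioi hx hy))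

lemma absCont_p (h : IsQuasi l u u1 p p1 f) {x y : ℝ} (hx : 0 < x) (hy : 0 < y) :
    AbsolutelyContinuousOnInterval p x y :=
  absCont_of_hasDerivAt (fun r hr => h.d2 r (uIcc_subset_Ioi hx hy hr))
    (h.continuousOn_p1.mono (uIcc_subset_Ioi hx hy))

lemma finiteGraphNorm (h : IsQuasi l u u1 p p1 f) (hu : MemLp u 2 μ₀) (hf : MemLp f 2 μ₀) :
    FiniteGraphNorm l u where
  contDiffOn := h.contDiffOn
  absCont x y hx hxy := by
    have hy := hx.trans hxy
    have hpot : ContDiffOn ℝ 1 (pot l) (Ioi 0) := contDiffOn_const_div_pow _ 2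
    have hpot1 : ContDiffOn ℝ 1 (pot1 l) (Ioi 0) := contDiffOn_const_div_pow _ 3
    have a0 := (hpot.mono (uIcc_subset_Ioi hx hy)).absolutelyContinuousOnInterval
    have a1 := (hpot1.mono (uIcc_subset_Ioi hx hy)).absolutelyContinuousOnInterval
    refine absCont_congr (((absCont_mul a1 (h.absCont_u hx hy)).add
      (absCont_mul a0 (h.absCont_u1 hx hy))).sub (h.ac x y hx hy)) fun r hr => ?_
    exact (h.iteratedDeriv_three (uIcc_subset_Ioi hx hy hr)).symm
  memLp := hu
  memLp_sq := (memLp_congr_ae h.radialOp_sq).2 hf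

lemma congr_rhs (h : IsQuasi l u u1 p p1 f) (hfg : f =ᵐ[μ₀] g) : IsQuasi l u u1 p p1 g where
  d0 := h.d0
  d1 := h.d1
  d2 := h.d2
  ac := h.ac
  d3 := by
    rw [EventuallyEq, ae_restrict_iff' measurableSet_Ioi] at hfg
    filter_upwards [h.d3, hfg] with r h1 h2 hr
    rw [← h2 hr]; exact h1 hr

lemma add (h : IsQuasi l u u1 p p1 f) (k : IsQuasi l v v1 s s1 g) :
    IsQuasi l (u + v) (u1 + v1) (p + s) (p1 + s1) (f + g) where
  d0 r hr := (h.d0 r hr).add (k.d0 r hr)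
  d1 r hr := ((h.d1 r hr).add (k.d1 r hr)).congr_deriv (by simp only [Pi.add_apply]; ring)
  d2 r hr := (h.d2 r hr).add (k.d2 r hr)
  ac x y hx hy := (h.ac x y hx hy).add (k.ac x y hx hy)
  d3 := by
    filter_upwards [h.d3, k.d3] with r h1 h2 hr
    exact ((h1 hr).add (h2 hr)).congr_deriv (by simp only [Pi.add_apply]; ring)

lemma smul (h : IsQuasi l u u1 p p1 f) (c : ℂ) :
    IsQuasi l (c • u) (c • u1) (c • p) (c • p1) (c • f) where
  d0 r hr := (h.d0 r hr).const_smul c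
  d1 r hr := ((h.d1 r hr).const_smul c).congr_deriv
    (by simp only [Pi.smul_apply, smul_eq_mul]; ring)
  d2 r hr := (h.d2 r hr).const_smul c
  ac x y hx hy := (h.ac x y hx hy).const_smul c
  d3 := by
    filter_upwards [h.d3] with r h1 hr
    exact ((h1 hr).const_smul c).congr_deriv (by simp only [Pi.smul_apply, smul_eq_mul]; ring)

lemma conj_pot (l : ℕ) (r : ℝ) : (starRingEnd ℂ) (pot l r) = pot l r := by
  simp [pot]

lemma conj (h : IsQuasi l u u1 p p1 f) :
    IsQuasi l (fun r => starRingEnd ℂ (u r)) (fun r => starRingEnd ℂ (u1 r))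
      (fun r => starRingEnd ℂ (p r)) (fun r => starRingEnd ℂ (p1 r))
      (fun r => starRingEnd ℂ (f r)) where
  d0 r hr := hasDerivAt_conj (h.d0 r hr)
  d1 r hr := (hasDerivAt_conj (h.d1 r hr)).congr_deriv (by simp [conj_pot])
  d2 r hr := hasDerivAt_conj (h.d2 r hr)
  ac x y hx hy := absCont_conj (h.ac x y hx hy)
  d3 := by
    filter_upwards [h.d3] with r h1 hr
    exact (hasDerivAt_conj (h1 hr)).congr_deriv (by simp [conj_pot])

end IsQuasi

lemma FiniteGraphNorm.isQuasi {l : ℕ} {u : ℝ → ℂ} (h : FiniteGraphNorm l u) :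
    IsQuasi l u (deriv u) (radialOp l u) (deriv (radialOp l u)) (radialOp l (radialOp l u)) := by
  have c1 : ContDiffOn ℝ 2 (deriv u) (Ioi 0) := h.contDiffOn.deriv_of_isOpen isOpen_Ioi (by norm_num)
  have c2 : ContDiffOn ℝ 1 (deriv (deriv u)) (Ioi 0) := c1.deriv_of_isOpen isOpen_Ioi (by norm_num)
  have d0 : ∀ r : ℝ, 0 < r → HasDerivAt u (deriv u r) r := fun r hr =>
    ((h.contDiffOn.differentiableOn (by norm_num)).differentiableAt
      (isOpen_Ioi.mem_nhds hr)).hasDerivAt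
  have d1 : ∀ r : ℝ, 0 < r → HasDerivAt (deriv u) (deriv (deriv u) r) r := fun r hr =>
    ((c1.differentiableOn (by norm_num)).differentiableAt (isOpen_Ioi.mem_nhds hr)).hasDerivAt
  have d2 : ∀ r : ℝ, 0 < r → HasDerivAt (deriv (deriv u)) (iteratedDeriv 3 u r) r := fun r hr => by
    rw [iteratedDeriv_succ, iteratedDeriv_succ, iteratedDeriv_one]
    exact ((c2.differentiableOn (by norm_num)).differentiableAt
      (isOpen_Ioi.mem_nhds hr)).hasDerivAt
  have dp : ∀ r : ℝ, 0 < r → HasDerivAt (radialOp l u)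
      (-iteratedDeriv 3 u r + (pot1 l r * u r + pot l r * deriv u r)) r := fun r hr =>
    (d2 r hr).neg.add ((hasDerivAt_pot l hr).mul (d0 r hr))
  have ac : ∀ x y : ℝ, 0 < x → 0 < y →
      AbsolutelyContinuousOnInterval (deriv (radialOp l u)) x y := by
    intro x y hx hy
    have hpot : ContDiffOn ℝ 1 (pot l) (Ioi 0) := contDiffOn_const_div_pow _ 2
    have hpot1 : ContDiffOn ℝ 1 (pot1 l) (Ioi 0) := contDiffOn_const_div_pow _ 3
    have hsub := uIcc_subset_Ioi hx hy
    have c3 : ContDiffOn ℝ 1 (fun r => pot1 l r * u r + pot l r * deriv u r) (Ioi 0) :=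
      (hpot1.mul (h.contDiffOn.of_le (by norm_num))).add (hpot.mul (c1.of_le (by norm_num)))
    have a3 : AbsolutelyContinuousOnInterval (iteratedDeriv 3 u) x y := by
      rcases lt_trichotomy x y with hxy | hxy | hxy
      · exact h.absCont x y hx hxy
      · subst hxy
        exact (h.absCont x (x + 1) hx (by linarith)).mono
          (by rw [uIcc_self]; simp)
      · exact (h.absCont y x hy hxy).symm
    refine absCont_congr (a3.neg.add (c3.mono hsub).absolutelyContinuousOnInterval) fun r hr => ?_
    exact (dp r (hsub hr)).deriv.symm
  refine ⟨d0, fun r hr => (d1 r hr).congr_deriv ?_,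
    fun r hr => (dp r hr).differentiableAt.hasDerivAt, ac, ?_⟩
  · rw [radialOp_eq]; ring
  · refine ae_pos_of_forall_uIcc fun x y hx hy => ?_
    filter_upwards [absCont_ae_differentiableAt (ac x y hx hy)] with r h1 hr
    refine (h1 hr).hasDerivAt.congr_deriv ?_
    rw [radialOp_eq l (radialOp l u)]; ring

/-! ### The Lagrange bracket -/

/-- The Lagrange bracket `p' v - p v' + u' s - u s'` of two functions with quasi-derivatives
`(u, u1, p, p1)` and `(v, v1, s, s1)`, where `p = T_l u` and `s = T_l v`. -/
def bracket (u u1 p p1 v v1 s s1 : ℝ → ℂ) (r : ℝ) : ℂ :=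
  p1 r * v r - p r * v1 r + u1 r * s r - u r * s1 r

/-- Lagrange's identity in integrated form. -/
lemma bracket_ftc {l : ℕ} {u u1 p p1 f v v1 s s1 g : ℝ → ℂ} (h : IsQuasi l u u1 p p1 f)
    (k : IsQuasi l v v1 s s1 g) {x y : ℝ} (hx : 0 < x) (hy : 0 < y) :
    IntervalIntegrable (fun r => u r * g r - f r * v r) volume x y ∧
    ∫ r in x..y, (u r * g r - f r * v r) =
      bracket u u1 p p1 v v1 s s1 y - bracket u u1 p p1 v v1 s s1 x := by
  refine absCont_ftc ((((absCont_mul (h.ac x y hx hy) (k.absCont_u hx hy)).sub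
    (absCont_mul (h.absCont_p hx hy) (k.absCont_u1 hx hy))).add
    (absCont_mul (h.absCont_u1 hx hy) (k.absCont_p hx hy))).sub
    (absCont_mul (h.absCont_u hx hy) (k.ac x y hx hy))) ?_
  filter_upwards [h.d3, k.d3] with r h3 k3 hr
  have hr0 : 0 < r := uIcc_subset_Ioi hx hy hr
  refine (((((h3 hr0).mul (k.d0 r hr0)).sub ((h.d2 r hr0).mul (k.d1 r hr0))).add
    ((h.d1 r hr0).mul (k.d2 r hr0))).sub ((h.d0 r hr0).mul (k3 hr0))).congr_deriv ?_
  ring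

/-! ### Decay at infinity -/

lemma intervalIntegrable_of_memLp {u : ℝ → ℂ} (hu : MemLp u 2 μ₀) {x y : ℝ} (hx : 0 ≤ x)
    (hy : 0 ≤ y) : IntervalIntegrable u volume x y := by
  rw [intervalIntegrable_iff]
  have hsub : uIoc x y ⊆ Ioi 0 := fun z hz => lt_of_le_of_lt (le_min hx hy) hz.1
  have h1 : MemLp u 2 (volume.restrict (uIoc x y)) :=
    hu.mono_measure (Measure.restrict_mono hsub le_rfl)
  have : IsFiniteMeasure (volume.restrict (uIoc x y)) := by
    rw [uIoc]; infer_instance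
  exact h1.integrable (by norm_num)

lemma integrableOn_norm_sq {u : ℝ → ℂ} (hu : MemLp u 2 μ₀) :
    IntegrableOn (fun r => ‖u r‖ ^ 2) (Ioi 0) :=
  (memLp_two_iff_integrable_sq_norm hu.1).1 hu

lemma tendsto_integral_norm_unit {u : ℝ → ℂ} (hu : MemLp u 2 μ₀) :
    Tendsto (fun x : ℝ => ∫ r in x..(x + 1), ‖u r‖) atTop (𝓝 0) := by
  have hsq := integrableOn_norm_sq hu
  have h1 : Tendsto (fun x : ℝ => ∫ r in (0 : ℝ)..x, ‖u r‖ ^ 2) atTop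
      (𝓝 (∫ r in Ioi 0, ‖u r‖ ^ 2)) :=
    intervalIntegral_tendsto_integral_Ioi 0 hsq tendsto_id
  have h2 : Tendsto (fun x : ℝ => ∫ r in x..(x + 1), ‖u r‖ ^ 2) atTop (𝓝 0) := by
    have h3 := (h1.comp (tendsto_atTop_add_const_right atTop 1 tendsto_id)).sub h1
    rw [sub_self] at h3
    refine h3.congr' ?_
    filter_upwards [eventually_ge_atTop 0] with x hx
    have i1 : IntervalIntegrable (fun r => ‖u r‖ ^ 2) volume 0 x :=
      (intervalIntegrable_iff_integrableOn_Ioc_of_le hx).2 (hsq.mono_set Ioc_subset_Ioi_self)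
    have i2 : IntervalIntegrable (fun r => ‖u r‖ ^ 2) volume 0 (x + 1) :=
      (intervalIntegrable_iff_integrableOn_Ioc_of_le (by linarith)).2
        (hsq.mono_set Ioc_subset_Ioi_self)
    exact intervalIntegral.integral_interval_sub_left i2 i1
  rw [Metric.tendsto_atTop]
  intro ε hε
  have h4 : ∀ᶠ x : ℝ in atTop, ∫ r in x..(x + 1), ‖u r‖ ^ 2 < ε ^ 2 := by
    filter_upwards [h2.eventually (gt_mem_nhds (show (0 : ℝ) < ε ^ 2 by positivity))] with x hx
    exact hx
  obtain ⟨N, hN⟩ := (h4.and (eventually_ge_atTop 0)).exists_forall_of_atTop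
  refine ⟨N, fun x hx => ?_⟩
  obtain ⟨hlt, hx0⟩ := hN x hx
  have i0 := (intervalIntegrable_of_memLp hu hx0 (show (0 : ℝ) ≤ x + 1 by linarith)).norm
  have i2 : IntervalIntegrable (fun r => ‖u r‖ ^ 2) volume x (x + 1) :=
    (intervalIntegrable_iff_integrableOn_Ioc_of_le (by linarith)).2
      (hsq.mono_set fun z hz => lt_of_le_of_lt hx0 hz.1)
  -- the inequality `‖u‖ ≤ ε / 2 + ‖u‖² / (2 ε)`, integrated over an interval of length one
  have h5 : ∫ r in x..(x + 1), ‖u r‖ ≤ ∫ r in x..(x + 1), (ε / 2 + (1 / (2 * ε)) * ‖u r‖ ^ 2) := by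
    refine intervalIntegral.integral_mono_on (by linarith) i0
      (intervalIntegrable_const.add (i2.const_mul _)) fun r _ => ?_
    have : ε / 2 + 1 / (2 * ε) * ‖u r‖ ^ 2 - ‖u r‖ = (1 / (2 * ε)) * (‖u r‖ - ε) ^ 2 := by
      field_simp; ring
    have h6 : 0 ≤ (1 / (2 * ε)) * (‖u r‖ - ε) ^ 2 := by positivity
    linarith
  rw [intervalIntegral.integral_add intervalIntegrable_const (i2.const_mul _),
    intervalIntegral.integral_const, intervalIntegral.integral_const_mul] at h5
  have h7 : 1 / (2 * ε) * ∫ r in x..(x + 1), ‖u r‖ ^ 2 < 1 / (2 * ε) * ε ^ 2 :=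
    mul_lt_mul_of_pos_left hlt (by positivity)
  have h8 : 1 / (2 * ε) * ε ^ 2 = ε / 2 := by field_simp
  have h9 : 0 ≤ ∫ r in x..(x + 1), ‖u r‖ :=
    intervalIntegral.integral_nonneg (by linarith) fun r _ => norm_nonneg _
  rw [Real.dist_eq, sub_zero, abs_of_nonneg h9]
  simp only [smul_eq_mul, add_sub_cancel_left, one_mul] at h5
  linarith

/-- The second derivative of the centrifugal potential. -/
noncomputable def pot2 (l : ℕ) (r : ℝ) : ℂ := 6 * ((l : ℂ) * ((l : ℂ) + 1)) / (r : ℂ) ^ 4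

lemma hasDerivAt_pot1 (l : ℕ) {r : ℝ} (hr : 0 < r) : HasDerivAt (pot1 l) (pot2 l r) r := by
  have hr' : (r : ℂ) ≠ 0 := by exact_mod_cast hr.ne'
  have h1 : HasDerivAt (fun x : ℝ => (x : ℂ) ^ 3) (3 * (r : ℂ) ^ 2) r := by
    simpa using (hasDerivAt_id r).ofReal_comp.fun_pow 3
  have := (h1.inv (pow_ne_zero 3 hr')).const_mul (-2 * ((l : ℂ) * ((l : ℂ) + 1)))
  refine (this.congr_of_eventuallyEq (Eventually.of_forall fun y => ?_)).congr_deriv ?_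
  · simp [pot1, div_eq_mul_inv]
  · simp only [pot2]; field_simp; ring

lemma continuousOn_pot2 (l : ℕ) : ContinuousOn (pot2 l) (Ioi 0) :=
  (contDiffOn_const_div_pow _ 4).continuousOn

/-- The quasi-derivatives of a function with four continuous derivatives. -/
lemma isQuasi_of_hasDerivAt (l : ℕ) {m m1 m2 m3 m4 : ℝ → ℂ}
    (h0 : ∀ r : ℝ, 0 < r → HasDerivAt m (m1 r) r) (h1 : ∀ r : ℝ, 0 < r → HasDerivAt m1 (m2 r) r)
    (h2 : ∀ r : ℝ, 0 < r → HasDerivAt m2 (m3 r) r) (h3 : ∀ r : ℝ, 0 < r → HasDerivAt m3 (m4 r) r)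
    (hc : ContinuousOn m4 (Ioi 0)) :
    IsQuasi l m m1 (fun r => pot l r * m r - m2 r)
      (fun r => pot1 l r * m r + pot l r * m1 r - m3 r)
      (fun r => pot l r * (pot l r * m r - m2 r) -
        (pot2 l r * m r + 2 * (pot1 l r * m1 r) + pot l r * m2 r - m4 r)) := by
  have d3 : ∀ r : ℝ, 0 < r → HasDerivAt (fun r => pot1 l r * m r + pot l r * m1 r - m3 r)
      (pot2 l r * m r + pot1 l r * m1 r + (pot1 l r * m1 r + pot l r * m2 r) - m4 r) r :=
    fun r hr => (((hasDerivAt_pot1 l hr).mul (h0 r hr)).add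
      ((hasDerivAt_pot l hr).mul (h1 r hr))).sub (h3 r hr)
  have cm : ContinuousOn m (Ioi 0) := fun r hr => (h0 r hr).continuousAt.continuousWithinAt
  have cm1 : ContinuousOn m1 (Ioi 0) := fun r hr => (h1 r hr).continuousAt.continuousWithinAt
  have cm2 : ContinuousOn m2 (Ioi 0) := fun r hr => (h2 r hr).continuousAt.continuousWithinAt
  refine ⟨h0, fun r hr => (h1 r hr).congr_deriv (by ring),
    fun r hr => ((hasDerivAt_pot l hr).mul (h0 r hr)).sub (h2 r hr), fun x y hx hy => ?_,
    ae_of_all _ fun r hr => (d3 r hr).congr_deriv (by ring)⟩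
  have hsub := uIcc_subset_Ioi hx hy
  refine absCont_of_hasDerivAt (fun r hr => d3 r (hsub hr)) (ContinuousOn.mono ?_ hsub)
  exact ((((continuousOn_pot2 l).mul cm).add ((continuousOn_pot1 l).mul cm1)).add
    (((continuousOn_pot1 l).mul cm1).add ((continuousOn_pot l).mul cm2))).sub hc

open Polynomial in
lemma hasDerivAt_poly (M : ℂ[X]) (x r : ℝ) :
    HasDerivAt (fun r : ℝ => M.eval ((r : ℂ) - (x : ℂ)))
      ((derivative M).eval ((r : ℂ) - (x : ℂ))) r := by
  have h1 : HasDerivAt (fun r : ℝ => (r : ℂ) - (x : ℂ)) 1 r := by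
    simpa using (hasDerivAt_id r).ofReal_comp.sub_const (x : ℂ)
  exact ((M.hasDerivAt ((r : ℂ) - (x : ℂ))).comp_of_eq r h1 rfl).congr_deriv (mul_one _)

lemma norm_const_div_pow_le (c : ℂ) (n : ℕ) {r : ℝ} (hr : 1 ≤ r) : ‖c / (r : ℂ) ^ n‖ ≤ ‖c‖ := by
  rw [norm_div, norm_pow, Complex.norm_real, Real.norm_of_nonneg (by linarith)]
  exact div_le_self (norm_nonneg _) (one_le_pow₀ hr)

open Polynomial in
lemma exists_bound_poly (M : ℂ[X]) : ∃ K : ℝ, 0 ≤ K ∧ ∀ s : ℝ, s ∈ Icc (0 : ℝ) 1 →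
    ‖M.eval (s : ℂ)‖ ≤ K := by
  have hc : ContinuousOn (fun s : ℝ => M.eval (s : ℂ)) (Icc 0 1) := by fun_prop
  obtain ⟨K, hK⟩ := isCompact_Icc.exists_bound_of_continuousOn hc
  exact ⟨max K 0, le_max_right _ _, fun s hs => (hK s hs).trans (le_max_left _ _)⟩

open Polynomial in
/-- Testing the equation on `[x, x + 1]` with a polynomial in `r - x` that vanishes to fourth order
at the right end point: the bracket at the left end point tends to `0`, since the integrals of `|u|`
and `|f|` over `[x, x + 1]` do. -/
lemma tendsto_bracket_poly {l : ℕ} {u u1 p p1 f : ℝ → ℂ} (h : IsQuasi l u u1 p p1 f)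
    (hu : MemLp u 2 μ₀) (hf : MemLp f 2 μ₀) (M : ℂ[X]) (e0 : M.eval 1 = 0)
    (e1 : (derivative M).eval 1 = 0) (e2 : (derivative (derivative M)).eval 1 = 0)
    (e3 : (derivative (derivative (derivative M))).eval 1 = 0) :
    Tendsto (fun x : ℝ => p1 x * M.eval 0 - p x * (derivative M).eval 0 +
      u1 x * (pot l x * M.eval 0 - (derivative (derivative M)).eval 0) -
      u x * (pot1 l x * M.eval 0 + pot l x * (derivative M).eval 0 -
        (derivative (derivative (derivative M))).eval 0)) atTop (𝓝 0) := by
  obtain ⟨K0, hK0, B0⟩ := exists_bound_poly M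
  obtain ⟨K1, hK1, B1⟩ := exists_bound_poly (derivative M)
  obtain ⟨K2, hK2, B2⟩ := exists_bound_poly (derivative (derivative M))
  obtain ⟨K4, hK4, B4⟩ := exists_bound_poly (derivative (derivative (derivative (derivative M))))
  set c : ℝ := ‖(l : ℂ) * ((l : ℂ) + 1)‖
  set c1 : ℝ := ‖-2 * ((l : ℂ) * ((l : ℂ) + 1))‖
  set c2 : ℝ := ‖6 * ((l : ℂ) * ((l : ℂ) + 1))‖
  set C : ℝ := c * (c * K0 + K2) + (c2 * K0 + 2 * (c1 * K1) + c * K2 + K4)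
  have hlim : Tendsto (fun x : ℝ => C * (∫ r in x..(x + 1), ‖u r‖) +
      K0 * ∫ r in x..(x + 1), ‖f r‖) atTop (𝓝 0) := by
    simpa using ((tendsto_integral_norm_unit hu).const_mul C).add
      ((tendsto_integral_norm_unit hf).const_mul K0)
  refine squeeze_zero_norm' ?_ hlim
  filter_upwards [eventually_ge_atTop 1] with x hx
  have hx0 : 0 < x := by linarith
  have hx1 : 0 < x + 1 := by linarith
  have hq := isQuasi_of_hasDerivAt l (fun r _ => hasDerivAt_poly M x r)
    (fun r _ => hasDerivAt_poly _ x r) (fun r _ => hasDerivAt_poly _ x r)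
    (fun r _ => hasDerivAt_poly _ x r) (by fun_prop)
  obtain ⟨hint, hftc⟩ := bracket_ftc h hq hx0 hx1
  have hb1 : ∀ (m m1 m2 m3 : ℝ → ℂ), m (x + 1) = 0 → m1 (x + 1) = 0 → m2 (x + 1) = 0 →
      m3 (x + 1) = 0 → bracket u u1 p p1 m m1 m2 m3 (x + 1) = 0 := by
    intro m m1 m2 m3 a0 a1 a2 a3
    simp [bracket, a0, a1, a2, a3]
  have es : ((x + 1 : ℝ) : ℂ) - (x : ℂ) = 1 := by push_cast; ring
  rw [hb1 _ _ _ _ (by rw [es, e0]) (by rw [es, e1]) (by rw [es, e0, e2]; ring)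
    (by rw [es, e0, e1, e3]; ring)] at hftc
  simp only [bracket, sub_self, zero_sub] at hftc
  rw [← norm_neg, ← hftc]
  have iu := (intervalIntegrable_of_memLp hu hx0.le hx1.le).norm
  have jf := (intervalIntegrable_of_memLp hf hx0.le hx1.le).norm
  rw [← intervalIntegral.integral_const_mul, ← intervalIntegral.integral_const_mul,
    ← intervalIntegral.integral_add (iu.const_mul C) (jf.const_mul K0)]
  refine intervalIntegral.norm_integral_le_of_norm_le (by linarith) ?_
    ((iu.const_mul C).add (jf.const_mul K0))
  refine ae_of_all _ fun r hr => ?_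
  have hr1 : 1 ≤ r := hx.trans hr.1.le
  have hs : r - x ∈ Icc (0 : ℝ) 1 := ⟨by linarith [hr.1], by linarith [hr.2]⟩
  have q0 : ‖pot l r‖ ≤ c := norm_const_div_pow_le _ 2 hr1
  have q1 : ‖pot1 l r‖ ≤ c1 := norm_const_div_pow_le _ 3 hr1
  have q2 : ‖pot2 l r‖ ≤ c2 := norm_const_div_pow_le _ 4 hr1
  have b0 := B0 _ hs
  have b1 := B1 _ hs
  have b2 := B2 _ hs
  have b4 := B4 _ hs
  rw [Complex.ofReal_sub] at b0 b1 b2 b4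
  refine (norm_sub_le _ _).trans (add_le_add ?_ ?_)
  · rw [norm_mul, mul_comm]
    refine mul_le_mul_of_nonneg_right ?_ (norm_nonneg _)
    refine (norm_sub_le _ _).trans (add_le_add ?_ ?_)
    · rw [norm_mul]
      refine mul_le_mul q0 ((norm_sub_le _ _).trans (add_le_add ?_ b2)) (norm_nonneg _)
        (norm_nonneg _)
      rw [norm_mul]
      exact mul_le_mul q0 b0 (norm_nonneg _) (norm_nonneg _)
    · refine (norm_sub_le _ _).trans (add_le_add ((norm_add_le _ _).trans
        (add_le_add ((norm_add_le _ _).trans (add_le_add ?_ ?_)) ?_)) b4)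
      · rw [norm_mul]; exact mul_le_mul q2 b0 (norm_nonneg _) (norm_nonneg _)
      · rw [norm_mul, norm_mul, Complex.norm_two]
        exact mul_le_mul_of_nonneg_left (mul_le_mul q1 b1 (norm_nonneg _) (norm_nonneg _))
          (by norm_num)
      · rw [norm_mul]; exact mul_le_mul q0 b2 (norm_nonneg _) (norm_nonneg _)
  · rw [norm_mul, mul_comm]
    exact mul_le_mul_of_nonneg_right b0 (norm_nonneg _)

lemma tendsto_const_div_pow (c : ℂ) {n : ℕ} (hn : n ≠ 0) :
    Tendsto (fun r : ℝ => c / (r : ℂ) ^ n) atTop (𝓝 0) := by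
  rw [tendsto_zero_iff_norm_tendsto_zero]
  have h1 : Tendsto (fun r : ℝ => ‖c‖ / r ^ n) atTop (𝓝 0) :=
    (tendsto_pow_atTop hn).const_div_atTop _
  refine h1.congr' ?_
  filter_upwards [eventually_ge_atTop 0] with r hr
  rw [norm_div, norm_pow, Complex.norm_real, Real.norm_of_nonneg hr]

open Polynomial in
/-- All quasi-derivatives of a function of finite graph norm tend to `0` at infinity. -/
lemma tendsto_atTop_of_isQuasi {l : ℕ} {u u1 p p1 f : ℝ → ℂ} (h : IsQuasi l u u1 p p1 f)
    (hu : MemLp u 2 μ₀) (hf : MemLp f 2 μ₀) :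
    Tendsto u atTop (𝓝 0) ∧ Tendsto u1 atTop (𝓝 0) ∧ Tendsto p atTop (𝓝 0) ∧
      Tendsto p1 atTop (𝓝 0) := by
  have q0 : Tendsto (pot l) atTop (𝓝 0) := tendsto_const_div_pow _ (by norm_num)
  have q1 : Tendsto (pot1 l) atTop (𝓝 0) := tendsto_const_div_pow _ (by norm_num)
  -- the four polynomials have a triangular matrix of derivatives at `0`
  set E : ℂ[X] := (1 - X) * (1 - X) * ((1 - X) * (1 - X)) with hE
  have t3 := tendsto_bracket_poly h hu hf (X * X * X * E) (by simp [hE]) (by simp [hE])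
    (by simp [hE]) (by simp [hE])
  have t2 := tendsto_bracket_poly h hu hf (X * X * E) (by simp [hE]) (by simp [hE])
    (by simp [hE]) (by simp [hE])
  have t1 := tendsto_bracket_poly h hu hf (X * E) (by simp [hE]) (by simp [hE])
    (by simp [hE]) (by simp [hE])
  have t0 := tendsto_bracket_poly h hu hf E (by simp [hE]) (by simp [hE])
    (by simp [hE]) (by simp [hE])
  have a0 : Tendsto u atTop (𝓝 0) := by
    have := t3.const_mul (1 / 6 : ℂ)
    rw [mul_zero] at this
    refine this.congr fun x => ?_
    simp [hE]; ring
  have a1 : Tendsto u1 atTop (𝓝 0) := by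
    have := (t2.const_mul (-1 / 2 : ℂ)).add (a0.const_mul (-12))
    simp only [mul_zero, add_zero] at this
    refine this.congr fun x => ?_
    simp [hE]; ring
  have a2 : Tendsto p atTop (𝓝 0) := by
    have := ((t1.const_mul (-1 : ℂ)).add (a1.const_mul 8)).sub (a0.mul (q0.sub_const 36))
    simp only [mul_zero, zero_mul, add_zero, sub_zero] at this
    refine this.congr fun x => ?_
    simp [hE]; ring
  have a3 : Tendsto p1 atTop (𝓝 0) := by
    have := ((t0.sub (a2.const_mul 4)).sub (a1.mul (q0.sub_const 12))).add
      (a0.mul ((q1.sub (q0.const_mul 4)).add_const 24))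
    simp only [mul_zero, zero_mul, add_zero, sub_zero] at this
    refine this.congr fun x => ?_
    simp [hE]; ring
  exact ⟨a0, a1, a2, a3⟩

/-- The Lagrange bracket of two functions of finite graph norm vanishes at infinity. -/
lemma tendsto_bracket_atTop {l : ℕ} {u u1 p p1 f v v1 s s1 g : ℝ → ℂ}
    (h : IsQuasi l u u1 p p1 f) (hu : MemLp u 2 μ₀) (hf : MemLp f 2 μ₀)
    (k : IsQuasi l v v1 s s1 g) (hv : MemLp v 2 μ₀) (hg : MemLp g 2 μ₀) :
    Tendsto (bracket u u1 p p1 v v1 s s1) atTop (𝓝 0) := by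
  obtain ⟨a0, a1, a2, a3⟩ := tendsto_atTop_of_isQuasi h hu hf
  obtain ⟨b0, b1, b2, b3⟩ := tendsto_atTop_of_isQuasi k hv hg
  have := (((a3.mul b0).sub (a2.mul b1)).add (a1.mul b2)).sub (a0.mul b3)
  simp only [mul_zero, sub_zero, add_zero] at this
  exact this

/-! ### Behaviour at the origin -/

lemma tendsto_integral_zero_right {g : ℝ → ℂ} (hg : IntervalIntegrable g volume 0 1) :
    Tendsto (fun r : ℝ => ∫ s in (0 : ℝ)..r, ‖g s‖) (𝓝[>] 0) (𝓝 0) := by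
  have hc : ContinuousOn (fun r : ℝ => ∫ s in (0 : ℝ)..r, ‖g s‖) (uIcc 0 1) :=
    intervalIntegral.continuousOn_primitive_interval' hg.norm left_mem_uIcc
  have h0 := hc 0 left_mem_uIcc
  rw [ContinuousWithinAt, intervalIntegral.integral_same, uIcc_of_le zero_le_one] at h0
  exact h0.mono_left (nhdsWithin_le_of_mem (Icc_mem_nhdsGT one_pos))

lemma tendsto_ofReal_pow (n : ℕ) :
    Tendsto (fun r : ℝ => (r : ℂ) ^ n) (𝓝[>] 0) (𝓝 ((0 : ℂ) ^ n)) := by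
  have : Continuous fun r : ℝ => (r : ℂ) ^ n := by fun_prop
  simpa using (this.tendsto 0).mono_left nhdsWithin_le_nhds

/-- A function with derivative `-g s ^ n` near the origin converges, with error `o(r ^ n)`. -/
lemma exists_limit_of_increment {g G : ℝ → ℂ} (hg : IntervalIntegrable g volume 0 1) (n : ℕ)
    (hG : ∀ x y : ℝ, 0 < x → 0 < y → G y - G x = -∫ s in x..y, g s * (s : ℂ) ^ n) :
    ∃ L : ℂ, Tendsto G (𝓝[>] 0) (𝓝 L) ∧
      Tendsto (fun r : ℝ => (G r - L) / (r : ℂ) ^ n) (𝓝[>] 0) (𝓝 0) := by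
  have hgn : IntervalIntegrable (fun s => g s * (s : ℂ) ^ n) volume 0 1 :=
    hg.mul_continuousOn (by fun_prop)
  set L : ℂ := G 1 + ∫ s in (0 : ℝ)..1, g s * (s : ℂ) ^ n
  have sub : ∀ r ∈ Ioo (0 : ℝ) 1, uIcc 0 r ⊆ uIcc 0 1 := fun r hr =>
    uIcc_subset_uIcc left_mem_uIcc ⟨by simpa using hr.1.le, by simpa using hr.2.le⟩
  have e : ∀ r ∈ Ioo (0 : ℝ) 1, G r - L = -∫ s in (0 : ℝ)..r, g s * (s : ℂ) ^ n := by
    intro r hr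
    have h1 := hG r 1 hr.1 one_pos
    have i1 := hgn.mono_set (sub r hr)
    have h2 := intervalIntegral.integral_interval_sub_left hgn i1
    simp only [L]
    linear_combination -h1 - h2
  have hmem : ∀ᶠ r : ℝ in 𝓝[>] 0, r ∈ Ioo (0 : ℝ) 1 := Ioo_mem_nhdsGT one_pos
  have hlim : Tendsto (fun r : ℝ => (G r - L) / (r : ℂ) ^ n) (𝓝[>] 0) (𝓝 0) := by
    refine squeeze_zero_norm' ?_ (tendsto_integral_zero_right hg)
    filter_upwards [hmem] with r hr
    rw [e r hr, norm_div, norm_neg, norm_pow, Complex.norm_real, Real.norm_of_nonneg hr.1.le,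
      div_le_iff₀ (pow_pos hr.1 n), mul_comm, ← intervalIntegral.integral_const_mul]
    refine intervalIntegral.norm_integral_le_of_norm_le hr.1.le (ae_of_all _ fun s hs => ?_)
      (((hg.mono_set (sub r hr)).norm).const_mul _)
    rw [norm_mul, norm_pow, Complex.norm_real, Real.norm_of_nonneg hs.1.le, mul_comm]
    exact mul_le_mul_of_nonneg_right (pow_le_pow_left₀ hs.1.le hs.2 n) (norm_nonneg _)
  refine ⟨L, ?_, hlim⟩
  have h1 := (hlim.mul (tendsto_ofReal_pow n)).add_const L
  rw [zero_mul, zero_add] at h1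
  refine h1.congr' ?_
  filter_upwards [hmem] with r hr
  have hr' : (r : ℂ) ≠ 0 := by exact_mod_cast hr.1.ne'
  field_simp
  ring

/-- A function with derivative `-g / s ^ n` near the origin is `o(r ^ (-n))`. -/
lemma tendsto_of_increment_div {g G : ℝ → ℂ} (hg : IntervalIntegrable g volume 0 1) {n : ℕ}
    (hn : n ≠ 0)
    (hG : ∀ x y : ℝ, 0 < x → 0 < y → G y - G x = -∫ s in x..y, g s * ((s : ℂ) ^ n)⁻¹) :
    Tendsto (fun r : ℝ => G r * (r : ℂ) ^ n) (𝓝[>] 0) (𝓝 0) := by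
  have hg' : Integrable g (volume.restrict (Ioc 0 1)) :=
    (intervalIntegrable_iff_integrableOn_Ioc_of_le zero_le_one).1 hg
  -- `r ^ n ∫_r^1 g / s ^ n` tends to `0` by dominated convergence, as `(r / s) ^ n ≤ 1`
  have hdct : Tendsto (fun r : ℝ => ∫ s in Ioc (0 : ℝ) 1,
      (Ioc r 1).indicator (fun s => (r : ℂ) ^ n * (g s * ((s : ℂ) ^ n)⁻¹)) s) (𝓝[>] 0)
      (𝓝 (∫ _ in Ioc (0 : ℝ) 1, (0 : ℂ))) := by
    refine tendsto_integral_filter_of_dominated_convergence (fun s => ‖g s‖) ?_ ?_ hg'.norm ?_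
    · refine Eventually.of_forall fun r => AEStronglyMeasurable.indicator ?_ measurableSet_Ioc
      refine (hg'.1.mul ?_).const_mul _
      exact (Measurable.inv (by fun_prop)).aestronglyMeasurable
    · filter_upwards [self_mem_nhdsWithin] with r hr
      have hr0 : 0 < r := hr
      refine ae_of_all _ fun s => ?_
      by_cases hs : s ∈ Ioc r 1
      · have hs0 : 0 < s := hr0.trans hs.1
        rw [indicator_of_mem hs, norm_mul, norm_mul, norm_inv, norm_pow, norm_pow,
          Complex.norm_real, Complex.norm_real, Real.norm_of_nonneg hr0.le,
          Real.norm_of_nonneg hs0.le]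
        have h1 : r ^ n * (s ^ n)⁻¹ ≤ 1 := by
          rw [← div_eq_mul_inv]
          exact div_le_one_of_le₀ (pow_le_pow_left₀ hr0.le hs.1.le n) (by positivity)
        calc r ^ n * (‖g s‖ * (s ^ n)⁻¹) = (r ^ n * (s ^ n)⁻¹) * ‖g s‖ := by ring
          _ ≤ 1 * ‖g s‖ := mul_le_mul_of_nonneg_right h1 (norm_nonneg _)
          _ = ‖g s‖ := one_mul _
      · rw [indicator_of_notMem hs]; simp
    · refine (ae_restrict_mem measurableSet_Ioc).mono fun s hs => ?_
      have h1 : Tendsto (fun r : ℝ => (r : ℂ) ^ n * (g s * ((s : ℂ) ^ n)⁻¹)) (𝓝[>] 0) (𝓝 0) := by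
        have := (tendsto_ofReal_pow n).mul_const (g s * ((s : ℂ) ^ n)⁻¹)
        rwa [zero_pow hn, zero_mul] at this
      refine h1.congr' ?_
      filter_upwards [Ioo_mem_nhdsGT hs.1] with r hr
      rw [indicator_of_mem (show s ∈ Ioc r 1 from ⟨hr.2, hs.2⟩)]
  rw [integral_zero] at hdct
  have h1 := ((tendsto_ofReal_pow n).const_mul (G 1)).add hdct
  rw [zero_pow hn, mul_zero, zero_add] at h1
  refine h1.congr' ?_
  filter_upwards [Ioo_mem_nhdsGT (show (0 : ℝ) < 1 from one_pos)] with r hr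
  have h2 := hG r 1 hr.1 one_pos
  rw [integral_indicator measurableSet_Ioc, Measure.restrict_restrict measurableSet_Ioc,
    inter_eq_left.2 (Ioc_subset_Ioc_left hr.1.le), integral_const_mul,
    ← intervalIntegral.integral_of_le hr.2.le]
  linear_combination (r : ℂ) ^ n * h2

/-- A square integrable function cannot behave like a negative power at the origin. -/
lemma eq_zero_of_tendsto_mul_pow {u : ℝ → ℂ} (hu : MemLp u 2 μ₀) {n : ℕ} (hn : n ≠ 0) {c : ℂ}
    (h : Tendsto (fun r : ℝ => u r * (r : ℂ) ^ n) (𝓝[>] 0) (𝓝 c)) : c = 0 := by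
  by_contra hc
  have hc0 : 0 < ‖c‖ := norm_pos_iff.2 hc
  have h1 : ∀ᶠ r : ℝ in 𝓝[>] 0, ‖c‖ / 2 < ‖u r * (r : ℂ) ^ n‖ :=
    h.norm.eventually (lt_mem_nhds (by linarith))
  obtain ⟨δ, hδ, H⟩ := (mem_nhdsGT_iff_exists_Ioo_subset).1
    (h1.and (Ioo_mem_nhdsGT (show (0 : ℝ) < 1 from one_pos)))
  have hδ0 : 0 < δ := hδ
  have hsq : IntegrableOn (fun r => ‖u r‖ ^ 2) (Ioo 0 δ) :=
    (integrableOn_norm_sq hu).mono_set Ioo_subset_Ioi_self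
  have hinv : IntegrableOn (fun r : ℝ => r ^ (-1 : ℝ)) (Ioo 0 δ) := by
    refine Integrable.mono' (hsq.const_mul (4 / ‖c‖ ^ 2))
      ((measurable_id.pow_const _).aestronglyMeasurable) ?_
    refine (ae_restrict_mem measurableSet_Ioo).mono fun r hr => ?_
    obtain ⟨hr1, hr2⟩ := H hr
    rw [norm_mul, norm_pow, Complex.norm_real, Real.norm_of_nonneg hr.1.le] at hr1
    rw [Real.rpow_neg_one, Real.norm_of_nonneg (inv_nonneg.2 hr.1.le)]
    have h2 : r ^ n ≤ r := by
      calc r ^ n ≤ r ^ 1 := pow_le_pow_of_le_one hr.1.le hr2.2.le (Nat.one_le_iff_ne_zero.2 hn)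
        _ = r := pow_one r
    have h3 : ‖c‖ / 2 ≤ ‖u r‖ * r :=
      hr1.le.trans (mul_le_mul_of_nonneg_left h2 (norm_nonneg _))
    have h4 : (‖c‖ / 2) ^ 2 ≤ (‖u r‖ * r) ^ 2 := pow_le_pow_left₀ (by positivity) h3 2
    have h5 : (‖u r‖ * r) ^ 2 ≤ ‖u r‖ ^ 2 * r := by
      have : r * r ≤ r * 1 := mul_le_mul_of_nonneg_left hr2.2.le hr.1.le
      nlinarith [sq_nonneg ‖u r‖]
    rw [inv_le_iff_one_le_mul₀ hr.1, div_mul_eq_mul_div, div_mul_eq_mul_div,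
      le_div_iff₀ (by positivity)]
    nlinarith
  rw [intervalIntegral.integrableOn_Ioo_rpow_iff hδ0] at hinv
  exact lt_irrefl _ hinv

/-! ### Homogeneous solutions -/

lemma hasDerivAt_ofReal_zpow (a : ℤ) {r : ℝ} (hr : 0 < r) :
    HasDerivAt (fun r : ℝ => (r : ℂ) ^ a) (a * (r : ℂ) ^ (a - 1)) r := by
  have hr' : (r : ℂ) ≠ 0 := by exact_mod_cast hr.ne'
  exact (hasDerivAt_zpow a (r : ℂ) (Or.inl hr')).comp_ofReal

lemma pot_mul_zpow (l : ℕ) (a : ℤ) {r : ℝ} (hr : 0 < r) :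
    pot l r * (r : ℂ) ^ a = (l : ℂ) * ((l : ℂ) + 1) * (r : ℂ) ^ (a - 2) := by
  have hr' : (r : ℂ) ≠ 0 := by exact_mod_cast hr.ne'
  rw [zpow_sub₀ hr', pot]
  norm_cast
  field_simp

/-- The factor `l (l + 1) - a (a - 1)` in `T_l r ^ a = (l (l + 1) - a (a - 1)) r ^ (a - 2)`. -/
noncomputable def powFactor (l : ℕ) (a : ℤ) : ℂ := (l : ℂ) * ((l : ℂ) + 1) - a * (a - 1)

/-- The quasi-derivatives of a power. It solves the homogeneous equation if one of the two factors
vanishes. -/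
lemma isQuasi_zpow (l : ℕ) (a : ℤ) :
    IsQuasi l (fun r => (r : ℂ) ^ a) (fun r => a * (r : ℂ) ^ (a - 1))
      (fun r => powFactor l a * (r : ℂ) ^ (a - 2))
      (fun r => powFactor l a * ((a - 2) * (r : ℂ) ^ (a - 3)))
      (fun r => powFactor l a * (powFactor l (a - 2) * (r : ℂ) ^ (a - 4))) := by
  have e1 : a - 1 - 1 = a - 2 := by ring
  have e2 : a - 2 - 1 = a - 3 := by ring
  have e3 : a - 3 - 1 = a - 4 := by ring
  have e4 : a - 2 - 2 = a - 4 := by ring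
  have d3 : ∀ r : ℝ, 0 < r → HasDerivAt (fun r : ℝ => powFactor l a * ((a - 2) * (r : ℂ) ^ (a - 3)))
      (powFactor l a * ((a - 2) * ((a - 3) * (r : ℂ) ^ (a - 4)))) r := fun r hr => by
    have := ((hasDerivAt_ofReal_zpow (a - 3) hr).const_mul ((a : ℂ) - 2)).const_mul (powFactor l a)
    rw [e3] at this
    exact this.congr_deriv (by push_cast; ring)
  refine ⟨fun r hr => hasDerivAt_ofReal_zpow a hr, fun r hr => ?_, fun r hr => ?_,
    fun x y hx hy => ?_, ae_of_all _ fun r hr => (d3 r hr).congr_deriv ?_⟩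
  · have := (hasDerivAt_ofReal_zpow (a - 1) hr).const_mul (a : ℂ)
    rw [e1] at this
    refine this.congr_deriv ?_
    rw [pot_mul_zpow l a hr, powFactor]; push_cast; ring
  · have := (hasDerivAt_ofReal_zpow (a - 2) hr).const_mul (powFactor l a)
    rw [e2] at this
    exact this.congr_deriv (by push_cast; ring)
  · refine absCont_of_hasDerivAt (fun r hr => d3 r (uIcc_subset_Ioi hx hy hr)) ?_
    refine ContinuousOn.mono (fun r hr => ?_) (uIcc_subset_Ioi hx hy)
    have := (hasDerivAt_ofReal_zpow (a - 4) hr).continuousAt.continuousWithinAt (s := Ioi 0)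
    exact (((this.const_mul _).const_mul _).const_mul _)
  · rw [mul_left_comm (pot l r), pot_mul_zpow l _ hr, e4]
    simp only [powFactor]; push_cast; ring

/-- The bracket of a function having quasi-derivatives `u, u1, p, p1` with the power `r ^ a`. -/
noncomputable def powBracket (l : ℕ) (a : ℤ) (u u1 p p1 : ℝ → ℂ) : ℝ → ℂ :=
  bracket u u1 p p1 (fun r => (r : ℂ) ^ a) (fun r => a * (r : ℂ) ^ (a - 1))
    (fun r => powFactor l a * (r : ℂ) ^ (a - 2))
    (fun r => powFactor l a * ((a - 2) * (r : ℂ) ^ (a - 3)))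

/-- The bracket with a homogeneous solution `r ^ a` has the derivative `-f r ^ a`. -/
lemma powBracket_increment {l : ℕ} {u u1 p p1 f : ℝ → ℂ} (h : IsQuasi l u u1 p p1 f) {a : ℤ}
    (ha : powFactor l a * powFactor l (a - 2) = 0) {x y : ℝ} (hx : 0 < x) (hy : 0 < y) :
    powBracket l a u u1 p p1 y - powBracket l a u u1 p p1 x =
      -∫ r in x..y, f r * (r : ℂ) ^ a := by
  rw [powBracket, ← (bracket_ftc h (isQuasi_zpow l a) hx hy).2, ← intervalIntegral.integral_neg]
  congr 1
  ext r
  rw [← mul_assoc (powFactor l a), ha]; ring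

lemma exists_limit_powBracket {l : ℕ} {u u1 p p1 f : ℝ → ℂ} (h : IsQuasi l u u1 p p1 f)
    (hf : MemLp f 2 μ₀) (n : ℕ) (ha : powFactor l n * powFactor l (n - 2) = 0) :
    ∃ L : ℂ, Tendsto (powBracket l n u u1 p p1) (𝓝[>] 0) (𝓝 L) ∧
      Tendsto (fun r : ℝ => (powBracket l n u u1 p p1 r - L) / (r : ℂ) ^ n) (𝓝[>] 0) (𝓝 0) := by
  refine exists_limit_of_increment (intervalIntegrable_of_memLp hf le_rfl zero_le_one) n
    fun x y hx hy => ?_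
  simpa using powBracket_increment h ha hx hy

lemma tendsto_powBracket_neg {l : ℕ} {u u1 p p1 f : ℝ → ℂ} (h : IsQuasi l u u1 p p1 f)
    (hf : MemLp f 2 μ₀) {n : ℕ} (hn : n ≠ 0)
    (ha : powFactor l (-n) * powFactor l (-n - 2) = 0) :
    Tendsto (fun r : ℝ => powBracket l (-n) u u1 p p1 r * (r : ℂ) ^ n) (𝓝[>] 0) (𝓝 0) := by
  refine tendsto_of_increment_div (intervalIntegrable_of_memLp hf le_rfl zero_le_one) hn
    fun x y hx hy => ?_
  simpa using powBracket_increment h ha hx hy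

/-- Variation of constants for `l = 1`: the coefficients of `u` with respect to the homogeneous
solutions `r ^ 2`, `r`, `r ^ (-1)`, `r ^ 4` are multiples of the brackets of `u` with the dual
solutions `r`, `r ^ 2`, `r ^ 4`, `r ^ (-1)`. -/
structure ExpansionOne (u u1 p p1 A B C D : ℝ → ℂ) (A0 B0 : ℂ) : Prop where
  tA : Tendsto A (𝓝[>] 0) (𝓝 A0)
  tB : Tendsto B (𝓝[>] 0) (𝓝 B0)
  tC : Tendsto (fun r : ℝ => C r / (r : ℂ) ^ 4) (𝓝[>] 0) (𝓝 0)
  tD : Tendsto (fun r : ℝ => D r * (r : ℂ)) (𝓝[>] 0) (𝓝 0)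
  eu : ∀ r : ℝ, 0 < r → u r = A r * (r : ℂ) ^ 2 + B r * r + C r / r + D r * (r : ℂ) ^ 4
  eu1 : ∀ r : ℝ, 0 < r → u1 r = 2 * A r * r + B r - C r / (r : ℂ) ^ 2 + 4 * D r * (r : ℂ) ^ 3
  ep : ∀ r : ℝ, 0 < r → p r = 2 * B r / r - 10 * D r * (r : ℂ) ^ 2
  ep1 : ∀ r : ℝ, 0 < r → p1 r = -2 * B r / (r : ℂ) ^ 2 - 20 * D r * r

/-- Variation of constants for `l = 2`: the coefficients of `u` with respect to the homogeneous
solutions `r ^ 3`, `1`, `r ^ (-2)`, `r ^ 5` are multiples of the brackets of `u` with the dual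
solutions `1`, `r ^ 3`, `r ^ 5`, `r ^ (-2)`. -/
structure ExpansionTwo (u u1 p p1 A B C D : ℝ → ℂ) (A0 B0 : ℂ) : Prop where
  tA : Tendsto A (𝓝[>] 0) (𝓝 A0)
  tB : Tendsto B (𝓝[>] 0) (𝓝 B0)
  tC : Tendsto (fun r : ℝ => C r / (r : ℂ) ^ 5) (𝓝[>] 0) (𝓝 0)
  tD : Tendsto (fun r : ℝ => D r * (r : ℂ) ^ 2) (𝓝[>] 0) (𝓝 0)
  eu : ∀ r : ℝ, 0 < r → u r = A r * (r : ℂ) ^ 3 + B r + C r / (r : ℂ) ^ 2 + D r * (r : ℂ) ^ 5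
  eu1 : ∀ r : ℝ, 0 < r →
    u1 r = 3 * A r * (r : ℂ) ^ 2 - 2 * C r / (r : ℂ) ^ 3 + 5 * D r * (r : ℂ) ^ 4
  ep : ∀ r : ℝ, 0 < r → p r = 6 * B r / (r : ℂ) ^ 2 - 14 * D r * (r : ℂ) ^ 3
  ep1 : ∀ r : ℝ, 0 < r → p1 r = -12 * B r / (r : ℂ) ^ 3 - 42 * D r * (r : ℂ) ^ 2

/-- The four brackets determine `u, u1, p, p1`. Since `f` is square integrable, the first two have
limits at `0`; the bracket with `r ^ 4` also has a limit, which vanishes because `r ^ (-1)` is not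
square integrable. -/
lemma exists_expansionOne {u u1 p p1 f : ℝ → ℂ} (h : IsQuasi 1 u u1 p p1 f)
    (hu : MemLp u 2 μ₀) (hf : MemLp f 2 μ₀) :
    ∃ A B C D : ℝ → ℂ, ∃ A0 B0 : ℂ, ExpansionOne u u1 p p1 A B C D A0 B0 := by
  obtain ⟨LA, hA, -⟩ := exists_limit_powBracket h hf 1 (by norm_num [powFactor])
  obtain ⟨LB, hB, -⟩ := exists_limit_powBracket h hf 2 (by norm_num [powFactor])
  obtain ⟨LC, hC, hC'⟩ := exists_limit_powBracket h hf 4 (by norm_num [powFactor])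
  have hD := tendsto_powBracket_neg h hf (n := 1) one_ne_zero (by norm_num [powFactor])
  have eu : ∀ r : ℝ, 0 < r → u r = powBracket 1 (1 : ℕ) u u1 p p1 r / 6 * (r : ℂ) ^ 2 +
      -powBracket 1 (2 : ℕ) u u1 p p1 r / 6 * r + powBracket 1 (4 : ℕ) u u1 p p1 r / 30 / r +
      -powBracket 1 (-(1 : ℕ)) u u1 p p1 r / 30 * (r : ℂ) ^ 4 := by
    intro r hr
    have hr' : (r : ℂ) ≠ 0 := by exact_mod_cast hr.ne'
    norm_num [powBracket, bracket, powFactor, zpow_neg]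
    field_simp
    ring
  -- a non-zero limit of the coefficient of `1 / r` would contradict square integrability
  have hLC : LC / 30 = 0 := by
    refine eq_zero_of_tendsto_mul_pow hu one_ne_zero ?_
    have p1 := tendsto_ofReal_pow 3
    have p2 := tendsto_ofReal_pow 2
    have p4 := tendsto_ofReal_pow 4
    have := (((hA.mul p1).div_const 6).sub ((hB.mul p2).div_const 6)).add
      ((hC.div_const 30).sub ((hD.mul p4).div_const 30))
    norm_num at this
    refine this.congr' ?_
    filter_upwards [self_mem_nhdsWithin] with r hr
    have hr' : (r : ℂ) ≠ 0 := by exact_mod_cast (ne_of_gt hr : r ≠ 0)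
    rw [eu r hr]
    field_simp
    push_cast
    ring
  have hLC0 : LC = 0 := by simpa using hLC
  refine ⟨_, _, _, _, LA / 6, -LB / 6, hA.div_const 6, hB.neg.div_const 6, ?_, ?_, eu, ?_, ?_, ?_⟩
  · have := hC'.div_const 30
    rw [hLC0, zero_div] at this
    refine this.congr fun r => ?_
    rw [sub_zero, div_right_comm]
  · have := hD.neg.div_const 30
    rw [neg_zero, zero_div] at this
    refine this.congr fun r => ?_
    ring
  all_goals
    intro r hr
    have hr' : (r : ℂ) ≠ 0 := by exact_mod_cast hr.ne'
    norm_num [powBracket, bracket, powFactor, zpow_neg]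
    field_simp
    ring

/-- The analogue of `exists_expansionOne` for `l = 2`. -/
lemma exists_expansionTwo {u u1 p p1 f : ℝ → ℂ} (h : IsQuasi 2 u u1 p p1 f)
    (hu : MemLp u 2 μ₀) (hf : MemLp f 2 μ₀) :
    ∃ A B C D : ℝ → ℂ, ∃ A0 B0 : ℂ, ExpansionTwo u u1 p p1 A B C D A0 B0 := by
  obtain ⟨LA, hA, -⟩ := exists_limit_powBracket h hf 0 (by norm_num [powFactor])
  obtain ⟨LB, hB, -⟩ := exists_limit_powBracket h hf 3 (by norm_num [powFactor])
  obtain ⟨LC, hC, hC'⟩ := exists_limit_powBracket h hf 5 (by norm_num [powFactor])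
  have hD := tendsto_powBracket_neg h hf (n := 2) two_ne_zero (by norm_num [powFactor])
  have eu : ∀ r : ℝ, 0 < r → u r = powBracket 2 (0 : ℕ) u u1 p p1 r / 30 * (r : ℂ) ^ 3 +
      -powBracket 2 (3 : ℕ) u u1 p p1 r / 30 + powBracket 2 (5 : ℕ) u u1 p p1 r / 70 / (r : ℂ) ^ 2 +
      -powBracket 2 (-(2 : ℕ)) u u1 p p1 r / 70 * (r : ℂ) ^ 5 := by
    intro r hr
    have hr' : (r : ℂ) ≠ 0 := by exact_mod_cast hr.ne'
    norm_num [powBracket, bracket, powFactor, zpow_neg]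
    field_simp
    ring
  -- a non-zero limit of the coefficient of `1 / r ^ 2` would contradict square integrability
  have hLC : LC / 70 = 0 := by
    refine eq_zero_of_tendsto_mul_pow hu two_ne_zero ?_
    have p1 := tendsto_ofReal_pow 5
    have p2 := tendsto_ofReal_pow 2
    have := (((hA.mul p1).div_const 30).sub ((hB.mul p2).div_const 30)).add
      ((hC.div_const 70).sub ((hD.mul p1).div_const 70))
    norm_num at this
    refine this.congr' ?_
    filter_upwards [self_mem_nhdsWithin] with r hr
    have hr' : (r : ℂ) ≠ 0 := by exact_mod_cast (ne_of_gt hr : r ≠ 0)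
    rw [eu r hr]
    field_simp
    push_cast
    ring
  have hLC0 : LC = 0 := by simpa using hLC
  refine ⟨_, _, _, _, LA / 30, -LB / 30, hA.div_const 30, hB.neg.div_const 30, ?_, ?_, eu,
    ?_, ?_, ?_⟩
  · have := hC'.div_const 70
    rw [hLC0, zero_div] at this
    refine this.congr fun r => ?_
    rw [sub_zero, div_right_comm]
  · have := hD.neg.div_const 70
    rw [neg_zero, zero_div] at this
    refine this.congr fun r => ?_
    ring
  all_goals
    intro r hr
    have hr' : (r : ℂ) ≠ 0 := by exact_mod_cast hr.ne'
    norm_num [powBracket, bracket, powFactor, zpow_neg]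
    field_simp
    ring

/-! ### Boundary values and Green's formula -/

/-- The vector of boundary values `u(0), u'(0), u''(0), u'''(0)` of a function of finite graph norm
in terms of the two that need not vanish: `β = u'(0)`, `α = u''(0)` if `l = 1` and `β = u(0)`,
`α = u'''(0)` if `l = 2`. -/
def bvec (l : ℕ) (β α : ℂ) : Fin 4 → ℂ := if l = 1 then ![0, β, α, 0] else ![β, 0, 0, α]

lemma bvec_injective (l : ℕ) {β α β' α' : ℂ} (h : bvec l β α = bvec l β' α') :
    β = β' ∧ α = α' := by
  unfold bvec at h
  split_ifs at h
  · exact ⟨congrFun h 1, congrFun h 2⟩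
  · exact ⟨congrFun h 0, congrFun h 3⟩

lemma bvec_zero (l : ℕ) : bvec l 0 0 = 0 := by
  unfold bvec
  split_ifs <;> (ext i; fin_cases i <;> rfl)

lemma HasBoundaryValues.unique {u : ℝ → ℂ} {b c : Fin 4 → ℂ} (h : HasBoundaryValues u b)
    (k : HasBoundaryValues u c) : b = c :=
  funext fun i => tendsto_nhds_unique (h i) (k i)

lemma HasBoundaryValues.congr {u v : ℝ → ℂ} {b : Fin 4 → ℂ} (h : HasBoundaryValues u b)
    (e : EqOn u v (Ioi 0)) : HasBoundaryValues v b := by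
  intro k
  refine (h k).congr' ?_
  filter_upwards [self_mem_nhdsWithin] with r hr
  exact (EventuallyEq.iteratedDeriv_eq _ (e.eventuallyEq_of_mem (isOpen_Ioi.mem_nhds hr)))

lemma IsQuasi.hasBoundaryValues {l : ℕ} {u u1 p p1 f : ℝ → ℂ} (h : IsQuasi l u u1 p p1 f)
    {b0 b1 b2 b3 : ℂ} (t0 : Tendsto u (𝓝[>] 0) (𝓝 b0)) (t1 : Tendsto u1 (𝓝[>] 0) (𝓝 b1))
    (t2 : Tendsto (fun r => pot l r * u r - p r) (𝓝[>] 0) (𝓝 b2))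
    (t3 : Tendsto (fun r => pot1 l r * u r + pot l r * u1 r - p1 r) (𝓝[>] 0) (𝓝 b3)) :
    HasBoundaryValues u ![b0, b1, b2, b3] := by
  have key : ∀ {v w : ℝ → ℂ} {b : ℂ}, Tendsto v (𝓝[>] 0) (𝓝 b) → EqOn w v (Ioi 0) →
      Tendsto w (𝓝[>] 0) (𝓝 b) := fun hv e =>
    hv.congr' ((e.eventuallyEq_of_mem self_mem_nhdsWithin).symm)
  intro k
  fin_cases k
  · simpa using t0
  · refine key t1 ?_
    change EqOn (iteratedDeriv 1 u) u1 (Ioi 0)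
    rw [iteratedDeriv_one]; exact h.deriv_u
  · exact key t2 h.iteratedDeriv_two
  · exact key t3 h.iteratedDeriv_three

lemma IsQuasi.hasBoundaryValues_conj {l : ℕ} {u u1 p p1 f : ℝ → ℂ} (h : IsQuasi l u u1 p p1 f)
    {b : Fin 4 → ℂ} (hb : HasBoundaryValues u b) :
    HasBoundaryValues (fun r => starRingEnd ℂ (u r)) (fun i => starRingEnd ℂ (b i)) := by
  have key : ∀ {v w : ℝ → ℂ} {c : ℂ}, Tendsto v (𝓝[>] 0) (𝓝 c) →
      EqOn w (fun r => starRingEnd ℂ (v r)) (Ioi 0) →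
      Tendsto w (𝓝[>] 0) (𝓝 (starRingEnd ℂ c)) := fun hv e =>
    ((Complex.continuous_conj.tendsto _).comp hv).congr'
      ((e.eventuallyEq_of_mem self_mem_nhdsWithin).symm)
  have pot1c : ∀ r, starRingEnd ℂ (pot1 l r) = pot1 l r := fun r => by simp [pot1, map_ofNat]
  intro k
  refine key (hb k) fun r hr => ?_
  fin_cases k
  · simp
  · simp only [iteratedDeriv_one]
    rw [h.deriv_u hr, h.conj.deriv_u hr]
  · change iteratedDeriv 2 _ r = starRingEnd ℂ (iteratedDeriv 2 u r)
    rw [h.iteratedDeriv_two hr, h.conj.iteratedDeriv_two hr]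
    simp [IsQuasi.conj_pot]
  · change iteratedDeriv 3 _ r = starRingEnd ℂ (iteratedDeriv 3 u r)
    rw [h.iteratedDeriv_three hr, h.conj.iteratedDeriv_three hr]
    simp [IsQuasi.conj_pot, pot1c]

lemma conj_bvec (l : ℕ) (β α : ℂ) :
    (fun i => starRingEnd ℂ (bvec l β α i)) = bvec l (starRingEnd ℂ β) (starRingEnd ℂ α) := by
  unfold bvec
  split_ifs <;> (ext i; fin_cases i <;> simp)

lemma ExpansionOne.hasBoundaryValues {u u1 p p1 f A B C D : ℝ → ℂ} {A0 B0 : ℂ}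
    (h : IsQuasi 1 u u1 p p1 f) (E : ExpansionOne u u1 p p1 A B C D A0 B0) :
    HasBoundaryValues u (bvec 1 B0 (2 * A0)) := by
  have q1 := tendsto_ofReal_pow 1
  have q2 := tendsto_ofReal_pow 2
  have q3 := tendsto_ofReal_pow 3
  simp only [ne_eq, one_ne_zero, not_false_eq_true, zero_pow, OfNat.ofNat_ne_zero] at q1 q2 q3
  have main : HasBoundaryValues u ![0, B0, 2 * A0, 0] := by
    refine h.hasBoundaryValues ?_ ?_ ?_ ?_
    · have := (((E.tA.mul q2).add (E.tB.mul q1)).add (E.tC.mul q3)).add (E.tD.mul q3)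
      simp only [mul_zero, add_zero] at this
      refine this.congr' ?_
      filter_upwards [self_mem_nhdsWithin] with r hr
      have hr' : (r : ℂ) ≠ 0 := by exact_mod_cast (ne_of_gt hr : r ≠ 0)
      rw [E.eu r hr]; field_simp
    · have := (((E.tA.mul q1).const_mul 2).add E.tB).add
        ((E.tD.mul (q2.const_mul 4)).sub (E.tC.mul q2))
      simp only [mul_zero, add_zero, sub_zero, zero_add] at this
      refine this.congr' ?_
      filter_upwards [self_mem_nhdsWithin] with r hr
      have hr' : (r : ℂ) ≠ 0 := by exact_mod_cast (ne_of_gt hr : r ≠ 0)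
      rw [E.eu1 r hr]; field_simp; ring
    · have := (E.tA.const_mul 2).add ((E.tC.mul (q1.const_mul 2)).add (E.tD.mul (q1.const_mul 12)))
      simp only [mul_zero, add_zero] at this
      refine this.congr' ?_
      filter_upwards [self_mem_nhdsWithin] with r hr
      have hr' : (r : ℂ) ≠ 0 := by exact_mod_cast (ne_of_gt hr : r ≠ 0)
      rw [E.eu r hr, E.ep r hr, pot]; push_cast; field_simp; ring
    · have := (E.tD.const_mul 24).sub (E.tC.const_mul 6)
      simp only [mul_zero, sub_zero] at this
      refine this.congr' ?_
      filter_upwards [self_mem_nhdsWithin] with r hr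
      have hr' : (r : ℂ) ≠ 0 := by exact_mod_cast (ne_of_gt hr : r ≠ 0)
      rw [E.eu r hr, E.eu1 r hr, E.ep1 r hr, pot, pot1]; push_cast; field_simp; ring
  simpa [bvec] using main

lemma ExpansionTwo.hasBoundaryValues {u u1 p p1 f A B C D : ℝ → ℂ} {A0 B0 : ℂ}
    (h : IsQuasi 2 u u1 p p1 f) (E : ExpansionTwo u u1 p p1 A B C D A0 B0) :
    HasBoundaryValues u (bvec 2 B0 (6 * A0)) := by
  have q1 := tendsto_ofReal_pow 1
  have q2 := tendsto_ofReal_pow 2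
  have q3 := tendsto_ofReal_pow 3
  simp only [ne_eq, one_ne_zero, not_false_eq_true, zero_pow, OfNat.ofNat_ne_zero] at q1 q2 q3
  have main : HasBoundaryValues u ![B0, 0, 0, 6 * A0] := by
    refine h.hasBoundaryValues ?_ ?_ ?_ ?_
    · have := (((E.tA.mul q3).add E.tB).add (E.tC.mul q3)).add (E.tD.mul q3)
      simp only [mul_zero, add_zero, zero_add] at this
      refine this.congr' ?_
      filter_upwards [self_mem_nhdsWithin] with r hr
      have hr' : (r : ℂ) ≠ 0 := by exact_mod_cast (ne_of_gt hr : r ≠ 0)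
      rw [E.eu r hr]; field_simp
    · have := ((E.tA.mul q2).const_mul 3).add ((E.tD.mul (q2.const_mul 5)).sub
        (E.tC.mul (q2.const_mul 2)))
      simp only [mul_zero, add_zero, sub_zero] at this
      refine this.congr' ?_
      filter_upwards [self_mem_nhdsWithin] with r hr
      have hr' : (r : ℂ) ≠ 0 := by exact_mod_cast (ne_of_gt hr : r ≠ 0)
      rw [E.eu1 r hr]; field_simp; ring
    · have := ((E.tA.mul q1).const_mul 6).add
        ((E.tC.mul (q1.const_mul 6)).add (E.tD.mul (q1.const_mul 20)))
      simp only [mul_zero, add_zero] at this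
      refine this.congr' ?_
      filter_upwards [self_mem_nhdsWithin] with r hr
      have hr' : (r : ℂ) ≠ 0 := by exact_mod_cast (ne_of_gt hr : r ≠ 0)
      rw [E.eu r hr, E.ep r hr, pot]; push_cast; field_simp; ring
    · have := (E.tA.const_mul 6).add ((E.tD.const_mul 60).sub (E.tC.const_mul 24))
      simp only [mul_zero, sub_zero, add_zero] at this
      refine this.congr' ?_
      filter_upwards [self_mem_nhdsWithin] with r hr
      have hr' : (r : ℂ) ≠ 0 := by exact_mod_cast (ne_of_gt hr : r ≠ 0)
      rw [E.eu r hr, E.eu1 r hr, E.ep1 r hr, pot, pot1]; push_cast; field_simp; ring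
  simpa [bvec] using main

/-- Functions of finite graph norm have boundary values, of which only two can be non-zero. -/
lemma exists_boundaryValues {l : ℕ} (hl : l = 1 ∨ l = 2) {u u1 p p1 f : ℝ → ℂ}
    (h : IsQuasi l u u1 p p1 f) (hu : MemLp u 2 μ₀) (hf : MemLp f 2 μ₀) :
    ∃ β α : ℂ, HasBoundaryValues u (bvec l β α) := by
  rcases hl with rfl | rfl
  · obtain ⟨A, B, C, D, A0, B0, E⟩ := exists_expansionOne h hu hf
    exact ⟨_, _, E.hasBoundaryValues h⟩
  · obtain ⟨A, B, C, D, A0, B0, E⟩ := exists_expansionTwo h hu hf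
    exact ⟨_, _, E.hasBoundaryValues h⟩

/-- The limit of the Lagrange bracket at the origin is a symplectic form in the boundary values: the
bracket is constant on pairs of homogeneous solutions, and only `r ^ (l + 1)` and `r ^ (2 - l)`
contribute in the limit. -/
lemma tendsto_bracket_zero {l : ℕ} (hl : l = 1 ∨ l = 2) {u u1 p p1 f v v1 s s1 g : ℝ → ℂ}
    (h : IsQuasi l u u1 p p1 f) (hu : MemLp u 2 μ₀) (hf : MemLp f 2 μ₀)
    (k : IsQuasi l v v1 s s1 g) (hv : MemLp v 2 μ₀) (hg : MemLp g 2 μ₀) {β α β' α' : ℂ}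
    (hb : HasBoundaryValues u (bvec l β α)) (hb' : HasBoundaryValues v (bvec l β' α')) :
    Tendsto (bracket u u1 p p1 v v1 s s1) (𝓝[>] 0)
      (𝓝 ((2 * l + 1) * (α * β' - β * α'))) := by
  have q1 := tendsto_ofReal_pow 1
  have q3 := tendsto_ofReal_pow 3
  simp only [ne_eq, one_ne_zero, not_false_eq_true, zero_pow, OfNat.ofNat_ne_zero] at q1 q3
  rcases hl with rfl | rfl
  · obtain ⟨A, B, C, D, A0, B0, E⟩ := exists_expansionOne h hu hf
    obtain ⟨A', B', C', D', A0', B0', E'⟩ := exists_expansionOne k hv hg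
    obtain ⟨rfl, rfl⟩ := bvec_injective 1 (hb.unique (E.hasBoundaryValues h))
    obtain ⟨rfl, rfl⟩ := bvec_injective 1 (hb'.unique (E'.hasBoundaryValues k))
    have := (((E.tA.mul E'.tB).sub (E.tB.mul E'.tA)).const_mul 6).add
      ((((E.tC.mul E'.tD).sub (E.tD.mul E'.tC)).const_mul 30).mul q3)
    simp only [mul_zero, add_zero] at this
    have e : (2 * ((1 : ℕ) : ℂ) + 1) * (2 * A0 * β' - β * (2 * A0')) =
      6 * (A0 * β' - β * A0') := by push_cast; ring
    rw [e]
    refine this.congr' ?_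
    filter_upwards [self_mem_nhdsWithin] with r hr
    have hr' : (r : ℂ) ≠ 0 := by exact_mod_cast (ne_of_gt hr : r ≠ 0)
    rw [bracket, E.eu r hr, E.eu1 r hr, E.ep r hr, E.ep1 r hr, E'.eu r hr, E'.eu1 r hr,
      E'.ep r hr, E'.ep1 r hr]
    field_simp
    ring
  · obtain ⟨A, B, C, D, A0, B0, E⟩ := exists_expansionTwo h hu hf
    obtain ⟨A', B', C', D', A0', B0', E'⟩ := exists_expansionTwo k hv hg
    obtain ⟨rfl, rfl⟩ := bvec_injective 2 (hb.unique (E.hasBoundaryValues h))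
    obtain ⟨rfl, rfl⟩ := bvec_injective 2 (hb'.unique (E'.hasBoundaryValues k))
    have := (((E.tA.mul E'.tB).sub (E.tB.mul E'.tA)).const_mul 30).add
      ((((E.tC.mul E'.tD).sub (E.tD.mul E'.tC)).const_mul 70).mul q3)
    simp only [mul_zero, add_zero] at this
    have e : (2 * ((2 : ℕ) : ℂ) + 1) * (6 * A0 * β' - β * (6 * A0')) =
      30 * (A0 * β' - β * A0') := by push_cast; ring
    rw [e]
    refine this.congr' ?_
    filter_upwards [self_mem_nhdsWithin] with r hr
    have hr' : (r : ℂ) ≠ 0 := by exact_mod_cast (ne_of_gt hr : r ≠ 0)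
    rw [bracket, E.eu r hr, E.eu1 r hr, E.ep r hr, E.ep1 r hr, E'.eu r hr, E'.eu1 r hr,
      E'.ep r hr, E'.ep1 r hr]
    field_simp
    ring

lemma integrableOn_mul {u v : ℝ → ℂ} (hu : MemLp u 2 μ₀) (hv : MemLp v 2 μ₀) :
    IntegrableOn (fun r => u r * v r) (Ioi 0) := MemLp.integrable_mul hu hv

/-- Green's formula, in bilinear form. -/
lemma integral_green {l : ℕ} (hl : l = 1 ∨ l = 2) {u u1 p p1 f v v1 s s1 g : ℝ → ℂ}
    (h : IsQuasi l u u1 p p1 f) (hu : MemLp u 2 μ₀) (hf : MemLp f 2 μ₀)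
    (k : IsQuasi l v v1 s s1 g) (hv : MemLp v 2 μ₀) (hg : MemLp g 2 μ₀) {β α β' α' : ℂ}
    (hb : HasBoundaryValues u (bvec l β α)) (hb' : HasBoundaryValues v (bvec l β' α')) :
    ∫ r in Ioi (0 : ℝ), (u r * g r - f r * v r) = (2 * l + 1) * (β * α' - α * β') := by
  have hint : IntegrableOn (fun r => u r * g r - f r * v r) (Ioi 0) :=
    (integrableOn_mul hu hg).sub (integrableOn_mul hf hv)
  set W := bracket u u1 p p1 v v1 s s1
  have t0 := tendsto_bracket_zero hl h hu hf k hv hg hb hb'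
  have tinf : Tendsto W atTop (𝓝 0) := tendsto_bracket_atTop h hu hf k hv hg
  -- the identity on `(x, ∞)`, followed by `x → 0`
  have h1 : ∀ x : ℝ, 0 < x → ∫ r in Ioi x, (u r * g r - f r * v r) = -W x := by
    intro x hx
    have i1 := intervalIntegral_tendsto_integral_Ioi x
      (hint.mono_set (Ioi_subset_Ioi hx.le)) tendsto_id
    have i2 : Tendsto (fun y => W y - W x) atTop (𝓝 (0 - W x)) := tinf.sub_const _
    rw [zero_sub] at i2
    refine tendsto_nhds_unique i1 (i2.congr' ?_)
    filter_upwards [eventually_gt_atTop 0] with y hy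
    exact (bracket_ftc h k hx hy).2.symm
  have h2 : Tendsto (fun x : ℝ => ∫ r in Ioi x, (u r * g r - f r * v r)) (𝓝[>] 0)
      (𝓝 (∫ r in Ioi (0 : ℝ), (u r * g r - f r * v r))) := by
    have hloc : IntervalIntegrable (fun r => u r * g r - f r * v r) volume 0 1 :=
      (intervalIntegrable_iff_integrableOn_Ioc_of_le zero_le_one).2
        (hint.mono_set Ioc_subset_Ioi_self)
    have hc := intervalIntegral.continuousOn_primitive_interval' hloc left_mem_uIcc
    have h0 := hc 0 left_mem_uIcc
    rw [ContinuousWithinAt, intervalIntegral.integral_same, uIcc_of_le zero_le_one] at h0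
    have h3 := (h0.mono_left (nhdsWithin_le_of_mem (Icc_mem_nhdsGT one_pos))).const_sub
      (∫ r in Ioi (0 : ℝ), (u r * g r - f r * v r))
    rw [sub_zero] at h3
    refine h3.congr' ?_
    filter_upwards [Ioo_mem_nhdsGT one_pos] with x hx
    have := intervalIntegral.integral_Ioi_sub_Ioi' hint (hint.mono_set (Ioi_subset_Ioi hx.1.le))
    rw [← this]; ring
  have h3 := tendsto_nhds_unique h2 (t0.neg.congr' (by
    filter_upwards [self_mem_nhdsWithin] with x hx
    exact (h1 x hx).symm))
  rw [h3]; ring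

/-- Green's formula for `T_l²`. -/
lemma inner_green {l : ℕ} (hl : l = 1 ∨ l = 2) {u v : ℝ → ℂ} (hu : FiniteGraphNorm l u)
    (hv : FiniteGraphNorm l v) {x y x' y' : HSpace} (hx : x =ᵐ[μ₀] u)
    (hy : y =ᵐ[μ₀] radialOp l (radialOp l u)) (hx' : x' =ᵐ[μ₀] v)
    (hy' : y' =ᵐ[μ₀] radialOp l (radialOp l v)) {β α β' α' : ℂ}
    (hb : HasBoundaryValues u (bvec l β α)) (hb' : HasBoundaryValues v (bvec l β' α')) :
    inner ℂ x y' - inner ℂ y x' =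
      (2 * l + 1) * (starRingEnd ℂ β * α' - starRingEnd ℂ α * β') := by
  have hq := hu.isQuasi
  have hbc := hq.hasBoundaryValues_conj hb
  rw [conj_bvec] at hbc
  have := integral_green hl hq.conj hu.memLp.star hu.memLp_sq.star hv.isQuasi hv.memLp hv.memLp_sq
    hbc hb'
  rw [← this, L2.inner_def, L2.inner_def,
    ← integral_sub (L2.integrable_inner x y') (L2.integrable_inner y x')]
  refine integral_congr_ae ?_
  filter_upwards [hx, hy, hx', hy'] with r h1 h2 h3 h4
  rw [h1, h2, h3, h4]
  simp only [RCLike.inner_apply]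
  ring

/-! ### Test functions -/

/-- Smooth functions with compact support in `(0, ∞)`. -/
def testFun : Submodule ℂ (ℝ → ℂ) where
  carrier := {φ | ContDiff ℝ ∞ φ ∧ ∃ a b : ℝ, 0 < a ∧ a ≤ b ∧ ∀ r ∉ Icc a b, φ r = 0}
  zero_mem' := ⟨contDiff_const, 1, 1, one_pos, le_rfl, fun _ _ => rfl⟩
  add_mem' := by
    rintro φ ψ ⟨hφ, a, b, ha, hab, h0⟩ ⟨hψ, a', b', ha', hab', h0'⟩
    refine ⟨hφ.add hψ, min a a', max b b', lt_min ha ha',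
      (min_le_left _ _).trans (hab.trans (le_max_left _ _)), fun r hr => ?_⟩
    have h1 : r ∉ Icc a b := fun h =>
      hr ⟨(min_le_left _ _).trans h.1, h.2.trans (le_max_left _ _)⟩
    have h2 : r ∉ Icc a' b' := fun h =>
      hr ⟨(min_le_right _ _).trans h.1, h.2.trans (le_max_right _ _)⟩
    rw [Pi.add_apply, h0 r h1, h0' r h2, add_zero]
  smul_mem' := by
    rintro c φ ⟨hφ, a, b, ha, hab, h0⟩
    exact ⟨hφ.const_smul c, a, b, ha, hab, fun r hr => by rw [Pi.smul_apply, h0 r hr, smul_zero]⟩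

lemma ofReal_mem_testFun {g : ℝ → ℝ} (hg : ContDiff ℝ ∞ g) (hc : HasCompactSupport g)
    (hs : tsupport g ⊆ Ioi 0) : (fun r => (g r : ℂ)) ∈ testFun := by
  refine ⟨Complex.ofRealCLM.contDiff.comp hg, ?_⟩
  rcases (tsupport g).eq_empty_or_nonempty with he | hne
  · refine ⟨1, 1, one_pos, le_rfl, fun r _ => ?_⟩
    simp [image_eq_zero_of_notMem_tsupport (show r ∉ tsupport g by rw [he]; simp)]
  · obtain ⟨a, ha⟩ := hc.isCompact.exists_isLeast hne
    obtain ⟨b, hb⟩ := hc.isCompact.exists_isGreatest hne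
    refine ⟨a, b, hs ha.1, ha.2 hb.1, fun r hr => ?_⟩
    simp [image_eq_zero_of_notMem_tsupport fun h => hr ⟨ha.2 h, hb.2 h⟩]

lemma eqOn_zero_radialOp (l : ℕ) {u : ℝ → ℂ} {s : Set ℝ} (hs : IsOpen s) (h : EqOn u 0 s) :
    EqOn (radialOp l u) 0 s := by
  have e1 : EqOn (deriv u) 0 s := fun r hr => by rw [h.deriv hs hr]; simp
  have e2 : EqOn (deriv (deriv u)) 0 s := fun r hr => by rw [e1.deriv hs hr]; simp
  intro r hr
  simp [radialOp, e2 hr, h hr]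

/-- Smoothness on `(0, ∞)` and vanishing off a compact subset give smoothness on the line. -/
lemma mem_testFun_of_contDiffOn {φ : ℝ → ℂ} (h : ContDiffOn ℝ ∞ φ (Ioi 0)) {a b : ℝ} (ha : 0 < a)
    (hab : a ≤ b) (h0 : ∀ r ∉ Icc a b, φ r = 0) : φ ∈ testFun := by
  refine ⟨contDiff_iff_contDiffAt.2 fun r => ?_, a, b, ha, hab, h0⟩
  rcases lt_or_ge 0 r with hr | hr
  · exact h.contDiffAt (isOpen_Ioi.mem_nhds hr)
  · refine (contDiffAt_const (c := (0 : ℂ))).congr_of_eventuallyEq ?_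
    filter_upwards [isOpen_Iio.mem_nhds (show r ∈ Iio a from lt_of_le_of_lt hr ha)] with s hs
    exact h0 s fun hs' => (not_le.2 hs) hs'.1

lemma radialOp_mem_testFun (l : ℕ) {φ : ℝ → ℂ} (h : φ ∈ testFun) : radialOp l φ ∈ testFun := by
  obtain ⟨hφ, a, b, ha, hab, h0⟩ := h
  refine mem_testFun_of_contDiffOn (contDiffOn_radialOp l hφ.contDiffOn) ha hab fun r hr => ?_
  exact eqOn_zero_radialOp l isClosed_Icc.isOpen_compl (fun s hs => h0 s hs) hr

lemma mul_mem_testFun {c φ : ℝ → ℂ} (hc : ContDiffOn ℝ ∞ c (Ioi 0)) (h : φ ∈ testFun) :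
    (fun r => c r * φ r) ∈ testFun := by
  obtain ⟨hφ, a, b, ha, hab, h0⟩ := h
  exact mem_testFun_of_contDiffOn (hc.mul hφ.contDiffOn) ha hab fun r hr => by
    simp [h0 r hr]

lemma memLp_of_mem_testFun {φ : ℝ → ℂ} (h : φ ∈ testFun) : MemLp φ 2 μ₀ := by
  obtain ⟨hφ, a, b, ha, hab, h0⟩ := h
  exact (hφ.continuous.memLp_of_hasCompactSupport
    (HasCompactSupport.intro isCompact_Icc h0)).restrict _

lemma mem_S0_of_mem_testFun (l : ℕ) {φ : ℝ → ℂ} (h : φ ∈ testFun) : φ ∈ S0 l := by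
  refine ⟨h.1.contDiffOn, fun n => ?_, memLp_of_mem_testFun h,
    memLp_of_mem_testFun (radialOp_mem_testFun l (radialOp_mem_testFun l h))⟩
  obtain ⟨hφ, a, b, ha, hab, h0⟩ := h
  refine tendsto_const_nhds.congr' ?_
  filter_upwards [Ioo_mem_nhdsGT ha] with r hr
  have e : φ =ᶠ[𝓝 r] fun _ => (0 : ℂ) := by
    filter_upwards [isOpen_Iio.mem_nhds (show r ∈ Iio a from hr.2)] with s hs
    exact h0 s fun hs' => (not_le.2 hs) hs'.1
  rw [e.iteratedDeriv_eq]
  simp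

lemma integrable_mul_test {z φ : ℝ → ℂ} (hz : LocallyIntegrableOn z (Ioi 0)) (h : φ ∈ testFun) :
    Integrable (fun r => z r * φ r) μ₀ := by
  obtain ⟨hφ, a, b, ha, hab, h0⟩ := h
  have h1 : IntegrableOn z (Icc a b) :=
    hz.integrableOn_compact_subset (fun r hr => lt_of_lt_of_le ha hr.1) isCompact_Icc
  have h2 : IntegrableOn (fun r => z r * φ r) (Icc a b) :=
    h1.mul_continuousOn hφ.continuous.continuousOn isCompact_Icc
  refine IntegrableOn.of_forall_sdiff_eq_zero (t := Ioi 0) h2 measurableSet_Ioi fun r hr => ?_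
  rw [h0 r hr.2, mul_zero]

lemma integral_mul_test {z φ : ℝ → ℂ} {a b : ℝ} (ha : 0 < a) (hab : a ≤ b)
    (h0 : ∀ r ∉ Icc a b, φ r = 0) :
    ∫ r, z r * φ r ∂μ₀ = ∫ r in a..b, z r * φ r := by
  rw [intervalIntegral.integral_of_le hab, ← integral_Icc_eq_integral_Ioc]
  exact setIntegral_eq_of_subset_of_forall_sdiff_eq_zero measurableSet_Ioi
    (fun r hr => lt_of_lt_of_le ha hr.1) fun r hr => by rw [h0 r hr.2, mul_zero]

/-! ### Weak solutions -/

/-- The second-order equation `T_l p = g` on `(0, ∞)` with locally integrable right-hand side. -/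
structure IsSol (l : ℕ) (p p1 g : ℝ → ℂ) : Prop where
  d2 : ∀ r : ℝ, 0 < r → HasDerivAt p (p1 r) r
  ac : ∀ x y : ℝ, 0 < x → 0 < y → AbsolutelyContinuousOnInterval p1 x y
  d3 : ∀ᵐ r : ℝ, 0 < r → HasDerivAt p1 (pot l r * p r - g r) r

lemma IsSol.continuousOn {l : ℕ} {p p1 g : ℝ → ℂ} (h : IsSol l p p1 g) : ContinuousOn p (Ioi 0) :=
  fun r hr => (h.d2 r hr).continuousAt.continuousWithinAt

lemma IsSol.add {l : ℕ} {p p1 f s s1 g : ℝ → ℂ} (h : IsSol l p p1 f) (k : IsSol l s s1 g) :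
    IsSol l (p + s) (p1 + s1) (f + g) where
  d2 r hr := (h.d2 r hr).add (k.d2 r hr)
  ac x y hx hy := (h.ac x y hx hy).add (k.ac x y hx hy)
  d3 := by
    filter_upwards [h.d3, k.d3] with r h1 h2 hr
    exact ((h1 hr).add (h2 hr)).congr_deriv (by simp only [Pi.add_apply]; ring)

lemma IsSol.smul {l : ℕ} {p p1 f : ℝ → ℂ} (h : IsSol l p p1 f) (c : ℂ) :
    IsSol l (c • p) (c • p1) (c • f) where
  d2 r hr := (h.d2 r hr).const_smul c
  ac x y hx hy := (h.ac x y hx hy).const_smul c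
  d3 := by
    filter_upwards [h.d3] with r h1 hr
    exact ((h1 hr).const_smul c).congr_deriv (by simp only [Pi.smul_apply, smul_eq_mul]; ring)

/-- The quasi-derivative `p1` of a solution with continuous right-hand side is differentiable
everywhere. -/
lemma IsSol.hasDerivAt_p1 {l : ℕ} {p p1 g : ℝ → ℂ} (h : IsSol l p p1 g)
    (hg : ContinuousOn g (Ioi 0)) {r : ℝ} (hr : 0 < r) :
    HasDerivAt p1 (pot l r * p r - g r) r := by
  have hc : ContinuousOn (fun r => pot l r * p r - g r) (Ioi 0) :=
    ((continuousOn_pot l).mul h.continuousOn).sub hg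
  have e : ∀ x : ℝ, 0 < x → p1 x = p1 1 + ∫ t in (1 : ℝ)..x, (pot l t * p t - g t) := by
    intro x hx
    rw [(absCont_ftc (h.ac 1 x one_pos hx) ?_).2]
    · ring
    · filter_upwards [h.d3] with t ht htm
      exact ht (uIcc_subset_Ioi one_pos hx htm)
  have hI : IntervalIntegrable (fun r => pot l r * p r - g r) volume 1 r :=
    (hc.mono (uIcc_subset_Ioi one_pos hr)).intervalIntegrable
  have := (intervalIntegral.integral_hasDerivAt_right hI
    (hc.stronglyMeasurableAtFilter isOpen_Ioi r hr)
    (hc.continuousAt (isOpen_Ioi.mem_nhds hr))).const_add (p1 1)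
  refine this.congr_of_eventuallyEq ?_
  filter_upwards [isOpen_Ioi.mem_nhds hr] with x hx using e x hx

/-- The homogeneous solution `r ^ (l + 1)`. -/
noncomputable def homA (l : ℕ) (r : ℝ) : ℂ := (r : ℂ) ^ ((l : ℤ) + 1)

/-- The homogeneous solution `r ^ (-l)`. -/
noncomputable def homB (l : ℕ) (r : ℝ) : ℂ := (r : ℂ) ^ (-(l : ℤ))

lemma isSol_zpow (l : ℕ) {a : ℤ} (ha : powFactor l a = 0) :
    IsSol l (fun r => (r : ℂ) ^ a) (fun r => a * (r : ℂ) ^ (a - 1)) 0 := by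
  have e1 : a - 1 - 1 = a - 2 := by ring
  have d3 : ∀ r : ℝ, 0 < r → HasDerivAt (fun r : ℝ => (a : ℂ) * (r : ℂ) ^ (a - 1))
      (pot l r * (r : ℂ) ^ a - (0 : ℝ → ℂ) r) r := fun r hr => by
    have := (hasDerivAt_ofReal_zpow (a - 1) hr).const_mul (a : ℂ)
    rw [e1] at this
    refine this.congr_deriv ?_
    rw [pot_mul_zpow l a hr]
    rw [powFactor, sub_eq_zero] at ha
    rw [ha, Pi.zero_apply]; push_cast; ring
  refine ⟨fun r hr => hasDerivAt_ofReal_zpow a hr, fun x y hx hy => ?_, ae_of_all _ d3⟩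
  have hsub := uIcc_subset_Ioi hx hy
  refine absCont_of_hasDerivAt (fun r hr => d3 r (hsub hr)) (ContinuousOn.mono ?_ hsub)
  refine ((continuousOn_pot l).mul fun r hr => ?_).sub continuousOn_const
  exact (hasDerivAt_ofReal_zpow a hr).continuousAt.continuousWithinAt

lemma exists_isSol_homA (l : ℕ) : ∃ m1, IsSol l (homA l) m1 0 :=
  ⟨_, isSol_zpow l (by rw [powFactor]; push_cast; ring)⟩

lemma exists_isSol_homB (l : ℕ) : ∃ m1, IsSol l (homB l) m1 0 :=
  ⟨_, isSol_zpow l (by rw [powFactor]; push_cast; ring)⟩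

lemma intervalIntegrable_of_locallyIntegrableOn {g : ℝ → ℂ} (hg : LocallyIntegrableOn g (Ioi 0))
    {x y : ℝ} (hx : 0 < x) (hy : 0 < y) : IntervalIntegrable g volume x y :=
  intervalIntegrable_iff.2 ((hg.integrableOn_compact_subset (uIcc_subset_Ioi hx hy)
    isCompact_uIcc).mono_set uIoc_subset_uIcc)

/-- Solvability of `T_l p = g`, by two integrations:
`T_l p = - r ^ (-l - 1) (r ^ (2 l + 2) (r ^ (-l - 1) p)')'`. -/
lemma exists_isSol (l : ℕ) {g : ℝ → ℂ} (hg : LocallyIntegrableOn g (Ioi 0)) :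
    ∃ p p1, IsSol l p p1 g := by
  set h : ℝ → ℂ := fun t => (t : ℂ) ^ (l + 1) * g t
  have hh : ∀ {x y : ℝ}, 0 < x → 0 < y → IntervalIntegrable h volume x y := fun hx hy =>
    (intervalIntegrable_of_locallyIntegrableOn hg hx hy).continuousOn_mul (by fun_prop)
  set Q : ℝ → ℂ := fun r => ∫ t in (1 : ℝ)..r, h t with hQ
  have Qac : ∀ x y : ℝ, 0 < x → 0 < y → AbsolutelyContinuousOnInterval Q x y := by
    intro x y hx hy
    have h1 : (1 : ℝ) ∈ uIcc (min (min x y) 1) (max (max x y) 1) := by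
      rw [uIcc_of_le ((min_le_right _ _).trans (le_max_right _ _))]
      exact ⟨min_le_right _ _, le_max_right _ _⟩
    refine (absCont_primitive (hh (lt_min (lt_min hx hy) one_pos)
      (lt_max_of_lt_right one_pos)) h1).mono ?_
    rw [uIcc_of_le (a := min (min x y) 1) ((min_le_right _ _).trans (le_max_right _ _))]
    exact Icc_subset_Icc (min_le_left _ _) (le_max_left _ _)
  have Qd : ∀ᵐ r : ℝ, 0 < r → HasDerivAt Q (h r) r := by
    refine ae_pos_of_forall_uIcc fun x y hx hy => ?_
    have h1 : (1 : ℝ) ∈ uIcc (min (min x y) 1) (max (max x y) 1) := by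
      rw [uIcc_of_le ((min_le_right _ _).trans (le_max_right _ _))]
      exact ⟨min_le_right _ _, le_max_right _ _⟩
    filter_upwards [(hh (lt_min (lt_min hx hy) one_pos)
      (lt_max_of_lt_right one_pos)).ae_hasDerivAt_integral] with r hr hr'
    refine hr ?_ 1 h1
    rw [uIcc_of_le ((min_le_right _ _).trans (le_max_right _ _))]
    exact Icc_subset_Icc (min_le_left _ _) (le_max_left _ _) hr'
  have Qc : ContinuousOn Q (Ioi 0) := fun r hr => by
    have hr0 : 0 < r := hr
    refine ((Qac (r / 2) (r + 1) (by positivity) (by positivity)).continuousOn.continuousAt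
      ?_).continuousWithinAt
    rw [uIcc_of_le (by linarith)]
    exact Icc_mem_nhds (by linarith) (by linarith)
  set k : ℝ → ℂ := fun s => Q s * (s : ℂ) ^ (-(2 * (l : ℤ) + 2))
  have kc : ContinuousOn k (Ioi 0) := Qc.mul fun r hr =>
    (hasDerivAt_ofReal_zpow _ hr).continuousAt.continuousWithinAt
  set P : ℝ → ℂ := fun r => ∫ s in (1 : ℝ)..r, k s with hP
  have Pd : ∀ r : ℝ, 0 < r → HasDerivAt P (k r) r := fun r hr =>
    intervalIntegral.integral_hasDerivAt_right
      ((kc.mono (uIcc_subset_Ioi one_pos hr)).intervalIntegrable)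
      (kc.stronglyMeasurableAtFilter isOpen_Ioi r hr) (kc.continuousAt (isOpen_Ioi.mem_nhds hr))
  have zc : ∀ a : ℤ, ContinuousOn (fun r : ℝ => (r : ℂ) ^ a) (Ioi 0) := fun a r hr =>
    (hasDerivAt_ofReal_zpow a hr).continuousAt.continuousWithinAt
  have zac : ∀ (a : ℤ) (x y : ℝ), 0 < x → 0 < y →
      AbsolutelyContinuousOnInterval (fun r : ℝ => (r : ℂ) ^ a) x y := fun a x y hx hy =>
    absCont_of_hasDerivAt (fun r hr => hasDerivAt_ofReal_zpow a (uIcc_subset_Ioi hx hy hr))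
      ((continuousOn_const.mul (zc _)).mono (uIcc_subset_Ioi hx hy))
  refine ⟨fun r => -((r : ℂ) ^ ((l : ℤ) + 1) * P r),
    fun r => -(((l : ℂ) + 1) * ((r : ℂ) ^ (l : ℤ) * P r) + (r : ℂ) ^ (-((l : ℤ) + 1)) * Q r),
    fun r hr => ?_, fun x y hx hy => ?_, ?_⟩
  · have hr' : (r : ℂ) ≠ 0 := by exact_mod_cast hr.ne'
    refine (((hasDerivAt_ofReal_zpow ((l : ℤ) + 1) hr).mul (Pd r hr)).neg).congr_deriv ?_
    have e : (r : ℂ) ^ (-((l : ℤ) + 1)) =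
        (r : ℂ) ^ ((l : ℤ) + 1) * (r : ℂ) ^ (-(2 * (l : ℤ) + 2)) := by
      rw [← zpow_add₀ hr']; congr 1; ring
    simp only [k]
    rw [e, add_sub_cancel_right]; push_cast; ring
  · have a1 : AbsolutelyContinuousOnInterval P x y :=
      absCont_of_hasDerivAt (fun r hr => Pd r (uIcc_subset_Ioi hx hy hr))
        (kc.mono (uIcc_subset_Ioi hx hy))
    exact (((absCont_mul (zac l x y hx hy) a1).const_smul ((l : ℂ) + 1)).add
      (absCont_mul (zac _ x y hx hy) (Qac x y hx hy))).neg
  · filter_upwards [Qd] with r hQr hr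
    have hr' : (r : ℂ) ≠ 0 := by exact_mod_cast hr.ne'
    refine (((((hasDerivAt_ofReal_zpow (l : ℤ) hr).mul (Pd r hr)).const_mul ((l : ℂ) + 1)).add
      ((hasDerivAt_ofReal_zpow (-((l : ℤ) + 1)) hr).mul (hQr hr))).neg).congr_deriv ?_
    rw [mul_neg, ← mul_assoc (pot l r), pot_mul_zpow l _ hr]
    have e1 : (r : ℂ) ^ (-((l : ℤ) + 1) - 1) = (r : ℂ) ^ (l : ℤ) * (r : ℂ) ^ (-(2 * (l : ℤ) + 2)) := by
      rw [← zpow_add₀ hr']; congr 1; ring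
    have e2 : (r : ℂ) ^ (-((l : ℤ) + 1)) * h r = g r := by
      simp only [h]
      rw [← mul_assoc, ← zpow_natCast, ← zpow_add₀ hr']
      simp
    have e3 : (l : ℤ) + 1 - 2 = l - 1 := by ring
    rw [e2, e1, e3]
    simp only [k]
    push_cast
    ring

/-- Integration by parts: solutions are weak solutions. -/
lemma integral_mul_radialOp {l : ℕ} {p p1 g φ : ℝ → ℂ} (h : IsSol l p p1 g)
    (hg : LocallyIntegrableOn g (Ioi 0)) (hφ : φ ∈ testFun) :
    ∫ r, p r * radialOp l φ r ∂μ₀ = ∫ r, g r * φ r ∂μ₀ := by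
  have ig := integrable_mul_test hg hφ
  have ip := integrable_mul_test (h.continuousOn.locallyIntegrableOn measurableSet_Ioi)
    (radialOp_mem_testFun l hφ)
  obtain ⟨hs, a, b, ha, hab, h0⟩ := hφ
  have ha' : 0 < a / 2 := by positivity
  have hb' : 0 < b + 1 := by linarith
  have hab' : a / 2 ≤ b + 1 := by linarith
  have h0' : ∀ r ∉ Icc (a / 2) (b + 1), φ r = 0 := fun r hr => h0 r fun h =>
    hr ⟨by linarith [h.1], by linarith [h.2]⟩
  have hT0 : ∀ r ∉ Icc (a / 2) (b + 1), radialOp l φ r = 0 := fun r hr =>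
    eqOn_zero_radialOp l isClosed_Icc.isOpen_compl (fun s hs => h0' s hs) hr
  have d0 : ∀ r, HasDerivAt φ (deriv φ r) r := fun r =>
    ((hs.differentiable (by simp)) r).hasDerivAt
  have hs1 : ContDiff ℝ ∞ (deriv φ) := (contDiff_infty_iff_deriv.1 hs).2
  have d1 : ∀ r, HasDerivAt (deriv φ) (deriv (deriv φ) r) r := fun r =>
    ((hs1.differentiable (by simp)) r).hasDerivAt
  have dz : ∀ r ∉ Icc a b, deriv φ r = 0 := fun r hr => by
    have e : EqOn φ 0 (Icc a b)ᶜ := fun s hs => h0 s hs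
    rw [e.deriv isClosed_Icc.isOpen_compl hr]; simp
  have n1 : a / 2 ∉ Icc a b := fun h => by linarith [h.1]
  have n2 : b + 1 ∉ Icc a b := fun h => by linarith [h.2]
  have acφ := (hs.contDiffOn (s := uIcc (a / 2) (b + 1))).of_le
    (show (1 : WithTop ℕ∞) ≤ ∞ by norm_cast) |>.absolutelyContinuousOnInterval
  have acφ1 := (hs1.contDiffOn (s := uIcc (a / 2) (b + 1))).of_le
    (show (1 : WithTop ℕ∞) ≤ ∞ by norm_cast) |>.absolutelyContinuousOnInterval
  have acp : AbsolutelyContinuousOnInterval p (a / 2) (b + 1) :=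
    absCont_of_hasDerivAt (fun r hr => h.d2 r (uIcc_subset_Ioi ha' hb' hr))
      (h.ac _ _ ha' hb').continuousOn
  obtain ⟨-, hftc⟩ := absCont_ftc (g := fun r => p r * radialOp l φ r - g r * φ r)
    ((absCont_mul (h.ac _ _ ha' hb') acφ).sub (absCont_mul acp acφ1)) (by
      filter_upwards [h.d3] with r h3 hr
      have hr0 : 0 < r := uIcc_subset_Ioi ha' hb' hr
      refine (((h3 hr0).mul (d0 r)).sub ((h.d2 r hr0).mul (d1 r))).congr_deriv ?_
      rw [radialOp_eq]; ring)
  simp only [Pi.sub_apply, h0 _ n1, h0 _ n2, dz _ n1, dz _ n2, mul_zero, sub_zero] at hftc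
  rw [integral_mul_test ha' hab' hT0, integral_mul_test ha' hab' h0']
  have mono : ∀ {w : ℝ → ℂ}, Integrable w μ₀ → IntervalIntegrable w volume (a / 2) (b + 1) :=
    fun hw => (intervalIntegrable_iff_integrableOn_Ioc_of_le hab').2
      (IntegrableOn.mono_set hw fun r hr => ha'.trans hr.1)
  rw [intervalIntegral.integral_sub (mono ip) (mono ig), sub_eq_zero] at hftc
  exact hftc

lemma contDiffOn_ofReal_zpow (a : ℤ) : ContDiffOn ℝ ∞ (fun r : ℝ => (r : ℂ) ^ a) (Ioi 0) := by
  intro r hr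
  have hr' : (r : ℂ) ≠ 0 := by exact_mod_cast (ne_of_gt hr : r ≠ 0)
  rcases a with n | n
  · have : ContDiff ℝ ∞ (fun r : ℝ => (r : ℂ) ^ n) := Complex.ofRealCLM.contDiff.pow n
    simpa using this.contDiffAt.contDiffWithinAt
  · have h1 : ContDiff ℝ ∞ (fun r : ℝ => (r : ℂ) ^ (n + 1)) := Complex.ofRealCLM.contDiff.pow _
    simp only [zpow_negSucc]
    exact (h1.contDiffAt.inv (pow_ne_zero _ hr')).contDiffWithinAt

lemma hasDerivAt_primitive {ψ : ℝ → ℂ} (h : Continuous ψ) (a r : ℝ) :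
    HasDerivAt (fun x => ∫ t in a..x, ψ t) (ψ r) r :=
  (h.integral_hasStrictDerivAt a r).hasDerivAt

lemma contDiff_primitive {ψ : ℝ → ℂ} (h : ContDiff ℝ ∞ ψ) (a : ℝ) :
    ContDiff ℝ ∞ fun x => ∫ t in a..x, ψ t := by
  rw [contDiff_infty_iff_deriv]
  refine ⟨fun r => (hasDerivAt_primitive h.continuous a r).differentiableAt, ?_⟩
  rwa [show deriv (fun x => ∫ t in a..x, ψ t) = ψ from
    funext fun r => (hasDerivAt_primitive h.continuous a r).deriv]

/-- A test function orthogonal to the two homogeneous solutions is `T_l` of a test function: the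
variation of constants formula starting from the left of the support also vanishes to its right. -/
lemma exists_radialOp_eq {l : ℕ} {ψ : ℝ → ℂ} (hψ : ψ ∈ testFun)
    (hA : ∫ r, homA l r * ψ r ∂μ₀ = 0) (hB : ∫ r, homB l r * ψ r ∂μ₀ = 0) :
    ∃ φ ∈ testFun, radialOp l φ = ψ := by
  have tA : (fun r => homA l r * ψ r) ∈ testFun := mul_mem_testFun (contDiffOn_ofReal_zpow _) hψ
  have tB : (fun r => homB l r * ψ r) ∈ testFun := mul_mem_testFun (contDiffOn_ofReal_zpow _) hψ
  have hψ' := hψ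
  obtain ⟨hs, a, b, ha, hab, h0⟩ := hψ
  set IA : ℝ → ℂ := fun x => ∫ t in a..x, homA l t * ψ t
  set IB : ℝ → ℂ := fun x => ∫ t in a..x, homB l t * ψ t
  have dA : ∀ r, HasDerivAt IA (homA l r * ψ r) r := hasDerivAt_primitive tA.1.continuous a
  have dB : ∀ r, HasDerivAt IB (homB l r * ψ r) r := hasDerivAt_primitive tB.1.continuous a
  have van : ∀ c : ℝ → ℂ, (∀ x y, IntervalIntegrable (fun r => c r * ψ r) volume x y) →
      ∫ r, c r * ψ r ∂μ₀ = 0 → ∀ r ∉ Icc a b, ∫ t in a..r, c t * ψ t = 0 := by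
    intro c ic hc r hr
    rw [integral_mul_test ha hab h0] at hc
    have zero : ∀ x y, (∀ t ∈ uIoc x y, t ∉ Icc a b) → ∫ t in x..y, c t * ψ t = 0 := by
      intro x y hxy
      rw [intervalIntegral.integral_congr_ae (g := fun _ => 0)
        (ae_of_all _ fun t ht => by rw [h0 t (hxy t ht), mul_zero])]
      simp
    rcases lt_or_ge r a with hra | hra
    · rw [intervalIntegral.integral_symm, intervalIntegral.integral_of_le hra.le,
        ← integral_Ico_eq_integral_Ioc, neg_eq_zero]
      refine setIntegral_eq_zero_of_forall_eq_zero fun t ht => ?_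
      rw [h0 t fun h => (not_le.2 ht.2) h.1, mul_zero]
    · have hbr : b < r := not_le.1 fun h => hr ⟨hra, h⟩
      rw [← intervalIntegral.integral_add_adjacent_intervals (ic a b) (ic b r), hc, zero_add]
      refine zero b r fun t ht => ?_
      rw [uIoc_of_le hbr.le] at ht
      exact fun h => (not_le.2 ht.1) h.2
  set k : ℂ := (2 * (l : ℂ) + 1)⁻¹
  have hk : k * (2 * (l : ℂ) + 1) = 1 := by
    refine inv_mul_cancel₀ ?_
    norm_cast
  set φ : ℝ → ℂ := fun r => k * (homB l r * IA r - homA l r * IB r) with hφ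
  have φ0 : ∀ r ∉ Icc a b, φ r = 0 := fun r hr => by
    simp only [hφ, IA, IB]
    rw [van _ (fun x y => tA.1.continuous.intervalIntegrable x y) hA r hr,
      van _ (fun x y => tB.1.continuous.intervalIntegrable x y) hB r hr]
    simp
  have φt : φ ∈ testFun := by
    refine mem_testFun_of_contDiffOn ?_ ha hab φ0
    exact contDiffOn_const.mul (((contDiffOn_ofReal_zpow _).mul
      (contDiff_primitive tA.1 a).contDiffOn).sub ((contDiffOn_ofReal_zpow _).mul
      (contDiff_primitive tB.1 a).contDiffOn))
  refine ⟨φ, φt, ?_⟩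
  set φ1 : ℝ → ℂ := fun r => k * (-(l : ℂ) * (r : ℂ) ^ (-(l : ℤ) - 1) * IA r -
    ((l : ℂ) + 1) * (r : ℂ) ^ (l : ℤ) * IB r)
  have d0 : ∀ r : ℝ, 0 < r → HasDerivAt φ (φ1 r) r := by
    intro r hr
    have hA' : HasDerivAt (homA l) (((l : ℂ) + 1) * (r : ℂ) ^ (l : ℤ)) r := by
      have := hasDerivAt_ofReal_zpow ((l : ℤ) + 1) hr
      rw [add_sub_cancel_right] at this
      exact this.congr_deriv (by push_cast; ring)
    have hB' : HasDerivAt (homB l) (-(l : ℂ) * (r : ℂ) ^ (-(l : ℤ) - 1)) r :=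
      (hasDerivAt_ofReal_zpow (-(l : ℤ)) hr).congr_deriv (by push_cast; ring)
    refine (((hB'.mul (dA r)).sub (hA'.mul (dB r))).const_mul k).congr_deriv ?_
    simp only [φ1]
    ring
  have d1 : ∀ r : ℝ, 0 < r → HasDerivAt φ1 (pot l r * φ r - ψ r) r := by
    intro r hr
    have hr' : (r : ℂ) ≠ 0 := by exact_mod_cast hr.ne'
    have hA' := ((hasDerivAt_ofReal_zpow (-(l : ℤ) - 1) hr).const_mul (-(l : ℂ))).mul (dA r)
    have hB' := ((hasDerivAt_ofReal_zpow (l : ℤ) hr).const_mul ((l : ℂ) + 1)).mul (dB r)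
    refine ((hA'.sub hB').const_mul k).congr_deriv ?_
    have e1 : pot l r * homB l r = (l : ℂ) * ((l : ℂ) + 1) * (r : ℂ) ^ (-(l : ℤ) - 2) :=
      pot_mul_zpow l _ hr
    have e2 : pot l r * homA l r = (l : ℂ) * ((l : ℂ) + 1) * (r : ℂ) ^ ((l : ℤ) - 1) := by
      rw [homA, pot_mul_zpow l _ hr]; congr 2; ring
    have e3 : (r : ℂ) ^ (-(l : ℤ) - 1) * homA l r = 1 := by
      rw [homA, ← zpow_add₀ hr']; simp
    have e4 : (r : ℂ) ^ (l : ℤ) * homB l r = 1 := by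
      rw [homB, ← zpow_add₀ hr']; simp
    have e5 : -(l : ℤ) - 1 - 1 = -(l : ℤ) - 2 := by ring
    rw [e5]
    simp only [hφ]
    push_cast
    linear_combination (-k * IA r) * e1 + (k * IB r) * e2 - k * l * ψ r * e3 -
      k * (l + 1) * ψ r * e4 - ψ r * hk
  ext r
  by_cases hr : 0 < r
  · have e : EqOn (deriv φ) φ1 (Ioi 0) := fun r hr => (d0 r hr).deriv
    rw [radialOp_eq, eqOn_deriv e hr, (d1 r hr).deriv]; ring
  · obtain ⟨-, a', b', ha', -, z⟩ := radialOp_mem_testFun l φt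
    rw [z r fun h => hr (ha'.trans_le h.1), h0 r fun h => hr (ha.trans_le h.1)]

/-- The linear functional `φ ↦ ∫ z φ` on test functions. -/
noncomputable def pairing (z : ℝ → ℂ) (hz : LocallyIntegrableOn z (Ioi 0)) : testFun →ₗ[ℂ] ℂ where
  toFun φ := ∫ r, z r * (φ : ℝ → ℂ) r ∂μ₀
  map_add' φ ψ := by
    rw [← integral_add (integrable_mul_test hz φ.2) (integrable_mul_test hz ψ.2)]
    simp [mul_add]
  map_smul' c φ := by
    rw [RingHom.id_apply, smul_eq_mul, ← integral_const_mul]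
    congr 1
    ext r
    simp only [Submodule.coe_smul, Pi.smul_apply, smul_eq_mul]
    ring

lemma locallyIntegrableOn_homA (l : ℕ) : LocallyIntegrableOn (homA l) (Ioi 0) :=
  (contDiffOn_ofReal_zpow _).continuousOn.locallyIntegrableOn measurableSet_Ioi

lemma locallyIntegrableOn_homB (l : ℕ) : LocallyIntegrableOn (homB l) (Ioi 0) :=
  (contDiffOn_ofReal_zpow _).continuousOn.locallyIntegrableOn measurableSet_Ioi

/-- A linear functional on test functions that annihilates the range of `T_l` is given by a
homogeneous solution. -/
lemma exists_eq_pairing_hom (l : ℕ) (L : testFun →ₗ[ℂ] ℂ)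
    (hL : ∀ φ ψ : testFun, (ψ : ℝ → ℂ) = radialOp l φ → L ψ = 0) :
    ∃ c d : ℂ, ∀ ψ : testFun, L ψ = ∫ r, (c * homA l r + d * homB l r) * (ψ : ℝ → ℂ) r ∂μ₀ := by
  set M : Fin 2 → testFun →ₗ[ℂ] ℂ := ![pairing _ (locallyIntegrableOn_homA l),
    pairing _ (locallyIntegrableOn_homB l)] with hM
  have hker : ⨅ i, LinearMap.ker (M i) ≤ LinearMap.ker L := by
    intro ψ hψ
    rw [Submodule.mem_iInf] at hψ
    obtain ⟨φ, hφ, e⟩ := exists_radialOp_eq (l := l) ψ.2 (hψ 0) (hψ 1)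
    exact hL ⟨φ, hφ⟩ ψ e.symm
  have hspan := mem_span_of_iInf_ker_le_ker hker
  rw [Submodule.mem_span_range_iff_exists_fun] at hspan
  obtain ⟨c, hc⟩ := hspan
  refine ⟨c 0, c 1, fun ψ => ?_⟩
  rw [← hc]
  have iA := (integrable_mul_test (locallyIntegrableOn_homA l) ψ.2).const_mul (c 0)
  have iB := (integrable_mul_test (locallyIntegrableOn_homB l) ψ.2).const_mul (c 1)
  have : ∫ r, (c 0 * homA l r + c 1 * homB l r) * (ψ : ℝ → ℂ) r ∂μ₀ =
      c 0 * (∫ r, homA l r * (ψ : ℝ → ℂ) r ∂μ₀) + c 1 * ∫ r, homB l r * (ψ : ℝ → ℂ) r ∂μ₀ := by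
    rw [← integral_const_mul, ← integral_const_mul, ← integral_add iA iB]
    congr 1
    ext r
    ring
  rw [this, Fin.sum_univ_two]
  rfl

/-- The fundamental lemma of the calculus of variations on `(0, ∞)`. -/
lemma ae_eq_zero_of_pairing {z : ℝ → ℂ} (hz : LocallyIntegrableOn z (Ioi 0))
    (h : ∀ φ ∈ testFun, ∫ r, z r * φ r ∂μ₀ = 0) : z =ᵐ[μ₀] 0 := by
  rw [EventuallyEq, ae_restrict_iff' measurableSet_Ioi]
  refine isOpen_Ioi.ae_eq_zero_of_integral_contDiff_smul_eq_zero hz fun g hg hc hs => ?_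
  have h1 := h _ (ofReal_mem_testFun hg hc hs)
  rw [← h1, ← integral_indicator measurableSet_Ioi]
  congr 1
  ext r
  by_cases hr : r ∈ Ioi (0 : ℝ)
  · rw [indicator_of_mem hr, Complex.real_smul, mul_comm]
  · rw [indicator_of_notMem hr, image_eq_zero_of_notMem_tsupport fun h => hr (hs h), zero_smul]

/-- Weak solutions of `T_l z = k` are regular up to a null set. -/
lemma exists_isSol_of_weak {l : ℕ} {z k : ℝ → ℂ} (hz : LocallyIntegrableOn z (Ioi 0))
    (hk : LocallyIntegrableOn k (Ioi 0))
    (h : ∀ φ ∈ testFun, ∫ r, z r * radialOp l φ r ∂μ₀ = ∫ r, k r * φ r ∂μ₀) :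
    ∃ u u1, IsSol l u u1 k ∧ z =ᵐ[μ₀] u := by
  obtain ⟨w, w1, hw⟩ := exists_isSol l hk
  obtain ⟨m, hm⟩ := exists_isSol_homA l
  obtain ⟨n, hn⟩ := exists_isSol_homB l
  have hwl := hw.continuousOn.locallyIntegrableOn (μ := volume) measurableSet_Ioi
  have hzw : LocallyIntegrableOn (z - w) (Ioi 0) := hz.sub hwl
  obtain ⟨c, d, hcd⟩ := exists_eq_pairing_hom l (pairing (z - w) hzw) (by
    intro φ ψ e
    change ∫ r, (z r - w r) * (ψ : ℝ → ℂ) r ∂μ₀ = 0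
    have i1 := integrable_mul_test hz ψ.2
    have i2 := integrable_mul_test hwl ψ.2
    simp only [sub_mul]
    rw [integral_sub i1 i2, e, h _ φ.2, integral_mul_radialOp hw hk φ.2, sub_self])
  refine ⟨w + (c • homA l + d • homB l), w1 + (c • m + d • n), ?_, ?_⟩
  · have := hw.add ((hm.smul c).add (hn.smul d))
    simpa using this
  · have hy : LocallyIntegrableOn (fun r => c * homA l r + d * homB l r) (Ioi 0) :=
      ContinuousOn.locallyIntegrableOn ((continuousOn_const.mul hm.continuousOn).add
        (continuousOn_const.mul hn.continuousOn)) measurableSet_Ioi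
    have := ae_eq_zero_of_pairing (hzw.sub hy) (by
      intro φ hφ
      have h1 := hcd ⟨φ, hφ⟩
      have i1 := integrable_mul_test hzw hφ
      have i2 := integrable_mul_test hy hφ
      have e : ∫ r, (z - w - fun r => c * homA l r + d * homB l r) r * φ r ∂μ₀ =
          ∫ r, ((z - w) r * φ r - (c * homA l r + d * homB l r) * φ r) ∂μ₀ := by
        congr 1
        ext r
        exact sub_mul _ _ _
      rw [e, integral_sub i1 i2, sub_eq_zero]
      exact h1)
    filter_upwards [this] with r hr
    simp only [Pi.sub_apply, Pi.zero_apply] at hr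
    simp only [Pi.add_apply, Pi.smul_apply, smul_eq_mul]
    linear_combination hr

/-- Weak solutions of `T_l² v = f` are regular up to a null set. -/
lemma exists_isQuasi_of_weak {l : ℕ} {v f : ℝ → ℂ} (hv : LocallyIntegrableOn v (Ioi 0))
    (hf : LocallyIntegrableOn f (Ioi 0))
    (h : ∀ φ ∈ testFun, ∫ r, v r * radialOp l (radialOp l φ) r ∂μ₀ = ∫ r, f r * φ r ∂μ₀) :
    ∃ u u1 p p1, IsQuasi l u u1 p p1 f ∧ v =ᵐ[μ₀] u := by
  obtain ⟨w, w1, hw⟩ := exists_isSol l hf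
  obtain ⟨m, hm⟩ := exists_isSol_homA l
  obtain ⟨n, hn⟩ := exists_isSol_homB l
  have hwl := hw.continuousOn.locallyIntegrableOn (μ := volume) measurableSet_Ioi
  -- `ψ ↦ ∫ v T_l ψ - ∫ w ψ` annihilates the range of `T_l`
  set T : testFun →ₗ[ℂ] testFun :=
    { toFun := fun φ => ⟨radialOp l φ, radialOp_mem_testFun l φ.2⟩
      map_add' := by
        intro φ ψ
        ext r
        by_cases hr : 0 < r
        · exact radialOp_add l φ.2.1.contDiffOn ψ.2.1.contDiffOn hr
        · have key : ∀ χ : testFun, radialOp l χ r = 0 := fun χ => by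
            obtain ⟨-, a, b, ha, -, z⟩ := radialOp_mem_testFun l χ.2
            exact z r fun h => hr (ha.trans_le h.1)
          have := key (φ + ψ)
          simp only [Submodule.coe_add, Pi.add_apply, key φ, key ψ] at this ⊢
          rw [this, add_zero]
      map_smul' := by
        intro c φ
        ext r
        exact congrFun (radialOp_smul l c φ) r }
  obtain ⟨c, d, hcd⟩ := exists_eq_pairing_hom l ((pairing v hv).comp T - pairing w hwl) (by
    intro φ ψ e
    change (∫ r, v r * radialOp l ψ r ∂μ₀) - ∫ r, w r * (ψ : ℝ → ℂ) r ∂μ₀ = 0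
    rw [e, h _ φ.2, integral_mul_radialOp hw hf φ.2, sub_self])
  have hk := hw.add ((hm.smul c).add (hn.smul d))
  have hkl := hk.continuousOn.locallyIntegrableOn (μ := volume) measurableSet_Ioi
  obtain ⟨u, u1, hu, e⟩ := exists_isSol_of_weak hv hkl (by
    intro φ hφ
    have h1 : (∫ r, v r * radialOp l φ r ∂μ₀) - ∫ r, w r * φ r ∂μ₀ =
      ∫ r, (c * homA l r + d * homB l r) * φ r ∂μ₀ := hcd ⟨φ, hφ⟩
    have hy : LocallyIntegrableOn (fun r => c * homA l r + d * homB l r) (Ioi 0) :=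
      ContinuousOn.locallyIntegrableOn ((continuousOn_const.mul hm.continuousOn).add
        (continuousOn_const.mul hn.continuousOn)) measurableSet_Ioi
    rw [sub_eq_iff_eq_add', ← integral_add (integrable_mul_test hwl hφ)
      (integrable_mul_test hy hφ)] at h1
    rw [h1]
    congr 1
    ext r
    simp only [Pi.add_apply, Pi.smul_apply, smul_eq_mul]
    ring)
  refine ⟨u, u1, _, _, ⟨hu.d2, fun r hr => hu.hasDerivAt_p1 hk.continuousOn hr, hk.d2, hk.ac, ?_⟩, e⟩
  filter_upwards [hk.d3] with r h3 hr
  exact (h3 hr).congr_deriv (by simp)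

/-! ### Symmetric operators with a two-dimensional space of boundary values -/

section Abstract

open LinearPMap

variable {H : Type*} [NormedAddCommGroup H] [InnerProductSpace ℂ H] [CompleteSpace H]

lemma mem_graph_adjoint_iff {S : H →ₗ.[ℂ] H} (hS : Dense (S.domain : Set H)) (x y : H) :
    (x, y) ∈ S.adjoint.graph ↔
      ∀ z w : H, (z, w) ∈ S.graph → (inner ℂ w x : ℂ) = inner ℂ z y := by
  rw [adjoint_graph_eq_graph_adjoint hS, Submodule.mem_adjoint_iff]
  simp only [sub_eq_zero]

/-- The closure of the graph of a densely defined operator is the graph of the double adjoint. -/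
lemma mem_closure_graph_iff {S : H →ₗ.[ℂ] H} (hS : Dense (S.domain : Set H)) (x y : H) :
    (x, y) ∈ S.graph.topologicalClosure ↔
      ∀ z w : H, (z, w) ∈ S.adjoint.graph → (inner ℂ w x : ℂ) = inner ℂ z y := by
  set e := WithLp.prodContinuousLinearEquiv 2 ℂ H H
  set G : Submodule ℂ (WithLp 2 (H × H)) := S.graph.comap e.toLinearEquiv.toLinearMap with hG
  have h1 : (x, y) ∈ S.graph.topologicalClosure ↔ e.symm (x, y) ∈ G.topologicalClosure := by
    have : (G : Set (WithLp 2 (H × H))) = e ⁻¹' (S.graph : Set (H × H)) := rfl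
    have hcl := e.toHomeomorph.preimage_closure (S.graph : Set (H × H))
    rw [← SetLike.mem_coe, ← SetLike.mem_coe, Submodule.topologicalClosure_coe,
      Submodule.topologicalClosure_coe, this]
    change _ ↔ e.symm (x, y) ∈ closure (e.toHomeomorph ⁻¹' (S.graph : Set (H × H)))
    rw [← hcl]
    change _ ↔ e (e.symm (x, y)) ∈ closure (S.graph : Set (H × H))
    rw [e.apply_symm_apply]
  rw [h1, ← Submodule.orthogonal_orthogonal_eq_closure, Submodule.mem_orthogonal]
  have h2 : ∀ z w : H, (z, w) ∈ S.adjoint.graph ↔ e.symm (w, -z) ∈ Gᗮ := by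
    intro z w
    rw [mem_graph_adjoint_iff hS, Submodule.mem_orthogonal]
    constructor
    · intro h p hp
      have := h p.fst p.snd hp
      rw [WithLp.prod_inner_apply]
      change inner ℂ p.fst w + inner ℂ p.snd (-z) = 0
      rw [inner_neg_right, this]; ring
    · intro h a b hab
      have := h (e.symm (a, b)) hab
      rw [WithLp.prod_inner_apply] at this
      change inner ℂ a w + inner ℂ b (-z) = 0 at this
      rw [inner_neg_right] at this
      linear_combination -this
  constructor
  · intro h z w hzw
    have := h _ ((h2 z w).1 hzw)
    rw [WithLp.prod_inner_apply] at this
    change inner ℂ w x + inner ℂ (-z) y = 0 at this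
    rw [inner_neg_left] at this
    linear_combination this
  · intro h p hp
    have h3 : (-p.snd, p.fst) ∈ S.adjoint.graph := by
      rw [h2, neg_neg]; exact hp
    have := h _ _ h3
    rw [WithLp.prod_inner_apply]
    change inner ℂ p.fst x + inner ℂ p.snd y = 0
    rw [this, inner_neg_left]; ring

/-- A densely defined symmetric operator `S` with a surjective map `b` from the domain of its adjoint
onto `ℂ²` such that Green's formula expresses the asymmetry of the adjoint by the standard
symplectic form of the boundary values. -/
structure BoundaryMap (S : H →ₗ.[ℂ] H) where
  /-- the domain is dense -/
  dense : Dense (S.domain : Set H)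
  /-- the operator is symmetric -/
  le_adjoint : S ≤ S.adjoint
  /-- the boundary values -/
  b : S.adjoint.domain →ₗ[ℂ] ℂ × ℂ
  /-- the factor in Green's formula -/
  k : ℂ
  /-- the factor does not vanish -/
  k_ne : k ≠ 0
  /-- Green's formula -/
  green : ∀ x y : S.adjoint.domain, (inner ℂ (x : H) (S.adjoint y) : ℂ) - inner ℂ (S.adjoint x) (y : H) =
    k * (starRingEnd ℂ (b x).1 * (b y).2 - starRingEnd ℂ (b x).2 * (b y).1)
  /-- all boundary values occur -/
  surj : Function.Surjective b

namespace BoundaryMap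

variable {S : H →ₗ.[ℂ] H} (Γ : BoundaryMap S)

include Γ in
lemma isClosable : S.IsClosable :=
  isClosable_iff_exists_closed_extension.2 ⟨_, adjoint_isClosed Γ.dense, Γ.le_adjoint⟩

lemma eq_zero_of_form {q : ℂ × ℂ} (h : ∀ x, starRingEnd ℂ (Γ.b x).1 * q.2 -
    starRingEnd ℂ (Γ.b x).2 * q.1 = 0) : q = 0 := by
  obtain ⟨x, hx⟩ := Γ.surj (1, 0)
  obtain ⟨y, hy⟩ := Γ.surj (0, 1)
  have h1 := h x
  have h2 := h y
  rw [hx] at h1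
  rw [hy] at h2
  ext
  · simpa using h2
  · simpa using h1

/-- The closure is the restriction of the adjoint to vanishing boundary values. -/
lemma mem_graph_closure_iff (x y : H) : (x, y) ∈ S.closure.graph ↔
    ∃ x' : S.adjoint.domain, (x' : H) = x ∧ S.adjoint x' = y ∧ Γ.b x' = 0 := by
  rw [← Γ.isClosable.graph_closure_eq_closure_graph]
  constructor
  · intro h
    have h1 : S.graph.topologicalClosure ≤ S.adjoint.graph :=
      Submodule.topologicalClosure_minimal _ (le_graph_of_le Γ.le_adjoint)
        (adjoint_isClosed Γ.dense)
    obtain ⟨x', hx, hy⟩ := (mem_graph_iff _).1 (h1 h)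
    refine ⟨x', hx, hy, Γ.eq_zero_of_form fun z => ?_⟩
    have h2 := (mem_closure_graph_iff Γ.dense x y).1 h _ _ (S.adjoint.mem_graph z)
    have h3 := Γ.green z x'
    simp only at hx hy
    rw [hx, hy, h2, sub_self] at h3
    exact (mul_eq_zero.1 h3.symm).resolve_left Γ.k_ne
  · rintro ⟨x', rfl, rfl, hb⟩
    rw [mem_closure_graph_iff Γ.dense]
    intro z w hzw
    obtain ⟨z', rfl, rfl⟩ := (mem_graph_iff _).1 hzw
    have h3 := Γ.green z' x'
    rw [hb] at h3
    simp only [Prod.fst_zero, Prod.snd_zero, mul_zero, sub_zero] at h3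
    exact (sub_eq_zero.1 h3).symm

/-- The restriction of the adjoint by the boundary condition `s α = t β` on the boundary values
`(β, α)`. -/
noncomputable def ext (s t : ℝ) : H →ₗ.[ℂ] H :=
  S.adjoint.domRestrict ((LinearMap.ker
    ((s : ℂ) • (LinearMap.snd ℂ ℂ ℂ).comp Γ.b - (t : ℂ) • (LinearMap.fst ℂ ℂ ℂ).comp Γ.b)).map
      S.adjoint.domain.subtype)

lemma mem_graph_ext_iff (s t : ℝ) (x y : H) : (x, y) ∈ (Γ.ext s t).graph ↔
    ∃ x' : S.adjoint.domain, (x' : H) = x ∧ S.adjoint x' = y ∧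
      (s : ℂ) * (Γ.b x').2 = t * (Γ.b x').1 := by
  constructor
  · intro h
    obtain ⟨⟨z, hz1, hz2⟩, rfl, rfl⟩ := (mem_graph_iff _).1 h
    obtain ⟨w, hw, e⟩ := hz1
    refine ⟨w, e, ?_, ?_⟩
    · subst e; rfl
    · simpa [sub_eq_zero] using hw
  · rintro ⟨x', rfl, rfl, h⟩
    refine (mem_graph_iff _).2 ⟨⟨x', ⟨⟨x', ?_, rfl⟩, x'.2⟩⟩, rfl, rfl⟩
    simpa [sub_eq_zero] using h

lemma closure_le_ext (s t : ℝ) : S.closure ≤ Γ.ext s t := by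
  refine le_of_le_graph fun p hp => ?_
  obtain ⟨x', h1, h2, h3⟩ := (Γ.mem_graph_closure_iff p.1 p.2).1 hp
  exact (Γ.mem_graph_ext_iff s t p.1 p.2).2 ⟨x', h1, h2, by rw [h3]; simp⟩

lemma le_ext (s t : ℝ) : S ≤ Γ.ext s t := S.le_closure.trans (Γ.closure_le_ext s t)

include Γ in
lemma dense_domain_of_le {B : H →ₗ.[ℂ] H} (h : S ≤ B) : Dense (B.domain : Set H) :=
  Γ.dense.mono h.1

include Γ in
/-- The adjoint of an extension is a restriction of the adjoint. -/
lemma adjoint_le_adjoint {B : H →ₗ.[ℂ] H} (h : S ≤ B) : B.adjoint ≤ S.adjoint := by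
  refine le_of_le_graph fun p hp => ?_
  rw [mem_graph_adjoint_iff Γ.dense]
  exact fun z w hzw => (mem_graph_adjoint_iff (Γ.dense_domain_of_le h) p.1 p.2).1 hp z w
    (le_graph_of_le h hzw)

/-- The boundary conditions `s α = t β` with real `(s, t) ≠ 0` define Lagrangian lines, hence
self-adjoint extensions. -/
lemma isSelfAdjoint_ext {s t : ℝ} (hst : s ≠ 0 ∨ t ≠ 0) : IsSelfAdjoint (Γ.ext s t) := by
  rw [isSelfAdjoint_def]
  refine eq_of_eq_graph (SetLike.ext fun p => ?_)
  have hd := Γ.dense_domain_of_le (Γ.le_ext s t)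
  constructor
  · intro hp
    obtain ⟨x', hx, hy⟩ := (mem_graph_iff _).1 (le_graph_of_le
      (Γ.adjoint_le_adjoint (Γ.le_ext s t)) hp)
    refine (Γ.mem_graph_ext_iff s t p.1 p.2).2 ⟨x', hx, hy, ?_⟩
    obtain ⟨z, hz⟩ := Γ.surj ((s : ℂ), (t : ℂ))
    have hzg : ((z : H), S.adjoint z) ∈ (Γ.ext s t).graph :=
      (Γ.mem_graph_ext_iff s t _ _).2 ⟨z, rfl, rfl, by rw [hz]; ring⟩
    have h1 := (mem_graph_adjoint_iff hd p.1 p.2).1 hp _ _ hzg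
    have h2 := Γ.green z x'
    rw [hx, hy, h1, sub_self, hz] at h2
    have h3 := (mul_eq_zero.1 h2.symm).resolve_left Γ.k_ne
    simp only [Complex.conj_ofReal] at h3
    exact sub_eq_zero.1 h3
  · intro hp
    obtain ⟨x', hx, hy, hx'⟩ := (Γ.mem_graph_ext_iff s t p.1 p.2).1 hp
    refine (mem_graph_adjoint_iff hd p.1 p.2).2 fun z w hzw => ?_
    obtain ⟨z', rfl, rfl, hz'⟩ := (Γ.mem_graph_ext_iff s t _ _).1 hzw
    have h2 := Γ.green z' x'
    rw [hx, hy] at h2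
    have hz'' := congrArg (starRingEnd ℂ) hz'
    simp only [map_mul, Complex.conj_ofReal] at hz''
    have h3 : starRingEnd ℂ (Γ.b z').1 * (Γ.b x').2 -
        starRingEnd ℂ (Γ.b z').2 * (Γ.b x').1 = 0 := by
      rcases hst with h | h
      · have h' : (s : ℂ) ≠ 0 := by exact_mod_cast h
        refine (mul_eq_zero.1 ?_).resolve_left h'
        linear_combination (starRingEnd ℂ (Γ.b z').1) * hx' - (Γ.b x').1 * hz''
      · have h' : (t : ℂ) ≠ 0 := by exact_mod_cast h
        refine (mul_eq_zero.1 ?_).resolve_left h'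
        linear_combination (starRingEnd ℂ (Γ.b z').2) * hx' - (Γ.b x').2 * hz''
    rw [h3, mul_zero] at h2
    exact (sub_eq_zero.1 h2).symm

lemma le_antisymm_of_isSelfAdjoint {A B : H →ₗ.[ℂ] H} (hA : IsSelfAdjoint A)
    (hB : IsSelfAdjoint B) (h : B ≤ A) : A = B := by
  refine le_antisymm ?_ h
  rw [isSelfAdjoint_def] at hA hB
  have hd : Dense (B.domain : Set H) := IsSelfAdjoint.dense_domain (isSelfAdjoint_def.2 hB)
  refine le_of_le_graph fun p hp => ?_
  rw [← hA] at hp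
  rw [← hB]
  refine (mem_graph_adjoint_iff hd p.1 p.2).2 fun z w hzw => ?_
  exact (mem_graph_adjoint_iff (hd.mono h.1) p.1 p.2).1 hp z w (le_graph_of_le h hzw)

include Γ in
/-- Every self-adjoint extension is given by a real boundary condition: its boundary values are a
Lagrangian subspace of `ℂ²`, hence a line spanned by a real vector. -/
lemma exists_eq_ext {B : H →ₗ.[ℂ] H} (hB : IsSelfAdjoint B) (h : S ≤ B) :
    ∃ s t : ℝ, (s ≠ 0 ∨ t ≠ 0) ∧ B = Γ.ext s t := by
  have hd := Γ.dense_domain_of_le h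
  have hB' := isSelfAdjoint_def.1 hB
  have hle : B ≤ S.adjoint := by
    have := Γ.adjoint_le_adjoint h
    rwa [hB'] at this
  have hmem : ∀ x y : S.adjoint.domain, (x : H) ∈ B.domain → (y : H) ∈ B.domain →
      starRingEnd ℂ (Γ.b x).1 * (Γ.b y).2 - starRingEnd ℂ (Γ.b x).2 * (Γ.b y).1 = 0 := by
    intro x y hx hy
    have e1 : B ⟨x, hx⟩ = S.adjoint x := hle.2 rfl
    have e2 : B ⟨y, hy⟩ = S.adjoint y := hle.2 rfl
    have h1 : ((y : H), S.adjoint y) ∈ B.adjoint.graph := by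
      rw [hB', ← e2]; exact B.mem_graph ⟨y, hy⟩
    have h2 := (mem_graph_adjoint_iff hd _ _).1 h1 _ _ (B.mem_graph ⟨x, hx⟩)
    have h3 := Γ.green x y
    rw [← h2, e1, sub_self] at h3
    exact (mul_eq_zero.1 h3.symm).resolve_left Γ.k_ne
  obtain ⟨x0, hx0, hb⟩ : ∃ x : S.adjoint.domain, (x : H) ∈ B.domain ∧ Γ.b x ≠ 0 := by
    by_contra! hcon
    -- otherwise every element of the domain of `S†` is in the domain of `B† = B`
    have hall : ∀ z : S.adjoint.domain, (z : H) ∈ B.domain := by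
      intro z
      have : ((z : H), S.adjoint z) ∈ B.adjoint.graph := by
        refine (mem_graph_adjoint_iff hd _ _).2 fun x w hxw => ?_
        obtain ⟨x', rfl, rfl⟩ := (mem_graph_iff _).1 (le_graph_of_le hle hxw)
        have h3 := Γ.green x' z
        rw [hcon x' (mem_domain_of_mem_graph hxw)] at h3
        simp only [Prod.fst_zero, Prod.snd_zero, _root_.map_zero, zero_mul, mul_zero, sub_zero] at h3
        exact (sub_eq_zero.1 h3).symm
      rw [hB'] at this
      exact mem_domain_of_mem_graph this
    obtain ⟨z, hz⟩ := Γ.surj (1, 0)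
    have := hcon z (hall z)
    rw [hz] at this
    simpa using congrArg Prod.fst this
  obtain ⟨s, t, hst, c, hc1, hc2⟩ : ∃ s t : ℝ, (s ≠ 0 ∨ t ≠ 0) ∧
      ∃ c : ℂ, (Γ.b x0).1 = c * s ∧ (Γ.b x0).2 = c * t := by
    by_cases hβ : (Γ.b x0).1 = 0
    · exact ⟨0, 1, Or.inr one_ne_zero, (Γ.b x0).2, by simp [hβ], by simp⟩
    · have hr := hmem x0 x0 hx0 hx0
      obtain ⟨t, ht⟩ : ∃ t : ℝ, ((t : ℝ) : ℂ) = (Γ.b x0).2 / (Γ.b x0).1 := by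
        refine Complex.conj_eq_iff_real.1 ?_ |>.imp fun _ h => h.symm
        have hβ' : starRingEnd ℂ (Γ.b x0).1 ≠ 0 := by simpa using hβ
        rw [map_div₀, div_eq_div_iff hβ' hβ]
        linear_combination -hr
      refine ⟨1, t, Or.inl one_ne_zero, (Γ.b x0).1, by simp, ?_⟩
      rw [ht]; field_simp
  refine ⟨s, t, hst, (le_antisymm_of_isSelfAdjoint (Γ.isSelfAdjoint_ext hst) hB ?_).symm⟩
  refine le_of_le_graph fun p hp => ?_
  obtain ⟨x', hx, hy⟩ := (mem_graph_iff _).1 (le_graph_of_le hle hp)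
  refine (Γ.mem_graph_ext_iff s t p.1 p.2).2 ⟨x', hx, hy, ?_⟩
  have hxB : (x' : H) ∈ B.domain := by
    rw [hx]; exact mem_domain_of_mem_graph (y := p.2) hp
  have h1 := hmem x0 x' hx0 hxB
  have hc0 : starRingEnd ℂ c ≠ 0 := by
    intro h0
    rw [map_eq_zero] at h0
    rw [h0, zero_mul] at hc1 hc2
    exact hb (Prod.ext hc1 hc2)
  rw [hc1, hc2] at h1
  simp only [map_mul, Complex.conj_ofReal] at h1
  have h2 : starRingEnd ℂ c * ((s : ℂ) * (Γ.b x').2 - t * (Γ.b x').1) = 0 := by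
    linear_combination h1
  exact sub_eq_zero.1 ((mul_eq_zero.1 h2).resolve_left hc0)

lemma mul_eq_mul_of_ext_eq {s t s' t' : ℝ} (h : Γ.ext s t = Γ.ext s' t') : s' * t = t' * s := by
  obtain ⟨z, hz⟩ := Γ.surj ((s : ℂ), (t : ℂ))
  have h1 : ((z : H), S.adjoint z) ∈ (Γ.ext s t).graph :=
    (Γ.mem_graph_ext_iff s t _ _).2 ⟨z, rfl, rfl, by rw [hz]; ring⟩
  rw [h] at h1
  obtain ⟨z', e, -, h2⟩ := (Γ.mem_graph_ext_iff s' t' _ _).1 h1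
  rw [Subtype.ext e, hz] at h2
  simp only at h2
  exact_mod_cast h2

lemma ext_congr {s t s' t' : ℝ} (hst : s ≠ 0 ∨ t ≠ 0) (hst' : s' ≠ 0 ∨ t' ≠ 0)
    (h : s' * t = t' * s) : Γ.ext s t = Γ.ext s' t' := by
  have hC : (s' : ℂ) * t = t' * s := by exact_mod_cast h
  refine le_antisymm_of_isSelfAdjoint (Γ.isSelfAdjoint_ext hst) (Γ.isSelfAdjoint_ext hst')
    (le_of_le_graph fun p hp => ?_)
  obtain ⟨x, hx, hy, hb⟩ := (Γ.mem_graph_ext_iff s' t' p.1 p.2).1 hp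
  refine (Γ.mem_graph_ext_iff s t p.1 p.2).2 ⟨x, hx, hy, ?_⟩
  rcases hst' with h' | h'
  · have h0 : (s' : ℂ) ≠ 0 := by exact_mod_cast h'
    refine mul_left_cancel₀ h0 ?_
    linear_combination s * hb - (Γ.b x).1 * hC
  · have h0 : (t' : ℂ) ≠ 0 := by exact_mod_cast h'
    refine mul_left_cancel₀ h0 ?_
    linear_combination t * hb - (Γ.b x).2 * hC

/-- Modulo the closure, the domain of an extension is spanned by any element with a non-zero
boundary value. -/
lemma exists_sub_smul_mem_closure {s t : ℝ} (hst : s ≠ 0 ∨ t ≠ 0) (h : S.adjoint.domain)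
    (hh : (s : ℂ) * (Γ.b h).2 = t * (Γ.b h).1) (hb : Γ.b h ≠ 0) {x y : H}
    (hx : (x, y) ∈ (Γ.ext s t).graph) :
    ∃ c : ℂ, (x - c • (h : H), y - c • S.adjoint h) ∈ S.closure.graph := by
  obtain ⟨x', rfl, rfl, hx'⟩ := (Γ.mem_graph_ext_iff s t _ _).1 hx
  obtain ⟨c, hc⟩ : ∃ c : ℂ, Γ.b x' = c • Γ.b h := by
    rcases hst with h' | h'
    · have h0 : (s : ℂ) ≠ 0 := by exact_mod_cast h'
      have hβ : (Γ.b h).1 ≠ 0 := fun h1 => hb (Prod.ext h1 (by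
        rw [h1, mul_zero] at hh
        exact (mul_eq_zero.1 hh).resolve_left h0))
      refine ⟨(Γ.b x').1 / (Γ.b h).1, Prod.ext ?_ (mul_left_cancel₀ h0 ?_)⟩
      · rw [Prod.smul_fst, smul_eq_mul]; field_simp
      · rw [Prod.smul_snd, smul_eq_mul, mul_left_comm, hh, hx']; field_simp
    · have h0 : (t : ℂ) ≠ 0 := by exact_mod_cast h'
      have hα : (Γ.b h).2 ≠ 0 := fun h1 => hb (Prod.ext (by
        rw [h1, mul_zero] at hh
        exact (mul_eq_zero.1 hh.symm).resolve_left h0) h1)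
      refine ⟨(Γ.b x').2 / (Γ.b h).2, Prod.ext (mul_left_cancel₀ h0 ?_) ?_⟩
      · rw [Prod.smul_fst, smul_eq_mul, mul_left_comm, ← hh, ← hx']; field_simp
      · rw [Prod.smul_snd, smul_eq_mul]; field_simp
  refine ⟨c, (Γ.mem_graph_closure_iff _ _).2 ⟨x' - c • h, by simp, ?_, ?_⟩⟩
  · rw [LinearPMap.map_sub, LinearPMap.map_smul]
  · rw [_root_.map_sub, _root_.map_smul, hc, sub_self]

lemma domain_ext {s t : ℝ} (hst : s ≠ 0 ∨ t ≠ 0) (h : S.adjoint.domain)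
    (hh : (s : ℂ) * (Γ.b h).2 = t * (Γ.b h).1) (hb : Γ.b h ≠ 0) :
    (Γ.ext s t).domain = S.closure.domain ⊔ Submodule.span ℂ {(h : H)} := by
  have hmem : (h : H) ∈ (Γ.ext s t).domain :=
    mem_domain_of_mem_graph ((Γ.mem_graph_ext_iff s t _ _).2 ⟨h, rfl, rfl, hh⟩)
  refine le_antisymm (fun x hx => ?_) (sup_le (Γ.closure_le_ext s t).1 ?_)
  · obtain ⟨c, hc⟩ := Γ.exists_sub_smul_mem_closure hst h hh hb
      ((Γ.ext s t).mem_graph ⟨x, hx⟩)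
    rw [show x = (x - c • (h : H)) + c • (h : H) by abel]
    exact Submodule.add_mem_sup (mem_domain_of_mem_graph hc)
      (Submodule.smul_mem _ _ (Submodule.mem_span_singleton_self _))
  · rwa [Submodule.span_singleton_le_iff_mem]

lemma hasCore_ext {s t : ℝ} (hst : s ≠ 0 ∨ t ≠ 0) (h : S.adjoint.domain)
    (hh : (s : ℂ) * (Γ.b h).2 = t * (Γ.b h).1) (hb : Γ.b h ≠ 0) :
    (Γ.ext s t).HasCore (S.domain ⊔ Submodule.span ℂ {(h : H)}) := by
  set A := Γ.ext s t
  set D := S.domain ⊔ Submodule.span ℂ {(h : H)}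
  have hg : ((h : H), S.adjoint h) ∈ A.graph :=
    (Γ.mem_graph_ext_iff s t _ _).2 ⟨h, rfl, rfl, hh⟩
  have hmem : (h : H) ∈ A.domain := mem_domain_of_mem_graph hg
  have hD : D ≤ A.domain :=
    sup_le (Γ.le_ext s t).1 ((Submodule.span_singleton_le_iff_mem _ _).2 hmem)
  have hAc : A.IsClosed := (Γ.isSelfAdjoint_ext hst).isClosed
  have hRle : A.domRestrict D ≤ A := domRestrict_le
  have hRc : (A.domRestrict D).IsClosable := hAc.isClosable.leIsClosable hRle
  have hgr : ∀ x y : H, x ∈ D → (x, y) ∈ A.graph → (x, y) ∈ (A.domRestrict D).graph := by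
    intro x y hx hxy
    obtain ⟨x', rfl, rfl⟩ := (mem_graph_iff _).1 hxy
    exact (mem_graph_iff _).2 ⟨⟨x', hx, x'.2⟩, rfl, rfl⟩
  have hS : S ≤ A.domRestrict D := le_of_le_graph fun p hp =>
    hgr p.1 p.2 (Submodule.mem_sup_left (mem_domain_of_mem_graph (y := p.2) hp))
      (le_graph_of_le (Γ.le_ext s t) hp)
  refine ⟨hD, le_antisymm ?_ (le_of_le_graph fun p hp => ?_)⟩
  · refine le_of_le_graph ?_
    rw [← hRc.graph_closure_eq_closure_graph]
    exact Submodule.topologicalClosure_minimal _ (le_graph_of_le hRle) hAc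
  · obtain ⟨c, hc⟩ := Γ.exists_sub_smul_mem_closure (x := p.1) (y := p.2) hst h hh hb hp
    have h1 := le_graph_of_le (hRc.closure_mono hS) hc
    have h2 := le_graph_of_le (le_closure _) (hgr _ _ (Submodule.mem_sup_right
      (Submodule.mem_span_singleton_self _)) hg)
    have h3 := Submodule.add_mem _ h1 (Submodule.smul_mem _ c h2)
    have e : (p.1 - c • (h : H), p.2 - c • S.adjoint h) + c • ((h : H), S.adjoint h) = p := by
      ext <;> simp
    rwa [e] at h3

include Γ in
/-- The deficiency spaces are lines: on an eigenvector with imaginary eigenvalue the form is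
definite, so that the first boundary value determines the eigenvector. -/
lemma mem_span_of_eigenvector {c : ℂ} (hc : c ≠ 0) (hc' : starRingEnd ℂ c = -c)
    (g x : S.adjoint.domain) (hg0 : (g : H) ≠ 0) (hg : S.adjoint g = c • (g : H))
    (hx : S.adjoint x = c • (x : H)) : (x : H) ∈ Submodule.span ℂ {(g : H)} := by
  have key : ∀ z : S.adjoint.domain, S.adjoint z = c • (z : H) → (Γ.b z).1 = 0 → (z : H) = 0 := by
    intro z hz hb
    have h1 := Γ.green z z
    rw [hb, hz, inner_smul_right, inner_smul_left, hc', _root_.map_zero, zero_mul, mul_zero, sub_zero,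
      mul_zero] at h1
    have h2 : 2 * c * inner ℂ (z : H) (z : H) = 0 := by linear_combination h1
    have h3 := (mul_eq_zero.1 h2).resolve_left (mul_ne_zero two_ne_zero hc)
    exact inner_self_eq_zero.1 h3
  have hβ : (Γ.b g).1 ≠ 0 := fun h => hg0 (key g hg h)
  have h1 := key ((Γ.b g).1 • x - (Γ.b x).1 • g) (by
    rw [LinearPMap.map_sub, LinearPMap.map_smul, LinearPMap.map_smul, hg, hx]
    simp only [Submodule.coe_sub, Submodule.coe_smul, smul_sub]
    rw [smul_comm c, smul_comm c]) (by simp [mul_comm])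
  simp only [Submodule.coe_sub, Submodule.coe_smul, sub_eq_zero] at h1
  refine Submodule.mem_span_singleton.2 ⟨(Γ.b x).1 / (Γ.b g).1, ?_⟩
  rw [div_eq_inv_mul, mul_smul, ← h1, smul_smul, inv_mul_cancel₀ hβ, one_smul]

end BoundaryMap

omit [CompleteSpace H] in
lemma norm_sq_add_imaginary {x y : H} (h : (inner ℂ y x : ℂ) = inner ℂ x y) (c : ℝ) :
    ‖y + (Complex.I * (c : ℂ)) • x‖ ^ 2 = ‖y‖ ^ 2 + c ^ 2 * ‖x‖ ^ 2 := by
  have h1 : RCLike.re (inner ℂ y ((Complex.I * (c : ℂ)) • x) : ℂ) = 0 := by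
    have hi : (inner ℂ y x : ℂ).im = 0 := by
      have := inner_conj_symm (𝕜 := ℂ) x y
      rw [← h] at this
      exact Complex.conj_eq_iff_im.1 this
    rw [inner_smul_right]
    simp [hi]
  rw [@norm_add_sq ℂ, h1, norm_smul, mul_pow]
  simp

/-- For a self-adjoint operator `A` and real `c ≠ 0` the operator `A + ic` is onto: its range is
closed because `‖(A + ic) x‖ ≥ |c| ‖x‖`, and a vector orthogonal to it is in the kernel of
`A - ic`. -/
lemma exists_eq_add_imaginary {A : H →ₗ.[ℂ] H} (hA : IsSelfAdjoint A) {c : ℝ} (hc : c ≠ 0) (y : H) :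
    ∃ x : A.domain, A x + (Complex.I * (c : ℂ)) • (x : H) = y := by
  have hA' := isSelfAdjoint_def.1 hA
  have hd := hA.dense_domain
  have hsym : ∀ x z : A.domain, (inner ℂ (A x) (z : H) : ℂ) = inner ℂ (x : H) (A z) := by
    intro x z
    have h1 : ((z : H), A z) ∈ A.adjoint.graph := by rw [hA']; exact A.mem_graph z
    exact (mem_graph_adjoint_iff hd _ _).1 h1 _ _ (A.mem_graph x)
  set L : A.graph →ₗ[ℂ] H := ((LinearMap.snd ℂ H H) + (Complex.I * (c : ℂ)) • (LinearMap.fst ℂ H H)).comp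
    A.graph.subtype with hL
  have hcomp : CompleteSpace A.graph := hA.isClosed.completeSpace_coe
  have hLval : ∀ x : A.domain, L ⟨((x : H), A x), A.mem_graph x⟩ =
    A x + (Complex.I * (c : ℂ)) • (x : H) := fun x => rfl
  have hbound : ∀ p : A.graph, ‖p‖ ≤ (1 + |c|⁻¹) * ‖L p‖ := by
    rintro ⟨p, hp⟩
    obtain ⟨x, hx1, hx2⟩ := (mem_graph_iff _).1 hp
    obtain ⟨p1, p2⟩ := p
    simp only at hx1 hx2
    subst hx1 hx2
    rw [hLval]
    have h1 := norm_sq_add_imaginary (hsym x x) c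
    set N := ‖A x + (Complex.I * (c : ℂ)) • (x : H)‖
    have hc' : 0 < |c| := abs_pos.2 hc
    have h2 : ‖A x‖ ≤ N := by
      refine abs_le_of_sq_le_sq' ?_ (norm_nonneg _) |>.2
      rw [h1]; nlinarith [sq_nonneg (c * ‖(x : H)‖)]
    have h3 : |c| * ‖(x : H)‖ ≤ N := by
      refine abs_le_of_sq_le_sq' ?_ (norm_nonneg _) |>.2
      rw [h1, mul_pow, sq_abs]; nlinarith [sq_nonneg ‖A x‖]
    have h4 : ‖(x : H)‖ ≤ |c|⁻¹ * N := by
      rw [inv_mul_eq_div, le_div_iff₀ hc']; linarith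
    have h0 : 0 ≤ N := norm_nonneg _
    have h5 : 0 ≤ |c|⁻¹ * N := by positivity
    refine max_le ?_ ?_
    · change ‖(x : H)‖ ≤ _; linarith
    · change ‖A x‖ ≤ _; linarith
  have hcl : IsClosed (LinearMap.range L : Set H) := by
    have hcont : Continuous L := by
      have h : Continuous fun p : A.graph => p.1.2 + (Complex.I * (c : ℂ)) • p.1.1 := by fun_prop
      exact h
    have hanti : AntilipschitzWith (Real.toNNReal (1 + |c|⁻¹)) L := by
      refine AddMonoidHomClass.antilipschitz_of_bound L fun p => ?_
      rw [Real.coe_toNNReal _ (by positivity)]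
      exact hbound p
    have hu : UniformContinuous L :=
      uniformContinuous_addMonoidHom_of_continuous (f := L.toAddMonoidHom) hcont
    exact hanti.isClosed_range hu
  have htop : LinearMap.range L = ⊤ := by
    rw [← hcl.submodule_topologicalClosure_eq, Submodule.topologicalClosure_eq_top_iff,
      Submodule.eq_bot_iff]
    intro v hv
    have h1 : ∀ x : A.domain, (inner ℂ (A x + (Complex.I * (c : ℂ)) • (x : H)) v : ℂ) = 0 :=
      fun x => (Submodule.mem_orthogonal _ _).1 hv _ ⟨_, hLval x⟩
    have h2 : (v, (Complex.I * (c : ℂ)) • v) ∈ A.graph := by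
      rw [← hA']
      refine (mem_graph_adjoint_iff hd _ _).2 fun z w hzw => ?_
      obtain ⟨x, rfl, rfl⟩ := (mem_graph_iff _).1 hzw
      have := h1 x
      rw [inner_add_left, inner_smul_left] at this
      rw [inner_smul_right]
      simp only [map_mul, Complex.conj_I, Complex.conj_ofReal] at this
      linear_combination this
    obtain ⟨x, hx1, hx2⟩ := (mem_graph_iff _).1 h2
    simp only at hx1 hx2
    have h3 := norm_sq_add_imaginary (hsym x x) (-c)
    rw [hx2, hx1] at h3
    have h4 : (Complex.I * (c : ℂ)) • v + (Complex.I * ((-c : ℝ) : ℂ)) • v = 0 := by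
      rw [← add_smul]; push_cast; ring_nf; simp
    rw [h4, norm_zero] at h3
    have hc2 : 0 < c ^ 2 := by positivity
    have h5 : ‖v‖ ^ 2 = 0 := by nlinarith [sq_nonneg ‖(Complex.I * (c : ℂ)) • v‖, sq_nonneg ‖v‖]
    simpa using h5
  have hy : y ∈ LinearMap.range L := by rw [htop]; trivial
  obtain ⟨⟨p, hp⟩, rfl⟩ := hy
  obtain ⟨x, hx1, hx2⟩ := (mem_graph_iff _).1 hp
  refine ⟨x, ?_⟩
  rw [← hLval]
  congr 2
  exact Prod.ext hx1 hx2

/-- The Cayley transform of a self-adjoint operator. -/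
lemma exists_cayley {A : H →ₗ.[ℂ] H} (hA : IsSelfAdjoint A) {c : ℝ} (hc : c ≠ 0) :
    ∃ U : H ≃ₗᵢ[ℂ] H, ∀ x : A.domain, U (A x + (Complex.I * (c : ℂ)) • (x : H)) =
      A x - (Complex.I * (c : ℂ)) • (x : H) := by
  have hA' := isSelfAdjoint_def.1 hA
  have hd := hA.dense_domain
  have hsym : ∀ x : A.domain, (inner ℂ (A x) (x : H) : ℂ) = inner ℂ (x : H) (A x) := by
    intro x
    have h1 : ((x : H), A x) ∈ A.adjoint.graph := by rw [hA']; exact A.mem_graph x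
    exact (mem_graph_adjoint_iff hd _ _).1 h1 _ _ (A.mem_graph x)
  have hneg : ∀ x : A.domain, A x - (Complex.I * (c : ℂ)) • (x : H) =
      A x + (Complex.I * ((-c : ℝ) : ℂ)) • (x : H) := by
    intro x; push_cast; rw [mul_neg, neg_smul, sub_eq_add_neg]
  set P : A.domain →ₗ[ℂ] H := A.toFun + (Complex.I * (c : ℂ)) • A.domain.subtype with hP
  set M : A.domain →ₗ[ℂ] H := A.toFun - (Complex.I * (c : ℂ)) • A.domain.subtype with hM
  have hPv : ∀ x : A.domain, P x = A x + (Complex.I * (c : ℂ)) • (x : H) := fun x => rfl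
  have hMv : ∀ x : A.domain, M x = A x - (Complex.I * (c : ℂ)) • (x : H) := fun x => rfl
  have hnorm : ∀ x, ‖M x‖ = ‖P x‖ := by
    intro x
    have h1 : ‖M x‖ ^ 2 = ‖P x‖ ^ 2 := by
      rw [hMv, hPv, hneg, norm_sq_add_imaginary (hsym x), norm_sq_add_imaginary (hsym x), neg_sq]
    exact (pow_left_inj₀ (norm_nonneg _) (norm_nonneg _) two_ne_zero).1 h1
  have hPs : Function.Surjective P := fun y => exists_eq_add_imaginary hA hc y
  have hMs : Function.Surjective M := fun y => by
    obtain ⟨x, hx⟩ := exists_eq_add_imaginary hA (neg_ne_zero.2 hc) y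
    exact ⟨x, by rw [hMv, hneg, hx]⟩
  have hPi : Function.Injective P := by
    rw [← LinearMap.ker_eq_bot, LinearMap.ker_eq_bot']
    intro x hx
    have h1 := norm_sq_add_imaginary (hsym x) c
    rw [← hPv, hx, norm_zero] at h1
    have hc2 : 0 < c ^ 2 := by positivity
    have h5 : ‖(x : H)‖ ^ 2 = 0 := by nlinarith [sq_nonneg ‖A x‖, sq_nonneg ‖(x : H)‖]
    exact Subtype.ext (by simpa using h5)
  set e := LinearEquiv.ofBijective P ⟨hPi, hPs⟩ with he
  set V : H →ₗᵢ[ℂ] H := ⟨M.comp e.symm.toLinearMap, fun y => by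
    obtain ⟨x, rfl⟩ := e.surjective y
    simp only [LinearMap.comp_apply, LinearEquiv.coe_coe, LinearEquiv.symm_apply_apply]
    exact hnorm x⟩
  have hVs : Function.Surjective V := fun y => by
    obtain ⟨x, rfl⟩ := hMs y
    exact ⟨e x, by simp [V]⟩
  refine ⟨LinearIsometryEquiv.ofSurjective V hVs, fun x => ?_⟩
  rw [← hPv, ← hMv]
  change M (e.symm (e x)) = M x
  rw [LinearEquiv.symm_apply_apply]

end Abstract

/-! ### The adjoint of the minimal operator -/

/-- `x` and `y` are the classes in `L²(0, ∞)` of `u` and `T_l² u`, for a function `u` of finite graph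
norm. -/
structure Represents (l : ℕ) (u : ℝ → ℂ) (x y : HSpace) : Prop where
  finite : FiniteGraphNorm l u
  fst : x =ᵐ[μ₀] u
  snd : y =ᵐ[μ₀] radialOp l (radialOp l u)

namespace FiniteGraphNorm

variable {l : ℕ} {u v : ℝ → ℂ}

lemma add (hu : FiniteGraphNorm l u) (hv : FiniteGraphNorm l v) : FiniteGraphNorm l (u + v) :=
  (hu.isQuasi.add hv.isQuasi).finiteGraphNorm (hu.memLp.add hv.memLp)
    (hu.memLp_sq.add hv.memLp_sq)

lemma smul (hu : FiniteGraphNorm l u) (c : ℂ) : FiniteGraphNorm l (c • u) :=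
  (hu.isQuasi.smul c).finiteGraphNorm (hu.memLp.const_smul c) (hu.memLp_sq.const_smul c)

lemma hasBoundaryValues_add (hu : FiniteGraphNorm l u) (hv : FiniteGraphNorm l v)
    {b c : Fin 4 → ℂ} (hb : HasBoundaryValues u b) (hc : HasBoundaryValues v c) :
    HasBoundaryValues (u + v) (b + c) := by
  intro k
  refine ((hb k).add (hc k)).congr' ?_
  filter_upwards [self_mem_nhdsWithin] with r hr
  have hk : ((k : ℕ) : WithTop ℕ∞) ≤ (3 : ℕ) := Nat.cast_le.2 (Nat.lt_succ_iff.1 k.2)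
  exact (iteratedDeriv_add ((hu.contDiffOn.contDiffAt (isOpen_Ioi.mem_nhds hr)).of_le hk)
    ((hv.contDiffOn.contDiffAt (isOpen_Ioi.mem_nhds hr)).of_le hk)).symm

end FiniteGraphNorm

lemma HasBoundaryValues.smul {u : ℝ → ℂ} {b : Fin 4 → ℂ} (hb : HasBoundaryValues u b) (c : ℂ) :
    HasBoundaryValues (c • u) (c • b) := by
  intro k
  refine ((hb k).const_smul c).congr' ?_
  filter_upwards with r
  simp [iteratedDeriv_const_smul_field]

lemma bvec_add (l : ℕ) (β α β' α' : ℂ) : bvec l β α + bvec l β' α' = bvec l (β + β') (α + α') := by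
  unfold bvec
  split_ifs <;> simp

lemma smul_bvec (l : ℕ) (c β α : ℂ) : c • bvec l β α = bvec l (c * β) (c * α) := by
  unfold bvec
  split_ifs <;> simp

namespace Represents

variable {l : ℕ} {u v : ℝ → ℂ} {x y x' y' : HSpace}

lemma add (h : Represents l u x y) (k : Represents l v x' y') :
    Represents l (u + v) (x + x') (y + y') where
  finite := h.finite.add k.finite
  fst := (Lp.coeFn_add _ _).trans (h.fst.add k.fst)
  snd := ((Lp.coeFn_add _ _).trans (h.snd.add k.snd)).trans
    (h.finite.isQuasi.add k.finite.isQuasi).radialOp_sq.symm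

lemma smul (h : Represents l u x y) (c : ℂ) : Represents l (c • u) (c • x) (c • y) where
  finite := h.finite.smul c
  fst := (Lp.coeFn_smul _ _).trans (h.fst.const_smul c)
  snd := ((Lp.coeFn_smul _ _).trans (h.snd.const_smul c)).trans
    (h.finite.isQuasi.smul c).radialOp_sq.symm

lemma eqOn (h : Represents l u x y) (k : Represents l v x y') : EqOn u v (Ioi 0) :=
  Measure.eqOn_open_of_ae_eq (h.fst.symm.trans k.fst) isOpen_Ioi h.finite.isQuasi.continuousOn_u
    k.finite.isQuasi.continuousOn_u

lemma exists_boundaryValues (hl : l = 1 ∨ l = 2) (h : Represents l u x y) :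
    ∃ β α : ℂ, HasBoundaryValues u (bvec l β α) :=
  RadialBilaplace.exists_boundaryValues hl h.finite.isQuasi h.finite.memLp h.finite.memLp_sq

end Represents

lemma finiteGraphNorm_of_mem_S0 {l : ℕ} {u : ℝ → ℂ} (hu : u ∈ S0 l) : FiniteGraphNorm l u where
  contDiffOn := hu.1.of_le (WithTop.coe_le_coe.2 le_top : ((3 : ℕ∞) : WithTop ℕ∞) ≤ ∞)
  absCont x y hx hxy := by
    have hs : uIcc x y ⊆ Ioi 0 := uIcc_subset_Ioi hx (hx.trans hxy)
    have hd : ∀ n : ℕ, ContDiffOn ℝ ∞ (iteratedDeriv n u) (Ioi 0) := by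
      intro n
      induction n with
      | zero => simpa using hu.1
      | succ n ih => rw [iteratedDeriv_succ]; exact contDiffOn_deriv ih
    refine absCont_of_hasDerivAt (f' := iteratedDeriv 4 u) (fun r hr => ?_)
      ((hd 4).continuousOn.mono hs)
    rw [iteratedDeriv_succ (n := 3)]
    exact (diffAt (hd 3) (hs hr)).hasDerivAt
  memLp := hu.2.2.1
  memLp_sq := hu.2.2.2

lemma hasBoundaryValues_of_mem_S0 {l : ℕ} {u : ℝ → ℂ} (hu : u ∈ S0 l) :
    HasBoundaryValues u (bvec l 0 0) := by
  rw [bvec_zero]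
  exact fun k => hu.2.1 k

lemma exists_represents_of_mem_graph {l : ℕ} {x y : HSpace} (h : (x, y) ∈ (minOp l).graph) :
    ∃ u, Represents l u x y ∧ HasBoundaryValues u (bvec l 0 0) := by
  obtain ⟨u, hu, hx, hy⟩ := (mem_graph_minOp l x y).1 h
  exact ⟨u, ⟨finiteGraphNorm_of_mem_S0 hu, hx, hy⟩, hasBoundaryValues_of_mem_S0 hu⟩

lemma mem_graph_minOp_of_mem_testFun (l : ℕ) {φ : ℝ → ℂ} (h : φ ∈ testFun) :
    ((memLp_of_mem_testFun h).toLp φ,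
      (memLp_of_mem_testFun (radialOp_mem_testFun l (radialOp_mem_testFun l h))).toLp _) ∈
      (minOp l).graph :=
  (mem_graph_minOp l _ _).2 ⟨φ, mem_S0_of_mem_testFun l h, MemLp.coeFn_toLp _, MemLp.coeFn_toLp _⟩

lemma locallyIntegrableOn_of_memLp {v : ℝ → ℂ} (hv : MemLp v 2 μ₀) :
    LocallyIntegrableOn v (Ioi 0) :=
  locallyIntegrableOn_of_locallyIntegrable_restrict (hv.locallyIntegrable (by norm_num))

/-- The pairing of the class of a test function with `x`. -/
lemma inner_toLp_testFun {ψ : ℝ → ℂ} (hψ : MemLp ψ 2 μ₀) (x : HSpace) :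
    inner ℂ (hψ.toLp ψ) x = starRingEnd ℂ (∫ r, starRingEnd ℂ (x r) * ψ r ∂μ₀) := by
  rw [L2.inner_def, ← integral_conj]
  refine integral_congr_ae ?_
  filter_upwards [hψ.coeFn_toLp] with r hr
  rw [hr]
  simp [RCLike.inner_apply]

lemma dense_domain_minOp (l : ℕ) : Dense ((minOp l).domain : Set HSpace) := by
  rw [Submodule.dense_iff_topologicalClosure_eq_top, Submodule.topologicalClosure_eq_top_iff,
    Submodule.eq_bot_iff]
  intro v hv
  have h0 : (fun r => starRingEnd ℂ (v r)) =ᵐ[μ₀] 0 := by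
    refine ae_eq_zero_of_pairing (locallyIntegrableOn_of_memLp (Lp.memLp v).star) fun φ hφ => ?_
    have h1 := (Submodule.mem_orthogonal _ _).1 hv _
      (LinearPMap.mem_domain_of_mem_graph (mem_graph_minOp_of_mem_testFun l hφ))
    rw [inner_toLp_testFun] at h1
    exact (map_eq_zero _).1 h1
  refine Lp.ext ?_
  filter_upwards [h0, Lp.coeFn_zero ℂ 2 μ₀] with r h1 h2
  rw [h2]
  exact (map_eq_zero _).1 h1

/-- The adjoint of the minimal operator is the differential operation on all functions of finite
graph norm: elements of the domain of the adjoint are regular because they solve the equation in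
the weak sense, and the converse is Green's formula. -/
lemma mem_graph_adjoint_minOp {l : ℕ} (hl : l = 1 ∨ l = 2) (x y : HSpace) :
    (x, y) ∈ (minOp l).adjoint.graph ↔ ∃ u, Represents l u x y := by
  rw [mem_graph_adjoint_iff (dense_domain_minOp l)]
  constructor
  · intro h
    obtain ⟨u, u1, p, p1, hq, hxu⟩ := exists_isQuasi_of_weak (l := l)
      (locallyIntegrableOn_of_memLp (Lp.memLp x).star)
      (locallyIntegrableOn_of_memLp (Lp.memLp y).star) (fun φ hφ => by
        have h1 := h _ _ (mem_graph_minOp_of_mem_testFun l hφ)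
        rw [inner_toLp_testFun, inner_toLp_testFun] at h1
        exact (starRingEnd ℂ).injective h1)
    have hxu' : x =ᵐ[μ₀] fun r => starRingEnd ℂ (u r) := by
      filter_upwards [hxu] with r hr
      rw [← hr]
      simp
    have hy' : (fun r => starRingEnd ℂ (starRingEnd ℂ (y r))) =ᵐ[μ₀] y := by
      filter_upwards with r
      simp
    have hc := hq.conj.congr_rhs hy'
    exact ⟨_, hc.finiteGraphNorm ((memLp_congr_ae hxu').1 (Lp.memLp x)) (Lp.memLp y), hxu',
      hc.radialOp_sq.symm⟩
  · rintro ⟨u, hu⟩ z w hzw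
    obtain ⟨v, hv, hv0⟩ := exists_represents_of_mem_graph hzw
    obtain ⟨β, α, hb⟩ := hu.exists_boundaryValues hl
    have := inner_green hl hv.finite hu.finite hv.fst hv.snd hu.fst hu.snd hv0 hb
    simp only [map_zero, zero_mul, sub_zero, mul_zero] at this
    exact (sub_eq_zero.1 this).symm

lemma minOp_le_adjoint {l : ℕ} (hl : l = 1 ∨ l = 2) : minOp l ≤ (minOp l).adjoint := by
  refine LinearPMap.le_of_le_graph fun p hp => ?_
  obtain ⟨u, hu, -⟩ := exists_represents_of_mem_graph (x := p.1) (y := p.2) hp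
  exact (mem_graph_adjoint_minOp hl p.1 p.2).2 ⟨u, hu⟩

/-! ### The boundary map -/

section Boundary

variable {l : ℕ} (hl : l = 1 ∨ l = 2)

include hl in
lemma exists_boundary (x : (minOp l).adjoint.domain) :
    ∃ (u : ℝ → ℂ) (q : ℂ × ℂ), Represents l u x ((minOp l).adjoint x) ∧
      HasBoundaryValues u (bvec l q.1 q.2) := by
  obtain ⟨u, hu⟩ := (mem_graph_adjoint_minOp hl _ _).1 ((minOp l).adjoint.mem_graph x)
  obtain ⟨β, α, hb⟩ := hu.exists_boundaryValues hl
  exact ⟨u, (β, α), hu, hb⟩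

lemma eq_of_boundary {u v : ℝ → ℂ} {x y y' : HSpace} {q q' : ℂ × ℂ} (hu : Represents l u x y)
    (hb : HasBoundaryValues u (bvec l q.1 q.2)) (hv : Represents l v x y')
    (hc : HasBoundaryValues v (bvec l q'.1 q'.2)) : q = q' := by
  have := bvec_injective l ((hb.congr (hu.eqOn hv)).unique hc)
  exact Prod.ext this.1 this.2

/-- The boundary values `(β, α)`, in the sense of `bvec`, of the elements of the domain of the
adjoint. -/
noncomputable def boundaryMap : (minOp l).adjoint.domain →ₗ[ℂ] ℂ × ℂ where
  toFun x := (exists_boundary hl x).choose_spec.choose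
  map_add' x y := by
    obtain ⟨hu, hb⟩ := (exists_boundary hl x).choose_spec.choose_spec
    obtain ⟨hv, hc⟩ := (exists_boundary hl y).choose_spec.choose_spec
    obtain ⟨hw, hd⟩ := (exists_boundary hl (x + y)).choose_spec.choose_spec
    have h := hu.finite.hasBoundaryValues_add hv.finite hb hc
    rw [bvec_add] at h
    exact (eq_of_boundary (q := _ + _) (hu.add hv) h hw hd).symm
  map_smul' c x := by
    obtain ⟨hu, hb⟩ := (exists_boundary hl x).choose_spec.choose_spec
    obtain ⟨hw, hd⟩ := (exists_boundary hl (c • x)).choose_spec.choose_spec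
    have h := hb.smul c
    rw [smul_bvec] at h
    exact (eq_of_boundary (q := c • _) (hu.smul c) h hw hd).symm

lemma boundaryMap_eq {x : (minOp l).adjoint.domain} {u : ℝ → ℂ} {y : HSpace} {q : ℂ × ℂ}
    (hu : Represents l u x y) (hb : HasBoundaryValues u (bvec l q.1 q.2)) :
    boundaryMap hl x = q := by
  obtain ⟨hw, hd⟩ := (exists_boundary hl x).choose_spec.choose_spec
  exact eq_of_boundary hw hd hu hb

lemma boundaryMap_spec (x : (minOp l).adjoint.domain) :
    ∃ u : ℝ → ℂ, Represents l u x ((minOp l).adjoint x) ∧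
      HasBoundaryValues u (bvec l (boundaryMap hl x).1 (boundaryMap hl x).2) :=
  ⟨_, (exists_boundary hl x).choose_spec.choose_spec⟩

include hl in
/-- A representative determines an element of the domain of the adjoint. -/
lemma exists_adjoint_domain {u : ℝ → ℂ} {x y : HSpace} (h : Represents l u x y) :
    ∃ x' : (minOp l).adjoint.domain, (x' : HSpace) = x ∧ (minOp l).adjoint x' = y :=
  (LinearPMap.mem_graph_iff _).1 ((mem_graph_adjoint_minOp hl x y).2 ⟨u, h⟩)

lemma boundaryMap_green (x y : (minOp l).adjoint.domain) :
    (inner ℂ (x : HSpace) ((minOp l).adjoint y) : ℂ) - inner ℂ ((minOp l).adjoint x) (y : HSpace) =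
      (2 * l + 1) * (starRingEnd ℂ (boundaryMap hl x).1 * (boundaryMap hl y).2 -
        starRingEnd ℂ (boundaryMap hl x).2 * (boundaryMap hl y).1) := by
  obtain ⟨u, hu, hb⟩ := boundaryMap_spec hl x
  obtain ⟨v, hv, hc⟩ := boundaryMap_spec hl y
  exact inner_green hl hu.finite hv.finite hu.fst hu.snd hv.fst hv.snd hb hc

end Boundary

/-! ### Exponential solutions -/

/-- The solution `D_l e^(kr)` of `T_l u = -k² u`, for `l ∈ {1, 2}`. -/
noncomputable def expSol (l : ℕ) (k : ℂ) (r : ℝ) : ℂ :=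
  Complex.exp (k * r) * if l = 1 then k - 1 / r else k ^ 2 - 3 * k / r + 3 / (r : ℂ) ^ 2

/-- The derivative of `expSol l k`. -/
noncomputable def expSol1 (l : ℕ) (k : ℂ) (r : ℝ) : ℂ :=
  Complex.exp (k * r) * if l = 1 then k ^ 2 - k / r + 1 / (r : ℂ) ^ 2
    else k ^ 3 - 3 * k ^ 2 / r + 6 * k / (r : ℂ) ^ 2 - 6 / (r : ℂ) ^ 3

lemma hasDerivAt_exp_mul (k : ℂ) (r : ℝ) :
    HasDerivAt (fun r : ℝ => Complex.exp (k * r)) (k * Complex.exp (k * r)) r := by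
  have h := ((hasDerivAt_id r).ofReal_comp.const_mul k).cexp
  simpa [mul_comm] using h

lemma hasDerivAt_const_div_pow (c : ℂ) (n : ℕ) {r : ℝ} (hr : 0 < r) :
    HasDerivAt (fun r : ℝ => c / (r : ℂ) ^ n) (-n * c / (r : ℂ) ^ (n + 1)) r := by
  have hr' : (r : ℂ) ≠ 0 := by exact_mod_cast hr.ne'
  have h := (hasDerivAt_ofReal_zpow (-(n : ℤ)) hr).const_mul c
  refine (h.congr_of_eventuallyEq (Eventually.of_forall fun x => ?_)).congr_deriv ?_
  · simp [div_eq_mul_inv]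
  · rw [show (-(n : ℤ) - 1) = -((n + 1 : ℕ) : ℤ) by push_cast; ring, zpow_neg, zpow_natCast]
    push_cast
    ring

lemma hasDerivAt_expSol {l : ℕ} (hl : l = 1 ∨ l = 2) (k : ℂ) {r : ℝ} (hr : 0 < r) :
    HasDerivAt (expSol l k) (expSol1 l k r) r := by
  have hr' : (r : ℂ) ≠ 0 := by exact_mod_cast hr.ne'
  have he := hasDerivAt_exp_mul k r
  rcases hl with rfl | rfl
  · have h := he.mul ((hasDerivAt_const r k).sub (hasDerivAt_const_div_pow 1 1 hr))
    refine (h.congr_of_eventuallyEq (Eventually.of_forall fun x => ?_)).congr_deriv ?_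
    · simp [expSol]
    · simp [expSol1]; field_simp
  · have h := he.mul (((hasDerivAt_const r (k ^ 2)).sub
      (hasDerivAt_const_div_pow (3 * k) 1 hr)).add (hasDerivAt_const_div_pow 3 2 hr))
    refine (h.congr_of_eventuallyEq (Eventually.of_forall fun x => ?_)).congr_deriv ?_
    · simp [expSol]
    · simp [expSol1]; field_simp; ring

lemma hasDerivAt_expSol1 {l : ℕ} (hl : l = 1 ∨ l = 2) (k : ℂ) {r : ℝ} (hr : 0 < r) :
    HasDerivAt (expSol1 l k) (pot l r * expSol l k r + k ^ 2 * expSol l k r) r := by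
  have hr' : (r : ℂ) ≠ 0 := by exact_mod_cast hr.ne'
  have he := hasDerivAt_exp_mul k r
  rcases hl with rfl | rfl
  · have h := he.mul (((hasDerivAt_const r (k ^ 2)).sub
      (hasDerivAt_const_div_pow k 1 hr)).add (hasDerivAt_const_div_pow 1 2 hr))
    refine (h.congr_of_eventuallyEq (Eventually.of_forall fun x => ?_)).congr_deriv ?_
    · simp [expSol1]
    · simp [expSol, pot]; field_simp; ring
  · have h := he.mul ((((hasDerivAt_const r (k ^ 3)).sub
      (hasDerivAt_const_div_pow (3 * k ^ 2) 1 hr)).add (hasDerivAt_const_div_pow (6 * k) 2 hr)).sub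
      (hasDerivAt_const_div_pow 6 3 hr))
    refine (h.congr_of_eventuallyEq (Eventually.of_forall fun x => ?_)).congr_deriv ?_
    · simp [expSol1]
    · simp [expSol, pot]; field_simp; ring

/-- If `k₁⁴ = k₂⁴ = c`, the difference of the exponential solutions is an eigenfunction of `T_l²`. -/
lemma isQuasi_expSol_sub {l : ℕ} (hl : l = 1 ∨ l = 2) {k₁ k₂ c : ℂ} (h₁ : k₁ ^ 4 = c)
    (h₂ : k₂ ^ 4 = c) :
    IsQuasi l (fun r => expSol l k₁ r - expSol l k₂ r) (fun r => expSol1 l k₁ r - expSol1 l k₂ r)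
      (fun r => -k₁ ^ 2 * expSol l k₁ r - -k₂ ^ 2 * expSol l k₂ r)
      (fun r => -k₁ ^ 2 * expSol1 l k₁ r - -k₂ ^ 2 * expSol1 l k₂ r)
      (fun r => c * (expSol l k₁ r - expSol l k₂ r)) := by
  have hd : ∀ r : ℝ, 0 < r → HasDerivAt
      (fun r => -k₁ ^ 2 * expSol1 l k₁ r - -k₂ ^ 2 * expSol1 l k₂ r)
      (pot l r * (-k₁ ^ 2 * expSol l k₁ r - -k₂ ^ 2 * expSol l k₂ r) -
        c * (expSol l k₁ r - expSol l k₂ r)) r := fun r hr =>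
    (((hasDerivAt_expSol1 hl k₁ hr).const_mul (-k₁ ^ 2)).sub
      ((hasDerivAt_expSol1 hl k₂ hr).const_mul (-k₂ ^ 2))).congr_deriv (by
        linear_combination -expSol l k₁ r * h₁ + expSol l k₂ r * h₂)
  have hc : ∀ k : ℂ, ContinuousOn (expSol l k) (Ioi 0) := fun k r hr =>
    (hasDerivAt_expSol hl k hr).continuousAt.continuousWithinAt
  refine ⟨fun r hr => (hasDerivAt_expSol hl k₁ hr).sub (hasDerivAt_expSol hl k₂ hr),
    fun r hr => ((hasDerivAt_expSol1 hl k₁ hr).sub (hasDerivAt_expSol1 hl k₂ hr)).congr_deriv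
      (by ring),
    fun r hr => ((hasDerivAt_expSol hl k₁ hr).const_mul _).sub
      ((hasDerivAt_expSol hl k₂ hr).const_mul _), fun x y hx hy => ?_, ?_⟩
  · have hs := uIcc_subset_Ioi hx hy
    refine absCont_of_hasDerivAt (fun r hr => hd r (hs hr)) (ContinuousOn.mono ?_ hs)
    exact ((continuousOn_pot l).mul ((continuousOn_const.mul (hc k₁)).sub
      (continuousOn_const.mul (hc k₂)))).sub (continuousOn_const.mul ((hc k₁).sub (hc k₂)))
  · exact Eventually.of_forall hd

/-- The remainder of the exponential series after the term of order `5`, divided by `r⁵`. -/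
noncomputable def expRem (k : ℂ) (r : ℝ) : ℂ :=
  (Complex.exp (k * r) - ∑ j ∈ Finset.range 6, (k * r) ^ j / (j.factorial : ℂ)) / (r : ℂ) ^ 5

lemma tendsto_expRem (k : ℂ) : Tendsto (expRem k) (𝓝[>] 0) (𝓝 0) := by
  have h1 : Tendsto (fun r : ℝ => ‖k‖ ^ 6 * r * Real.exp ‖k * r‖) (𝓝[>] 0) (𝓝 0) := by
    have : Continuous fun r : ℝ => ‖k‖ ^ 6 * r * Real.exp ‖k * r‖ := by fun_prop
    have := (this.tendsto 0).mono_left (nhdsWithin_le_nhds (s := Ioi 0))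
    simpa using this
  refine squeeze_zero_norm' ?_ h1
  filter_upwards [self_mem_nhdsWithin] with r (hr : 0 < r)
  have h2 := Complex.norm_exp_sub_sum_le_norm_mul_exp (k * r) 6
  rw [expRem, norm_div, norm_pow, Complex.norm_real, Real.norm_of_nonneg hr.le,
    div_le_iff₀ (by positivity)]
  refine h2.trans (le_of_eq ?_)
  rw [norm_mul, Complex.norm_real, Real.norm_of_nonneg hr.le]
  ring

lemma exp_eq_expRem (k : ℂ) {r : ℝ} (hr : 0 < r) : Complex.exp (k * r) =
    1 + k * r + (k * r) ^ 2 / 2 + (k * r) ^ 3 / 6 + (k * r) ^ 4 / 24 + (k * r) ^ 5 / 120 +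
      (r : ℂ) ^ 5 * expRem k r := by
  have hr' : (r : ℂ) ≠ 0 := by exact_mod_cast hr.ne'
  rw [expRem, mul_div_cancel₀ _ (pow_ne_zero 5 hr')]
  simp only [Finset.sum_range_succ, Finset.sum_range_zero, Nat.factorial]
  push_cast
  ring

lemma tendsto_of_eq_expRem {F M N : ℝ → ℂ} {k L : ℂ} (hM : Continuous M) (hN : Continuous N)
    (h : ∀ r : ℝ, 0 < r → F r = L + r * M r + expRem k r * N r) :
    Tendsto F (𝓝[>] 0) (𝓝 L) := by
  have hM' : Tendsto (fun r : ℝ => L + r * M r) (𝓝[>] 0) (𝓝 L) := by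
    have hc : Continuous fun r : ℝ => L + r * M r := by fun_prop
    have := (hc.tendsto 0).mono_left (nhdsWithin_le_nhds (s := Ioi 0))
    simpa using this
  have hN' := (hN.tendsto 0).mono_left (nhdsWithin_le_nhds (s := Ioi 0))
  have h1 := hM'.add ((tendsto_expRem k).mul hN')
  rw [zero_mul, add_zero] at h1
  refine h1.congr' ?_
  filter_upwards [self_mem_nhdsWithin] with r hr
  exact (h r hr).symm

lemma tendsto_expSol_one (k : ℂ) :
    Tendsto (fun r : ℝ => expSol 1 k r + 1 / r) (𝓝[>] 0) (𝓝 0) := by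
  refine tendsto_of_eq_expRem (k := k) (M := fun r => k ^ 2 / 2 + k ^ 3 / 3 * r +
    k ^ 4 / 8 * (r : ℂ) ^ 2 + k ^ 5 / 30 * (r : ℂ) ^ 3 + k ^ 6 / 120 * (r : ℂ) ^ 4)
    (N := fun r => -(r : ℂ) ^ 4 + k * (r : ℂ) ^ 5) (by fun_prop) (by fun_prop) fun r hr => ?_
  have hr' : (r : ℂ) ≠ 0 := by exact_mod_cast hr.ne'
  rw [expSol, exp_eq_expRem k hr]
  simp only [if_true]
  field_simp
  ring

lemma tendsto_expSol1_one (k : ℂ) :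
    Tendsto (fun r : ℝ => expSol1 1 k r - 1 / (r : ℂ) ^ 2) (𝓝[>] 0) (𝓝 (k ^ 2 / 2)) := by
  refine tendsto_of_eq_expRem (k := k) (M := fun r => 2 / 3 * k ^ 3 + 3 / 8 * k ^ 4 * r +
    2 / 15 * k ^ 5 * (r : ℂ) ^ 2 + k ^ 6 / 30 * (r : ℂ) ^ 3 + k ^ 7 / 120 * (r : ℂ) ^ 4)
    (N := fun r => (r : ℂ) ^ 3 - k * (r : ℂ) ^ 4 + k ^ 2 * (r : ℂ) ^ 5) (by fun_prop)
    (by fun_prop) fun r hr => ?_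
  have hr' : (r : ℂ) ≠ 0 := by exact_mod_cast hr.ne'
  rw [expSol1, exp_eq_expRem k hr]
  simp only [if_true]
  field_simp
  ring

lemma tendsto_expSol2_one (k : ℂ) :
    Tendsto (fun r : ℝ => pot 1 r * expSol 1 k r + k ^ 2 * expSol 1 k r + 2 / (r : ℂ) ^ 3)
      (𝓝[>] 0) (𝓝 (2 / 3 * k ^ 3)) := by
  refine tendsto_of_eq_expRem (k := k) (M := fun r => 3 / 4 * k ^ 4 + 2 / 5 * k ^ 5 * r +
    17 / 120 * k ^ 6 * (r : ℂ) ^ 2 + k ^ 7 / 30 * (r : ℂ) ^ 3 + k ^ 8 / 120 * (r : ℂ) ^ 4)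
    (N := fun r => -2 * (r : ℂ) ^ 2 + 2 * k * (r : ℂ) ^ 3 - k ^ 2 * (r : ℂ) ^ 4 +
      k ^ 3 * (r : ℂ) ^ 5) (by fun_prop) (by fun_prop) fun r hr => ?_
  have hr' : (r : ℂ) ≠ 0 := by exact_mod_cast hr.ne'
  rw [expSol, exp_eq_expRem k hr]
  simp only [if_true, pot, Nat.cast_one]
  field_simp
  ring

lemma tendsto_expSol_two (k : ℂ) :
    Tendsto (fun r : ℝ => expSol 2 k r - 3 / (r : ℂ) ^ 2) (𝓝[>] 0) (𝓝 (-k ^ 2 / 2)) := by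
  refine tendsto_of_eq_expRem (k := k) (M := fun r => k ^ 4 / 8 * r +
    k ^ 5 / 15 * (r : ℂ) ^ 2 + k ^ 6 / 60 * (r : ℂ) ^ 3 + k ^ 7 / 120 * (r : ℂ) ^ 4)
    (N := fun r => 3 * (r : ℂ) ^ 3 - 3 * k * (r : ℂ) ^ 4 + k ^ 2 * (r : ℂ) ^ 5) (by fun_prop)
    (by fun_prop) fun r hr => ?_
  have hr' : (r : ℂ) ≠ 0 := by exact_mod_cast hr.ne'
  rw [expSol, exp_eq_expRem k hr]
  simp only [OfNat.ofNat_ne_one, if_false]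
  field_simp
  ring

lemma tendsto_expSol3_two (k : ℂ) :
    Tendsto (fun r : ℝ => pot1 2 r * expSol 2 k r + pot 2 r * expSol1 2 k r +
      k ^ 2 * expSol1 2 k r + 72 / (r : ℂ) ^ 5) (𝓝[>] 0) (𝓝 (2 / 5 * k ^ 5)) := by
  refine tendsto_of_eq_expRem (k := k) (M := fun r => 3 / 5 * k ^ 6 + k ^ 7 / 5 * r +
    17 / 120 * k ^ 8 * (r : ℂ) ^ 2 + k ^ 9 / 60 * (r : ℂ) ^ 3 + k ^ 10 / 120 * (r : ℂ) ^ 4)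
    (N := fun r => -72 + 72 * k * r - 36 * k ^ 2 * (r : ℂ) ^ 2 + 12 * k ^ 3 * (r : ℂ) ^ 3 -
      3 * k ^ 4 * (r : ℂ) ^ 4 + k ^ 5 * (r : ℂ) ^ 5) (by fun_prop) (by fun_prop) fun r hr => ?_
  have hr' : (r : ℂ) ≠ 0 := by exact_mod_cast hr.ne'
  rw [expSol, expSol1, exp_eq_expRem k hr]
  simp only [OfNat.ofNat_ne_one, if_false, pot, pot1, Nat.cast_ofNat]
  field_simp
  ring

/-- The limit of `expSol l k₁ - expSol l k₂` at `0`; the singular parts cancel. -/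
lemma exists_tendsto_expSol_sub {l : ℕ} (hl : l = 1 ∨ l = 2) (k₁ k₂ : ℂ) :
    ∃ L : ℂ, Tendsto (fun r => expSol l k₁ r - expSol l k₂ r) (𝓝[>] 0) (𝓝 L) := by
  rcases hl with rfl | rfl
  · exact ⟨_, ((tendsto_expSol_one k₁).sub (tendsto_expSol_one k₂)).congr fun r => by ring⟩
  · exact ⟨_, ((tendsto_expSol_two k₁).sub (tendsto_expSol_two k₂)).congr fun r => by ring⟩

lemma norm_expSol_le {l : ℕ} {k : ℂ} {c r : ℝ} (hk : k.re ≤ -c)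
    (hr : 1 ≤ r) : ‖expSol l k r‖ ≤ (‖k‖ ^ 2 + 3 * ‖k‖ + ‖k‖ + 4) * Real.exp (-c * r) := by
  have hr0 : 0 < r := one_pos.trans_le hr
  have hd : ∀ (z : ℂ) (n : ℕ), ‖z / (r : ℂ) ^ n‖ ≤ ‖z‖ := fun z n => norm_const_div_pow_le z n hr
  have he : ‖Complex.exp (k * r)‖ ≤ Real.exp (-c * r) := by
    rw [Complex.norm_exp]
    refine Real.exp_le_exp.2 ?_
    simp only [Complex.mul_re, Complex.ofReal_re, Complex.ofReal_im, mul_zero, sub_zero]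
    gcongr
  have h0 := norm_nonneg k
  rw [expSol, norm_mul, mul_comm]
  refine mul_le_mul ?_ he (norm_nonneg _) (by positivity)
  split_ifs
  · have h1 := hd 1 1
    rw [pow_one, norm_one] at h1
    refine (norm_sub_le _ _).trans ?_
    nlinarith
  · have h1 := hd (3 * k) 1
    have h2 := hd 3 2
    rw [pow_one, norm_mul] at h1
    have h3 : ‖(3 : ℂ)‖ = 3 := by simp
    rw [h3] at h1 h2
    refine (norm_add_le _ _).trans ?_
    have h4 := norm_sub_le (k ^ 2) (3 * k / r)
    rw [norm_pow] at h4
    linarith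

lemma memLp_of_norm_le_exp {u : ℝ → ℂ} (hu : ContinuousOn u (Ioi 0)) {c C : ℝ} (hc : 0 < c)
    (h : ∀ r : ℝ, 0 < r → ‖u r‖ ≤ C * Real.exp (-c * r)) : MemLp u 2 μ₀ := by
  have h1 : MemLp (fun r : ℝ => C * Real.exp (-c * r)) 2 μ₀ := by
    refine MemLp.const_mul ?_ C
    rw [memLp_two_iff_integrable_sq (by fun_prop)]
    refine (exp_neg_integrableOn_Ioi 0 (b := 2 * c) (by positivity)).congr
      (Eventually.of_forall fun r => ?_)
    simp only
    rw [← Real.exp_nat_mul]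
    push_cast
    ring_nf
  refine h1.mono (hu.aestronglyMeasurable measurableSet_Ioi) ?_
  filter_upwards [ae_restrict_mem measurableSet_Ioi] with r hr
  exact (h r hr).trans (le_abs_self _)

lemma memLp_expSol_sub {l : ℕ} (hl : l = 1 ∨ l = 2) {k₁ k₂ : ℂ} (h₁ : k₁.re < 0)
    (h₂ : k₂.re < 0) : MemLp (fun r => expSol l k₁ r - expSol l k₂ r) 2 μ₀ := by
  set u := fun r => expSol l k₁ r - expSol l k₂ r with hu
  have hcont : ContinuousOn u (Ioi 0) := fun r hr =>
    ((hasDerivAt_expSol hl k₁ hr).sub (hasDerivAt_expSol hl k₂ hr)).continuousAt.continuousWithinAt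
  obtain ⟨c, hc, hc1, hc2⟩ : ∃ c : ℝ, 0 < c ∧ k₁.re ≤ -c ∧ k₂.re ≤ -c :=
    ⟨min (-k₁.re) (-k₂.re), lt_min (by linarith) (by linarith),
      by linarith [min_le_left (-k₁.re) (-k₂.re)], by linarith [min_le_right (-k₁.re) (-k₂.re)]⟩
  obtain ⟨L, hL⟩ := exists_tendsto_expSol_sub hl k₁ k₂
  -- a bound on `(0, δ)` from the limit, on `[δ, 1]` from compactness, on `[1, ∞)` from the decay
  obtain ⟨δ, hδ, hb⟩ : ∃ δ : ℝ, 0 < δ ∧ ∀ r ∈ Ioo 0 δ, ‖u r‖ < ‖L‖ + 1 := by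
    have := hL.norm.eventually (gt_mem_nhds (lt_add_one ‖L‖))
    obtain ⟨δ, hδ, h⟩ := (mem_nhdsGT_iff_exists_Ioo_subset).1 this
    exact ⟨δ, hδ, h⟩
  obtain ⟨M, hM⟩ := (isCompact_Icc (a := δ) (b := 1)).exists_bound_of_continuousOn
    (hcont.mono fun r hr => hδ.trans_le hr.1)
  set K := max (‖L‖ + 1) M with hK
  have hK0 : 0 ≤ K := le_max_of_le_left (by positivity)
  refine memLp_of_norm_le_exp (C := K * Real.exp c + (‖k₁‖ ^ 2 + 3 * ‖k₁‖ + ‖k₁‖ + 4) +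
    (‖k₂‖ ^ 2 + 3 * ‖k₂‖ + ‖k₂‖ + 4)) hcont hc fun r hr => ?_
  have he := Real.exp_pos (-c * r)
  rcases le_or_gt 1 r with h1 | h1
  · have e1 := norm_expSol_le (l := l) hc1 h1
    have e2 := norm_expSol_le (l := l) hc2 h1
    have e3 : 0 ≤ K * Real.exp c * Real.exp (-c * r) := by positivity
    have := norm_sub_le (expSol l k₁ r) (expSol l k₂ r)
    rw [add_mul, add_mul]
    linarith
  · have h2 : ‖u r‖ ≤ K := by
      rcases lt_or_ge r δ with h3 | h3
      · exact (hb r ⟨hr, h3⟩).le.trans (le_max_left _ _)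
      · exact (hM r ⟨h3, h1.le⟩).trans (le_max_right _ _)
    have h3 : K ≤ K * Real.exp c * Real.exp (-c * r) := by
      rw [mul_assoc, ← Real.exp_add]
      refine le_mul_of_one_le_right hK0 (Real.one_le_exp ?_)
      nlinarith
    have h4 : 0 ≤ (‖k₁‖ ^ 2 + 3 * ‖k₁‖ + ‖k₁‖ + 4) * Real.exp (-c * r) := by positivity
    have h5 : 0 ≤ (‖k₂‖ ^ 2 + 3 * ‖k₂‖ + ‖k₂‖ + 4) * Real.exp (-c * r) := by positivity
    rw [add_mul, add_mul]
    linarith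

/-- The boundary values of the difference of two exponential solutions. -/
lemma hasBoundaryValues_expSol_sub {l : ℕ} (hl : l = 1 ∨ l = 2) {k₁ k₂ c : ℂ} (h₁ : k₁ ^ 4 = c)
    (h₂ : k₂ ^ 4 = c) (h₁' : k₁.re < 0) (h₂' : k₂.re < 0) :
    HasBoundaryValues (fun r => expSol l k₁ r - expSol l k₂ r)
      (if l = 1 then bvec 1 ((k₁ ^ 2 - k₂ ^ 2) / 2) (2 / 3 * (k₁ ^ 3 - k₂ ^ 3))
        else bvec 2 (-(k₁ ^ 2 - k₂ ^ 2) / 2) (2 / 5 * (k₁ ^ 5 - k₂ ^ 5))) := by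
  have hq := isQuasi_expSol_sub hl h₁ h₂
  have hm := memLp_expSol_sub hl h₁' h₂'
  obtain ⟨β, α, hb⟩ := exists_boundaryValues hl hq hm (hm.const_mul c)
  have hlim : ∀ (j : Fin 4) {F : ℝ → ℂ} {L : ℂ},
      EqOn (iteratedDeriv j fun r => expSol l k₁ r - expSol l k₂ r) F (Ioi 0) →
      Tendsto F (𝓝[>] 0) (𝓝 L) → bvec l β α j = L := fun j F L he hL =>
    tendsto_nhds_unique (hb j) (hL.congr' (by
      filter_upwards [self_mem_nhdsWithin] with r hr using (he hr).symm))
  rcases hl with rfl | rfl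
  · have e1 := hlim 1 (L := (k₁ ^ 2 - k₂ ^ 2) / 2) (by
        simpa [iteratedDeriv_one] using hq.deriv_u)
      (((tendsto_expSol1_one k₁).sub (tendsto_expSol1_one k₂)).congr' (by
        filter_upwards with r; ring) |>.trans (by rw [sub_div]))
    have e2 := hlim 2 (L := 2 / 3 * (k₁ ^ 3 - k₂ ^ 3)) hq.iteratedDeriv_two
      (((tendsto_expSol2_one k₁).sub (tendsto_expSol2_one k₂)).congr' (by
        filter_upwards with r; ring) |>.trans (by rw [mul_sub]))
    simp only [bvec, if_true] at e1 e2
    simp only [if_true]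
    rw [← e1, ← e2]
    exact hb
  · have e1 := hlim 0 (L := -(k₁ ^ 2 - k₂ ^ 2) / 2) (F := fun r => expSol 2 k₁ r - expSol 2 k₂ r)
      (by intro r hr; simp)
      (((tendsto_expSol_two k₁).sub (tendsto_expSol_two k₂)).congr' (by
        filter_upwards with r; ring) |>.trans (by
          rw [show -(k₁ ^ 2 - k₂ ^ 2) / 2 = -k₁ ^ 2 / 2 - -k₂ ^ 2 / 2 by ring]))
    have e2 := hlim 3 (L := 2 / 5 * (k₁ ^ 5 - k₂ ^ 5)) hq.iteratedDeriv_three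
      (((tendsto_expSol3_two k₁).sub (tendsto_expSol3_two k₂)).congr' (by
        filter_upwards with r; ring) |>.trans (by rw [mul_sub]))
    simp only [bvec, OfNat.ofNat_ne_one, if_false] at e1 e2
    simp only [OfNat.ofNat_ne_one, if_false]
    rw [← e1, ← e2]
    exact hb

/-- The operation `D_l` maps exponentials to exponential solutions. -/
lemma besselOp_exp_sub {l : ℕ} (hl : l = 1 ∨ l = 2) (k₁ k₂ : ℂ) :
    EqOn (besselOp l fun r => Complex.exp (k₁ * r) - Complex.exp (k₂ * r))
      (fun r => expSol l k₁ r - expSol l k₂ r) (Ioi 0) := by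
  have hinv := fun (n : ℕ) {r : ℝ} (hr : 0 < r) => hasDerivAt_const_div_pow 1 n hr
  have hD1 : ∀ k : ℂ, ∀ r : ℝ, 0 < r → HasDerivAt (fun r : ℝ => Complex.exp (k * r) / r)
      (Complex.exp (k * r) * (k / r - 1 / (r : ℂ) ^ 2)) r := by
    intro k r hr
    have hr' : (r : ℂ) ≠ 0 := by exact_mod_cast hr.ne'
    refine (((hasDerivAt_exp_mul k r).mul (hinv 1 hr)).congr_of_eventuallyEq
      (Eventually.of_forall fun x => ?_)).congr_deriv ?_
    · simp [div_eq_mul_inv]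
    · simp; field_simp; ring
  have h1 : EqOn (fun s : ℝ => deriv (fun s : ℝ =>
      (Complex.exp (k₁ * s) - Complex.exp (k₂ * s)) / (s : ℂ)) s / (s : ℂ))
      (fun r => Complex.exp (k₁ * r) * (k₁ / (r : ℂ) ^ 2 - 1 / (r : ℂ) ^ 3) -
        Complex.exp (k₂ * r) * (k₂ / (r : ℂ) ^ 2 - 1 / (r : ℂ) ^ 3)) (Ioi 0) := by
    intro r (hr : 0 < r)
    have hr' : (r : ℂ) ≠ 0 := by exact_mod_cast hr.ne'
    have := ((hD1 k₁ r hr).fun_sub (hD1 k₂ r hr)).deriv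
    simp only [sub_div]
    rw [this]
    field_simp
  rcases hl with rfl | rfl
  · intro r hr
    have hr' : (r : ℂ) ≠ 0 := by exact_mod_cast (ne_of_gt hr)
    have := h1 hr
    simp only at this
    simp only [besselOp, Function.iterate_one, this, expSol, if_true]
    field_simp
  · intro r hr
    have hr' : (r : ℂ) ≠ 0 := by exact_mod_cast (ne_of_gt hr)
    have hD2 : ∀ k : ℂ, HasDerivAt
        (fun r : ℝ => Complex.exp (k * r) * (k / (r : ℂ) ^ 2 - 1 / (r : ℂ) ^ 3))
        (Complex.exp (k * r) * (k ^ 2 / (r : ℂ) ^ 2 - 3 * k / (r : ℂ) ^ 3 + 3 / (r : ℂ) ^ 4)) r := by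
      intro k
      refine ((hasDerivAt_exp_mul k r).mul ((hasDerivAt_const_div_pow k 2 hr).sub
        (hinv 3 hr))).congr_deriv ?_
      simp only [Pi.sub_apply]
      push_cast; field_simp; ring
    have h2 := eqOn_deriv h1 hr
    rw [((hD2 k₁).fun_sub (hD2 k₂)).deriv] at h2
    change (r : ℂ) ^ (2 + 1) * (deriv (fun s : ℝ => deriv (fun s : ℝ =>
      (Complex.exp (k₁ * s) - Complex.exp (k₂ * s)) / (s : ℂ)) s / (s : ℂ)) r / (r : ℂ)) = _
    rw [h2]
    simp only [expSol, OfNat.ofNat_ne_one, if_false]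
    field_simp

/-! ### The deficiency elements -/

lemma toH_ae {u : ℝ → ℂ} (hu : MemLp u 2 μ₀) : toH u =ᵐ[μ₀] u := by
  rw [toH, dif_pos hu]
  exact hu.coeFn_toLp

lemma toH_eq {u : ℝ → ℂ} {x : HSpace} (h : x =ᵐ[μ₀] u) : toH u = x :=
  Lp.ext ((toH_ae ((memLp_congr_ae h).1 (Lp.memLp x))).trans h.symm)

lemma IsQuasi.congr_left {l : ℕ} {u v u1 p p1 f : ℝ → ℂ} (h : IsQuasi l u u1 p p1 f)
    (e : EqOn v u (Ioi 0)) : IsQuasi l v u1 p p1 f where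
  d0 r hr := (h.d0 r hr).congr_of_eventuallyEq (e.eventuallyEq_of_mem (isOpen_Ioi.mem_nhds hr))
  d1 r hr := by rw [e hr]; exact h.d1 r hr
  d2 := h.d2
  ac := h.ac
  d3 := h.d3

/-- The primitive 16th root of unity `e^(iπ/8)`. -/
noncomputable def zeta : ℂ := Complex.exp (((Real.pi / 8 : ℝ) : ℂ) * Complex.I)

lemma exp_eq_zeta_pow (n : ℕ) :
    Complex.exp (((n * Real.pi / 8 : ℝ) : ℂ) * Complex.I) = zeta ^ n := by
  rw [zeta, ← Complex.exp_nat_mul]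
  congr 1
  push_cast
  ring

lemma zeta_pow_eight : zeta ^ 8 = -1 := by
  rw [← exp_eq_zeta_pow, ← Complex.exp_pi_mul_I]
  congr 2
  push_cast
  ring

lemma zeta_pow_four : zeta ^ 4 = Complex.I := by
  rw [← exp_eq_zeta_pow, show ((4 : ℕ) : ℝ) * Real.pi / 8 = Real.pi / 2 by push_cast; ring]
  push_cast
  exact Complex.exp_pi_div_two_mul_I

lemma zeta_ne_zero : zeta ≠ 0 := Complex.exp_ne_zero _

lemma zeta_pow_re (n : ℕ) : (zeta ^ n).re = Real.cos (n * Real.pi / 8) := by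
  rw [← exp_eq_zeta_pow, Complex.exp_ofReal_mul_I_re]

lemma zeta_pow_mul_re_neg {ρ : ℝ} (hρ : 0 < ρ) {n : ℕ} (h1 : 5 ≤ n) (h2 : n ≤ 11) :
    (zeta ^ n * ρ).re < 0 := by
  rw [Complex.re_mul_ofReal, zeta_pow_re]
  refine mul_neg_of_neg_of_pos (Real.cos_neg_of_pi_div_two_lt_of_lt ?_ ?_) hρ
  · have : (5 : ℝ) ≤ n := by exact_mod_cast h1
    nlinarith [Real.pi_pos]
  · have : (n : ℝ) ≤ 11 := by exact_mod_cast h2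
    nlinarith [Real.pi_pos]

/-- The boundary values `(β, α)`, in the sense of `bvec`, of `g_{l+}`. -/
noncomputable def gPlusBoundary (l : ℕ) (ρ : ℝ) : ℂ × ℂ :=
  if l = 1 then (-ρ ^ 2 * zeta ^ 2, 2 / 3 * ρ ^ 3 * (zeta ^ 3 - zeta ^ 7))
  else (ρ ^ 2 * zeta ^ 2, 2 / 5 * ρ ^ 5 * (zeta ^ 5 - zeta))

/-- The boundary values `(β, α)`, in the sense of `bvec`, of `g_{l-}`. -/
noncomputable def gMinusBoundary (l : ℕ) (ρ : ℝ) : ℂ × ℂ :=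
  if l = 1 then (-ρ ^ 2 * zeta ^ 6, 2 / 3 * ρ ^ 3 * (zeta ^ 5 - zeta))
  else (ρ ^ 2 * zeta ^ 6, 2 / 5 * ρ ^ 5 * (zeta ^ 3 - zeta ^ 7))

section

variable {l : ℕ} (hl : l = 1 ∨ l = 2) {ρ : ℝ} (hρ : 0 < ρ)

/-- Functions equal on `(0, ∞)` to the difference of two decaying exponential solutions with
`k₁⁴ = k₂⁴ = c` are eigenfunctions of the maximal operator. -/
lemma represents_of_eqOn_expSol_sub (hl : l = 1 ∨ l = 2) {g : ℝ → ℂ} {k₁ k₂ c : ℂ}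
    (hg : EqOn g (fun r => expSol l k₁ r - expSol l k₂ r) (Ioi 0)) (h₁ : k₁ ^ 4 = c)
    (h₂ : k₂ ^ 4 = c) (h₁' : k₁.re < 0) (h₂' : k₂.re < 0) :
    Represents l g (toH g) (c • toH g) ∧
      HasBoundaryValues g (if l = 1 then bvec 1 ((k₁ ^ 2 - k₂ ^ 2) / 2)
        (2 / 3 * (k₁ ^ 3 - k₂ ^ 3)) else bvec 2 (-(k₁ ^ 2 - k₂ ^ 2) / 2)
          (2 / 5 * (k₁ ^ 5 - k₂ ^ 5))) := by
  have hm : MemLp g 2 μ₀ := (memLp_congr_ae (ae_of_eqOn hg)).2 (memLp_expSol_sub hl h₁' h₂')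
  have hq : IsQuasi l g _ _ _ (fun r => c * g r) :=
    ((isQuasi_expSol_sub hl h₁ h₂).congr_left hg).congr_rhs (by
      filter_upwards [ae_of_eqOn hg] with r hr
      rw [hr])
  refine ⟨⟨hq.finiteGraphNorm hm (hm.const_mul c), toH_ae hm, ?_⟩,
    (hasBoundaryValues_expSol_sub hl h₁ h₂ h₁' h₂').congr hg.symm⟩
  exact ((Lp.coeFn_smul _ _).trans ((toH_ae hm).const_smul c)).trans hq.radialOp_sq.symm

include hl hρ

lemma represents_gPlus : Represents l (gPlus l ρ) (toH (gPlus l ρ))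
      ((Complex.I * (ρ : ℂ) ^ 4) • toH (gPlus l ρ)) ∧
    HasBoundaryValues (gPlus l ρ) (bvec l (gPlusBoundary l ρ).1 (gPlusBoundary l ρ).2) := by
  have hg : EqOn (gPlus l ρ)
      (fun r => expSol l (zeta ^ 5 * ρ) r - expSol l (zeta ^ 9 * ρ) r) (Ioi 0) := by
    have h := besselOp_exp_sub hl (zeta ^ 5 * ρ) (zeta ^ 9 * ρ)
    have h5 := exp_eq_zeta_pow 5
    have h9 := exp_eq_zeta_pow 9
    rw [← h5, ← h9] at h ⊢
    exact h
  have h8 := zeta_pow_eight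
  obtain ⟨h1, h2⟩ := represents_of_eqOn_expSol_sub hl hg (c := Complex.I * (ρ : ℂ) ^ 4)
    (by rw [← zeta_pow_four]; linear_combination ρ ^ 4 * (zeta ^ 12 - zeta ^ 4) * h8)
    (by rw [← zeta_pow_four]; linear_combination
          ρ ^ 4 * (zeta ^ 28 - zeta ^ 20 + zeta ^ 12 - zeta ^ 4) * h8)
    (zeta_pow_mul_re_neg hρ le_rfl (by norm_num)) (zeta_pow_mul_re_neg hρ (by norm_num)
      (by norm_num))
  refine ⟨h1, ?_⟩
  convert h2 using 1
  have w2 : zeta ^ 10 - zeta ^ 18 = -2 * zeta ^ 2 := by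
    linear_combination (-zeta ^ 10 + 2 * zeta ^ 2) * h8
  have w3 : zeta ^ 15 - zeta ^ 27 = zeta ^ 3 - zeta ^ 7 := by
    linear_combination (-zeta ^ 19 + zeta ^ 11 + zeta ^ 7 - zeta ^ 3) * h8
  have w5 : zeta ^ 25 - zeta ^ 45 = zeta ^ 5 - zeta := by
    linear_combination (-zeta ^ 37 + zeta ^ 29 - zeta ^ 21 + zeta ^ 17 + zeta ^ 13 - zeta ^ 9 -
      zeta ^ 5 + zeta) * h8
  rcases hl with rfl | rfl
  · simp only [gPlusBoundary, if_true]
    congr 1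
    · linear_combination -ρ ^ 2 / 2 * w2
    · linear_combination -(2 / 3) * ρ ^ 3 * w3
  · simp only [gPlusBoundary, OfNat.ofNat_ne_one, if_false]
    congr 1
    · linear_combination ρ ^ 2 / 2 * w2
    · linear_combination -(2 / 5) * ρ ^ 5 * w5

lemma represents_gMinus : Represents l (gMinus l ρ) (toH (gMinus l ρ))
      ((-(Complex.I * (ρ : ℂ) ^ 4)) • toH (gMinus l ρ)) ∧
    HasBoundaryValues (gMinus l ρ) (bvec l (gMinusBoundary l ρ).1 (gMinusBoundary l ρ).2) := by
  have hg : EqOn (gMinus l ρ)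
      (fun r => expSol l (zeta ^ 7 * ρ) r - expSol l (zeta ^ 11 * ρ) r) (Ioi 0) := by
    have h := besselOp_exp_sub hl (zeta ^ 7 * ρ) (zeta ^ 11 * ρ)
    have h7 := exp_eq_zeta_pow 7
    have h11 := exp_eq_zeta_pow 11
    rw [← h7, ← h11] at h ⊢
    exact h
  have h8 := zeta_pow_eight
  obtain ⟨h1, h2⟩ := represents_of_eqOn_expSol_sub hl hg (c := -(Complex.I * (ρ : ℂ) ^ 4))
    (by rw [← zeta_pow_four]
        linear_combination ρ ^ 4 * (zeta ^ 20 - zeta ^ 12 + zeta ^ 4) * h8)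
    (by rw [← zeta_pow_four]
        linear_combination
          ρ ^ 4 * (zeta ^ 36 - zeta ^ 28 + zeta ^ 20 - zeta ^ 12 + zeta ^ 4) * h8)
    (zeta_pow_mul_re_neg hρ (by norm_num) (by norm_num)) (zeta_pow_mul_re_neg hρ (by norm_num)
      le_rfl)
  refine ⟨h1, ?_⟩
  convert h2 using 1
  have w2 : zeta ^ 14 - zeta ^ 22 = -2 * zeta ^ 6 := by
    linear_combination (-zeta ^ 14 + 2 * zeta ^ 6) * h8
  have w3 : zeta ^ 21 - zeta ^ 33 = zeta ^ 5 - zeta := by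
    linear_combination (-zeta ^ 25 + zeta ^ 17 + zeta ^ 13 - zeta ^ 9 - zeta ^ 5 + zeta) * h8
  have w5 : zeta ^ 35 - zeta ^ 55 = zeta ^ 3 - zeta ^ 7 := by
    linear_combination (-zeta ^ 47 + zeta ^ 39 - zeta ^ 31 + zeta ^ 27 + zeta ^ 23 - zeta ^ 19 -
      zeta ^ 15 + zeta ^ 11 + zeta ^ 7 - zeta ^ 3) * h8
  rcases hl with rfl | rfl
  · simp only [gMinusBoundary, if_true]
    congr 1
    · linear_combination -ρ ^ 2 / 2 * w2
    · linear_combination -(2 / 3) * ρ ^ 3 * w3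
  · simp only [gMinusBoundary, OfNat.ofNat_ne_one, if_false]
    congr 1
    · linear_combination ρ ^ 2 / 2 * w2
    · linear_combination -(2 / 5) * ρ ^ 5 * w5

omit hl in
lemma gPlusBoundary_fst_ne_zero : (gPlusBoundary l ρ).1 ≠ 0 := by
  have h : (ρ : ℂ) ≠ 0 := by exact_mod_cast hρ.ne'
  have hz := zeta_ne_zero
  unfold gPlusBoundary
  split_ifs <;> simp [h, hz]

omit hl in
lemma gMinusBoundary_fst_ne_zero : (gMinusBoundary l ρ).1 ≠ 0 := by
  have h : (ρ : ℂ) ≠ 0 := by exact_mod_cast hρ.ne'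
  have hz := zeta_ne_zero
  unfold gMinusBoundary
  split_ifs <;> simp [h, hz]

omit hl hρ in
lemma ne_zero_of_boundary {u : ℝ → ℂ} {x y : HSpace} {β α : ℂ} (hu : Represents l u x y)
    (hb : HasBoundaryValues u (bvec l β α)) (hβ : β ≠ 0) : x ≠ 0 := by
  rintro rfl
  have e : EqOn u (fun _ => 0) (Ioi 0) :=
    Measure.eqOn_open_of_ae_eq (hu.fst.symm.trans (Lp.coeFn_zero _ _ _)) isOpen_Ioi
      hu.finite.isQuasi.continuousOn_u continuousOn_const
  have h0 : HasBoundaryValues (fun _ : ℝ => (0 : ℂ)) (bvec l 0 0) := by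
    rw [bvec_zero]
    intro k
    refine tendsto_const_nhds.congr fun r => ?_
    simp
  exact hβ (bvec_injective l ((hb.congr e).unique h0)).1

lemma toH_gPlus_ne_zero : toH (gPlus l ρ) ≠ 0 :=
  ne_zero_of_boundary (represents_gPlus hl hρ).1 (represents_gPlus hl hρ).2
    (gPlusBoundary_fst_ne_zero hρ)

lemma toH_gMinus_ne_zero : toH (gMinus l ρ) ≠ 0 :=
  ne_zero_of_boundary (represents_gMinus hl hρ).1 (represents_gMinus hl hρ).2
    (gMinusBoundary_fst_ne_zero hρ)

end

/-! ### The elements `h_l^a` and their boundary values -/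

/-- The functions of finite graph norm in the domain of the extension with parameter `a` satisfy
`condS a * α = condT l ρ a * β` for their boundary values `(β, α)`; this is the first
coefficient. -/
noncomputable def condS (a : ℝ) : ℝ := Real.sin (a - Real.pi / 4)

/-- The second coefficient of the boundary condition with parameter `a`. -/
noncomputable def condT (l : ℕ) (ρ a : ℝ) : ℝ :=
  if l = 1 then 2 * √2 / 3 * ρ * Real.cos (a + Real.pi / 8)
  else 2 * √2 / 5 * ρ ^ 3 * Real.cos (a - Real.pi / 8)

lemma inv_zeta : zeta⁻¹ = -zeta ^ 7 :=
  inv_eq_of_mul_eq_one_right (by linear_combination -zeta_pow_eight)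

lemma cos_add_eq (a : ℝ) (n : ℕ) : ((Real.cos (a + n * Real.pi / 8) : ℝ) : ℂ) =
    (Complex.exp (a * Complex.I) * zeta ^ n +
      Complex.exp (-(a * Complex.I)) * (-zeta ^ 7) ^ n) / 2 := by
  rw [← inv_zeta, inv_pow, ← exp_eq_zeta_pow, ← Complex.exp_neg, ← Complex.exp_add,
    ← Complex.exp_add, Complex.ofReal_cos, Complex.cos]
  congr 3
  · push_cast; ring
  · push_cast; ring

lemma sqrt_two_eq : ((√2 : ℝ) : ℂ) = zeta ^ 2 - zeta ^ 6 := by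
  have h := cos_add_eq 0 2
  rw [show (0 : ℝ) + (2 : ℕ) * Real.pi / 8 = Real.pi / 4 by push_cast; ring,
    Real.cos_pi_div_four] at h
  simp only [Complex.ofReal_zero, zero_mul, neg_zero, Complex.exp_zero] at h
  push_cast at h
  linear_combination 2 * h + zeta ^ 6 * zeta_pow_eight

lemma condS_eq (a : ℝ) : (condS a : ℂ) =
    -(Complex.exp (a * Complex.I) * zeta ^ 2 - Complex.exp (-(a * Complex.I)) * zeta ^ 6) / 2 := by
  have h := cos_add_eq a 2
  have e : condS a = -Real.cos (a + (2 : ℕ) * Real.pi / 8) := by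
    have := Real.cos_add_pi_div_two (a - Real.pi / 4)
    rw [condS, ← neg_eq_iff_eq_neg, ← this]
    congr 1
    push_cast
    ring
  rw [e, Complex.ofReal_neg, h]
  linear_combination -Complex.exp (-(a * Complex.I)) / 2 * zeta ^ 6 * zeta_pow_eight

lemma condT_one_eq (ρ a : ℝ) : (condT 1 ρ a : ℂ) = 2 / 3 * (zeta ^ 2 - zeta ^ 6) * ρ *
    ((Complex.exp (a * Complex.I) * zeta - Complex.exp (-(a * Complex.I)) * zeta ^ 7) / 2) := by
  have h := cos_add_eq a 1
  simp only [condT, if_true]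
  rw [show a + Real.pi / 8 = a + (1 : ℕ) * Real.pi / 8 by push_cast; ring]
  rw [Complex.ofReal_mul, h]
  push_cast
  rw [sqrt_two_eq]
  ring

lemma condT_two_eq (ρ a : ℝ) : (condT 2 ρ a : ℂ) = 2 / 5 * (zeta ^ 2 - zeta ^ 6) * ρ ^ 3 *
    ((-Complex.exp (a * Complex.I) * zeta ^ 7 + Complex.exp (-(a * Complex.I)) * zeta) / 2) := by
  have h := cos_add_eq a 7
  have e : Real.cos (a - Real.pi / 8) = -Real.cos (a + (7 : ℕ) * Real.pi / 8) := by
    rw [← Real.cos_sub_pi]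
    congr 1
    push_cast
    ring
  simp only [condT, OfNat.ofNat_ne_one, if_false]
  rw [e, Complex.ofReal_mul, Complex.ofReal_neg, h]
  push_cast
  rw [sqrt_two_eq]
  linear_combination (zeta ^ 2 - zeta ^ 6) / 5 * ρ ^ 3 * Complex.exp (-(a * Complex.I)) *
    (zeta ^ 41 - zeta ^ 33 + zeta ^ 25 - zeta ^ 17 + zeta ^ 9 - zeta) * zeta_pow_eight

/-- The factor between the boundary values of `h_l^a` and the real vector
`(condS a, condT l ρ a)`. -/
noncomputable def hFactor (l : ℕ) (ρ : ℝ) : ℂ :=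
  if l = 1 then -Complex.I / (ρ : ℂ) ^ 2 else Complex.I / (ρ : ℂ) ^ 2

section

variable {l : ℕ} (hl : l = 1 ∨ l = 2) {ρ : ℝ} (hρ : 0 < ρ)

include hρ in
lemma hFactor_ne_zero : hFactor l ρ ≠ 0 := by
  have h : (ρ : ℂ) ≠ 0 := by exact_mod_cast hρ.ne'
  unfold hFactor
  split_ifs <;> simp [h]

include hl hρ in
lemma represents_hElem (a : ℝ) : Represents l (hElem l ρ a) (toH (hElem l ρ a))
      ((1 / 2 : ℂ) • (Complex.exp (a * Complex.I) • toH (gPlus l ρ) +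
        Complex.exp (-(a * Complex.I)) • toH (gMinus l ρ))) ∧
    HasBoundaryValues (hElem l ρ a)
      (bvec l (hFactor l ρ * condS a) (hFactor l ρ * condT l ρ a)) ∧
    toH (hElem l ρ a) = (Complex.exp (a * Complex.I) / (2 * Complex.I * (ρ : ℂ) ^ 4)) •
      toH (gPlus l ρ) - (Complex.exp (-(a * Complex.I)) / (2 * Complex.I * (ρ : ℂ) ^ 4)) •
        toH (gMinus l ρ) := by
  have hρ' : (ρ : ℂ) ≠ 0 := by exact_mod_cast hρ.ne'
  obtain ⟨h1, b1⟩ := represents_gPlus hl hρ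
  obtain ⟨h2, b2⟩ := represents_gMinus hl hρ
  set E := Complex.exp (a * Complex.I) with hE
  set E' := Complex.exp (-(a * Complex.I)) with hE'
  set c₁ := E / (2 * Complex.I * (ρ : ℂ) ^ 4) with hc₁
  set c₂ := E' / (2 * Complex.I * (ρ : ℂ) ^ 4) with hc₂
  have hh : hElem l ρ a = c₁ • gPlus l ρ + (-c₂) • gMinus l ρ := by
    funext r
    simp only [hElem, Pi.add_apply, Pi.smul_apply, smul_eq_mul, neg_mul, hc₁, hc₂, hE, hE',
      sub_eq_add_neg]
  have hr := (h1.smul c₁).add (h2.smul (-c₂))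
  rw [← hh] at hr
  have hx := toH_eq hr.fst
  refine ⟨?_, ?_, by rw [hx, neg_smul, sub_eq_add_neg]⟩
  · rw [hx]
    convert hr using 1
    have e1 : c₁ * (Complex.I * (ρ : ℂ) ^ 4) = 1 / 2 * E := by
      rw [hc₁]; field_simp
    have e2 : -c₂ * -(Complex.I * (ρ : ℂ) ^ 4) = 1 / 2 * E' := by
      rw [hc₂]; field_simp
    rw [smul_smul, smul_smul, e1, e2, smul_add, smul_smul, smul_smul]
  · have hb := (h1.smul c₁).finite.hasBoundaryValues_add (h2.smul (-c₂)).finite (b1.smul c₁)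
      (b2.smul (-c₂))
    rw [← hh, smul_bvec, smul_bvec, bvec_add] at hb
    have h8 := zeta_pow_eight
    have hI : Complex.I ≠ 0 := Complex.I_ne_zero
    convert hb using 1
    rw [condS_eq, ← hE, ← hE']
    rcases hl with rfl | rfl
    · rw [condT_one_eq, ← hE, ← hE']
      simp only [hFactor, gPlusBoundary, gMinusBoundary, if_true, hc₁, hc₂]
      congr 1
      · field_simp
        simp only [Complex.I_sq]
        ring
      · field_simp
        simp only [Complex.I_sq]
        linear_combination -zeta * (1 - zeta ^ 4) * E' * h8
    · rw [condT_two_eq, ← hE, ← hE']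
      simp only [hFactor, gPlusBoundary, gMinusBoundary, OfNat.ofNat_ne_one, if_false, hc₁, hc₂]
      congr 1
      · field_simp
        simp only [Complex.I_sq]
        ring
      · field_simp
        simp only [Complex.I_sq]
        linear_combination zeta * (1 - zeta ^ 4) * E * h8

end

/-! ### The circle of boundary conditions and the parameter `κ` -/

/-- The phase by which `condT` is shifted against `condS`. -/
noncomputable def phase (l : ℕ) : ℝ := if l = 1 then 3 * Real.pi / 8 else Real.pi / 8

/-- The amplitude of `condT`. -/
noncomputable def amplitude (l : ℕ) (ρ : ℝ) : ℝ :=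
  if l = 1 then 2 * √2 / 3 * ρ else 2 * √2 / 5 * ρ ^ 3

lemma condT_eq (l : ℕ) (ρ a : ℝ) :
    condT l ρ a = amplitude l ρ * Real.cos (a - Real.pi / 4 + phase l) := by
  unfold condT amplitude phase
  split_ifs
  · congr 2; ring
  · congr 2; ring

lemma cos_phase_pos (l : ℕ) : 0 < Real.cos (phase l) := by
  have := Real.pi_pos
  refine Real.cos_pos_of_mem_Ioo ?_
  unfold phase
  split_ifs <;> constructor <;> linarith

lemma amplitude_pos (l : ℕ) {ρ : ℝ} (hρ : 0 < ρ) : 0 < amplitude l ρ := by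
  unfold amplitude
  split_ifs <;> positivity

lemma condS_mul_condT_sub (l : ℕ) (ρ a b : ℝ) : condS b * condT l ρ a - condT l ρ b * condS a =
    amplitude l ρ * Real.cos (phase l) * Real.sin (b - a) := by
  have h := Real.sin_sub (b - Real.pi / 4) (a - Real.pi / 4)
  rw [sub_sub_sub_cancel_right] at h
  rw [condT_eq, condT_eq, condS, condS, Real.cos_add, Real.cos_add, h]
  ring

lemma condS_ne_zero_or (l : ℕ) {ρ : ℝ} (hρ : 0 < ρ) (a : ℝ) : condS a ≠ 0 ∨ condT l ρ a ≠ 0 := by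
  by_contra! h
  have h1 := condS_mul_condT_sub l ρ a (a + Real.pi / 2)
  rw [h.1, h.2, mul_zero, mul_zero, sub_zero, add_sub_cancel_left, Real.sin_pi_div_two,
    mul_one] at h1
  exact (mul_pos (amplitude_pos l hρ) (cos_phase_pos l)).ne h1

lemma condS_eq_zero_iff {a : ℝ} (ha : a ∈ Ico 0 Real.pi) : condS a = 0 ↔ a = Real.pi / 4 := by
  have := Real.pi_pos
  constructor
  · intro h
    have := (Real.sin_eq_zero_iff_of_lt_of_lt (by linarith [ha.1]) (by linarith [ha.2])).1 h
    linarith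
  · rintro rfl
    simp [condS]

lemma eq_of_condS_mul_condT {l : ℕ} {ρ : ℝ} (hρ : 0 < ρ) {a b : ℝ} (ha : a ∈ Ico 0 Real.pi)
    (hb : b ∈ Ico 0 Real.pi) (h : condS b * condT l ρ a = condT l ρ b * condS a) : a = b := by
  have h1 := condS_mul_condT_sub l ρ a b
  rw [h, sub_self] at h1
  have h2 := (mul_eq_zero.1 h1.symm).resolve_left
    (mul_pos (amplitude_pos l hρ) (cos_phase_pos l)).ne'
  have := (Real.sin_eq_zero_iff_of_lt_of_lt (by linarith [ha.2, hb.1])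
    (by linarith [ha.1, hb.2])).1 h2
  linarith

/-- Every real boundary condition is proportional to the one with some parameter `a ∈ [0, π)`. -/
lemma exists_condS_mul_eq (l : ℕ) (ρ s t : ℝ) :
    ∃ a ∈ Ico 0 Real.pi, condS a * t = condT l ρ a * s := by
  have hpi := Real.pi_pos
  -- the condition is `sin θ * X = cos θ * Y` for `θ = a - π/4`
  set X := t + amplitude l ρ * Real.sin (phase l) * s with hX
  set Y := amplitude l ρ * Real.cos (phase l) * s with hY
  have key : ∀ θ : ℝ, Real.sin θ * X = Real.cos θ * Y →
      condS (θ + Real.pi / 4) * t = condT l ρ (θ + Real.pi / 4) * s := by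
    intro θ h
    rw [condT_eq, condS, add_sub_cancel_right, Real.cos_add]
    rw [hX, hY] at h
    linear_combination h
  set θ := Complex.arg (X + Y * Complex.I) with hθ
  obtain ⟨N, hre, him⟩ : ∃ N : ℝ, N * Real.cos θ = X ∧ N * Real.sin θ = Y := by
    refine ⟨‖(X + Y * Complex.I : ℂ)‖, ?_, ?_⟩
    · rw [hθ, Complex.norm_mul_cos_arg]; simp
    · rw [hθ, Complex.norm_mul_sin_arg]; simp
  have h0 : Real.sin θ * X = Real.cos θ * Y := by
    linear_combination Real.cos θ * him - Real.sin θ * hre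
  have hθ1 := Complex.neg_pi_lt_arg (X + Y * Complex.I)
  have hθ2 := Complex.arg_le_pi (X + Y * Complex.I)
  rw [← hθ] at hθ1 hθ2
  rcases lt_or_ge (θ + Real.pi / 4) 0 with h1 | h1
  · exact ⟨θ + Real.pi + Real.pi / 4, ⟨by linarith, by linarith⟩, key _ (by
      rw [Real.sin_add_pi, Real.cos_add_pi]; linarith)⟩
  · rcases lt_or_ge (θ + Real.pi / 4) Real.pi with h2 | h2
    · exact ⟨_, ⟨h1, h2⟩, key _ h0⟩
    · exact ⟨θ - Real.pi + Real.pi / 4, ⟨by linarith, by linarith⟩, key _ (by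
        rw [Real.sin_sub_pi, Real.cos_sub_pi]; linarith)⟩

lemma cubeRoot_pow (x : ℝ) : cubeRoot x ^ 3 = x := by
  have h : (|x| ^ (1 / 3 : ℝ)) ^ 3 = |x| := by
    rw [← Real.rpow_natCast, ← Real.rpow_mul (abs_nonneg x)]
    norm_num
  rw [cubeRoot, mul_pow, h]
  rcases lt_trichotomy x 0 with hx | rfl | hx
  · rw [Real.sign_of_neg hx, abs_of_neg hx]; ring
  · simp
  · rw [Real.sign_of_pos hx, abs_of_pos hx]; ring

/-- The power of `κ` that enters the boundary condition. -/
noncomputable def kappaPow (l : ℕ) (κ : ℝ) : ℝ :=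
  if l = 1 then 2 * √2 / 3 * κ else 2 * √2 / 5 * κ ^ 3

lemma kappaPow_injective (l : ℕ) : Function.Injective (kappaPow l) := by
  have h2 : 0 < √2 := by positivity
  intro x y h
  unfold kappaPow at h
  split_ifs at h
  · exact mul_left_cancel₀ (by positivity) h
  · exact (Odd.strictMono_pow (by decide : Odd 3)).injective (mul_left_cancel₀ (by positivity) h)

/-- The parameter `κ` determines the slope of the boundary condition. -/
lemma condT_eq_kappaPow (l : ℕ) (ρ : ℝ) {a : ℝ} (h : condS a ≠ 0) :
    condT l ρ a = -kappaPow l (kappa l ρ a) * condS a := by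
  unfold condT kappaPow kappa
  split_ifs
  · unfold condS at h ⊢
    generalize Real.sin (a - Real.pi / 4) = x at *
    field_simp
  · rw [cubeRoot_pow]
    unfold condS at h ⊢
    generalize Real.sin (a - Real.pi / 4) = x at *
    field_simp

lemma bijOn_kappa (l : ℕ) {ρ : ℝ} (hρ : 0 < ρ) :
    BijOn (kappa l ρ) (Ico 0 Real.pi \ {Real.pi / 4}) univ := by
  have hS : ∀ a ∈ Ico 0 Real.pi \ {Real.pi / 4}, condS a ≠ 0 := fun a ha h0 =>
    ha.2 ((condS_eq_zero_iff ha.1).1 h0)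
  refine ⟨fun _ _ => trivial, fun a ha b hb h => ?_, fun κ _ => ?_⟩
  · refine eq_of_condS_mul_condT (l := l) hρ ha.1 hb.1 ?_
    rw [condT_eq_kappaPow l ρ (hS a ha), condT_eq_kappaPow l ρ (hS b hb), h]
    ring
  · obtain ⟨a, ha, h⟩ := exists_condS_mul_eq l ρ 1 (-kappaPow l κ)
    rw [mul_one] at h
    have hs : condS a ≠ 0 := by
      intro h0
      rw [h0, zero_mul] at h
      exact (condS_ne_zero_or l hρ a).elim (fun k => k h0) fun k => k h.symm
    refine ⟨a, ⟨ha, fun h0 => hs ((condS_eq_zero_iff ha).2 h0)⟩, kappaPow_injective l ?_⟩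
    rw [condT_eq_kappaPow l ρ hs, mul_comm] at h
    have := mul_right_cancel₀ hs h
    linarith

/-! ### Boundary conditions in terms of boundary values -/

lemma boundaryCond_iff {l : ℕ} (hl : l = 1 ∨ l = 2) {κ : ℝ} {u : ℝ → ℂ} {β α : ℂ}
    (hb : HasBoundaryValues u (bvec l β α)) :
    BoundaryCond l κ u ↔ α = -(kappaPow l κ : ℂ) * β := by
  have h : BoundaryCond l κ u ↔ ((l = 1 ∧ bvec l β α 0 = 0 ∧ bvec l β α 3 = 0 ∧
      bvec l β α 2 = -((2 * √2 / 3 * κ : ℝ) : ℂ) * bvec l β α 1) ∨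
      (l = 2 ∧ bvec l β α 1 = 0 ∧ bvec l β α 2 = 0 ∧
      bvec l β α 3 = -((2 * √2 / 5 * κ ^ 3 : ℝ) : ℂ) * bvec l β α 0)) := by
    constructor
    · rintro ⟨b, h1, h2⟩
      rwa [h1.unique hb] at h2
    · exact fun h => ⟨_, hb, h⟩
  rw [h]
  rcases hl with rfl | rfl <;> simp [bvec, kappaPow]

lemma boundaryCondInfty_iff {l : ℕ} (hl : l = 1 ∨ l = 2) {u : ℝ → ℂ} {β α : ℂ}
    (hb : HasBoundaryValues u (bvec l β α)) : BoundaryCondInfty l u ↔ β = 0 := by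
  have h : BoundaryCondInfty l u ↔ ((l = 1 ∧ bvec l β α 0 = 0 ∧ bvec l β α 3 = 0 ∧
      bvec l β α 1 = 0) ∨ (l = 2 ∧ bvec l β α 1 = 0 ∧ bvec l β α 2 = 0 ∧
      bvec l β α 0 = 0)) := by
    constructor
    · rintro ⟨b, h1, h2⟩
      rwa [h1.unique hb] at h2
    · exact fun h => ⟨_, hb, h⟩
  rw [h]
  rcases hl with rfl | rfl <;> simp [bvec]

/-! ### The self-adjoint extensions -/

section

variable {l : ℕ} (hl : l = 1 ∨ l = 2) {ρ : ℝ} (hρ : 0 < ρ)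

include hl hρ in
/-- The element `h_l^a` in the domain of the adjoint. -/
lemma exists_hElem (a : ℝ) : ∃ h : (minOp l).adjoint.domain,
    (h : HSpace) = toH (hElem l ρ a) ∧
    (minOp l).adjoint h = (1 / 2 : ℂ) • (Complex.exp (a * Complex.I) • toH (gPlus l ρ) +
        Complex.exp (-(a * Complex.I)) • toH (gMinus l ρ)) ∧
    boundaryMap hl h = (hFactor l ρ * condS a, hFactor l ρ * condT l ρ a) := by
  obtain ⟨h1, h2, -⟩ := represents_hElem hl hρ a
  obtain ⟨h, e1, e2⟩ := exists_adjoint_domain hl h1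
  rw [← e1] at h1
  exact ⟨h, e1, e2, boundaryMap_eq hl h1 h2⟩

include hρ in
/-- The boundary values of `h_l^a` for `a = π/4` and `a = 3π/4` already span `ℂ²`. -/
lemma boundaryMap_surjective : Function.Surjective (boundaryMap hl) := by
  have hF : hFactor l ρ ≠ 0 := hFactor_ne_zero hρ
  obtain ⟨x, -, -, hx⟩ := exists_hElem hl hρ (Real.pi / 4)
  obtain ⟨y, -, -, hy⟩ := exists_hElem hl hρ (3 * Real.pi / 4)
  have h1 : condS (Real.pi / 4) = 0 := by simp [condS]
  have h2 : condS (3 * Real.pi / 4) = 1 := by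
    rw [condS, show 3 * Real.pi / 4 - Real.pi / 4 = Real.pi / 2 by ring, Real.sin_pi_div_two]
  have h3 : ((condT l ρ (Real.pi / 4) : ℝ) : ℂ) ≠ 0 := by
    exact_mod_cast (condS_ne_zero_or l hρ (Real.pi / 4)).resolve_left fun h => h h1
  rw [h1] at hx
  rw [h2] at hy
  rintro ⟨p, q⟩
  refine ⟨(p / hFactor l ρ) • y + ((q - p * condT l ρ (3 * Real.pi / 4)) /
    (hFactor l ρ * condT l ρ (Real.pi / 4))) • x, ?_⟩
  rw [map_add, map_smul, map_smul, hx, hy]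
  ext
  · simp; field_simp
  · simp; field_simp; ring

/-- The boundary values of the minimal operator. -/
noncomputable def minBoundary : BoundaryMap (minOp l) where
  dense := dense_domain_minOp l
  le_adjoint := minOp_le_adjoint hl
  b := boundaryMap hl
  k := 2 * l + 1
  k_ne := by exact_mod_cast Nat.succ_ne_zero (2 * l)
  green := boundaryMap_green hl
  surj := boundaryMap_surjective hl one_pos

lemma mem_graph_ext_minBoundary (s t : ℝ) (x y : HSpace) :
    (x, y) ∈ ((minBoundary hl).ext s t).graph ↔ ∃ (u : ℝ → ℂ) (β α : ℂ), Represents l u x y ∧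
      HasBoundaryValues u (bvec l β α) ∧ (s : ℂ) * α = t * β := by
  rw [BoundaryMap.mem_graph_ext_iff]
  constructor
  · rintro ⟨x', rfl, rfl, h⟩
    obtain ⟨u, hu, hb⟩ := boundaryMap_spec hl x'
    exact ⟨u, _, _, hu, hb, h⟩
  · rintro ⟨u, β, α, hu, hb, h⟩
    obtain ⟨x', rfl, rfl⟩ := exists_adjoint_domain hl hu
    refine ⟨x', rfl, rfl, ?_⟩
    have e : (minBoundary hl).b x' = (β, α) := boundaryMap_eq hl hu hb
    rw [e]
    exact h

include hl in
lemma isRealizedOn_closure : IsRealizedOn l (minOp l).closure (fun u => HasBoundaryValues u 0) := by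
  intro x y
  rw [(minBoundary hl).mem_graph_closure_iff]
  constructor
  · rintro ⟨x', rfl, rfl, h⟩
    obtain ⟨u, hu, hb⟩ := boundaryMap_spec hl x'
    have e : boundaryMap hl x' = 0 := h
    rw [e, Prod.fst_zero, Prod.snd_zero, bvec_zero] at hb
    exact ⟨u, hu.finite, hb, hu.fst, hu.snd⟩
  · rintro ⟨u, hu, hb, hx, hy⟩
    have hr : Represents l u x y := ⟨hu, hx, hy⟩
    obtain ⟨x', rfl, rfl⟩ := exists_adjoint_domain hl hr
    exact ⟨x', rfl, rfl, boundaryMap_eq hl hr (q := 0) (by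
      rw [Prod.fst_zero, Prod.snd_zero, bvec_zero]; exact hb)⟩

/-- A realization of an extension by a boundary condition equivalent to `s α = t β`. -/
lemma isRealizedOn_ext {s t : ℝ} {P : (ℝ → ℂ) → Prop}
    (hP : ∀ (u : ℝ → ℂ) (β α : ℂ), HasBoundaryValues u (bvec l β α) →
      (P u ↔ (s : ℂ) * α = t * β)) : IsRealizedOn l ((minBoundary hl).ext s t) P := by
  intro x y
  rw [mem_graph_ext_minBoundary]
  constructor
  · rintro ⟨u, β, α, hu, hb, h⟩
    exact ⟨u, hu.finite, (hP u β α hb).2 h, hu.fst, hu.snd⟩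
  · rintro ⟨u, hu, hPu, hx, hy⟩
    have hr : Represents l u x y := ⟨hu, hx, hy⟩
    obtain ⟨β, α, hb⟩ := hr.exists_boundaryValues hl
    exact ⟨u, β, α, hr, hb, (hP u β α hb).1 hPu⟩

/-- The extension `T_{la}²`. -/
noncomputable def extension (ρ a : ℝ) : HSpace →ₗ.[ℂ] HSpace :=
  (minBoundary hl).ext (condS a) (condT l ρ a)

include hρ

lemma isSelfAdjoint_extension (a : ℝ) : IsSelfAdjoint (extension hl ρ a) :=
  (minBoundary hl).isSelfAdjoint_ext (condS_ne_zero_or l hρ a)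

lemma bijOn_extension :
    BijOn (extension hl ρ) (Ico 0 Real.pi) {B | IsSelfAdjoint B ∧ minOp l ≤ B} := by
  refine ⟨fun a _ => ⟨isSelfAdjoint_extension hl hρ a, (minBoundary hl).le_ext _ _⟩,
    fun a ha b hb h => ?_, fun B hB => ?_⟩
  · exact eq_of_condS_mul_condT hρ ha hb ((minBoundary hl).mul_eq_mul_of_ext_eq h)
  · obtain ⟨s, t, hst, rfl⟩ := (minBoundary hl).exists_eq_ext hB.1 hB.2
    obtain ⟨a, ha, h⟩ := exists_condS_mul_eq l ρ s t
    exact ⟨a, ha, ((minBoundary hl).ext_congr hst (condS_ne_zero_or l hρ a) h).symm⟩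

omit hρ in
lemma isRealizedOn_extension {a : ℝ} (ha : condS a ≠ 0) :
    IsRealizedOn l (extension hl ρ a) (BoundaryCond l (kappa l ρ a)) := by
  refine isRealizedOn_ext hl fun u β α hb => ?_
  rw [boundaryCond_iff hl hb, condT_eq_kappaPow l ρ ha]
  have h : (condS a : ℂ) ≠ 0 := by exact_mod_cast ha
  push_cast
  constructor
  · rintro rfl
    ring
  · intro h1
    refine mul_left_cancel₀ h ?_
    linear_combination h1

lemma isRealizedOn_extension_infty {a : ℝ} (ha : condS a = 0) :
    IsRealizedOn l (extension hl ρ a) (BoundaryCondInfty l) := by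
  refine isRealizedOn_ext hl fun u β α hb => ?_
  have h : (condT l ρ a : ℂ) ≠ 0 := by
    exact_mod_cast (condS_ne_zero_or l hρ a).resolve_left fun h => h ha
  rw [boundaryCondInfty_iff hl hb, ha, Complex.ofReal_zero, zero_mul, eq_comm (a := (0 : ℂ)),
    mul_eq_zero_iff_left h]

/-- The element `h_l^a` lies in the domain of the extension with parameter `a`. -/
lemma exists_hElem_extension (a : ℝ) : ∃ h : (extension hl ρ a).domain,
    (h : HSpace) = toH (hElem l ρ a) ∧
    extension hl ρ a h + (Complex.I * (ρ : ℂ) ^ 4) • (h : HSpace) =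
      Complex.exp (a * Complex.I) • toH (gPlus l ρ) ∧
    extension hl ρ a h - (Complex.I * (ρ : ℂ) ^ 4) • (h : HSpace) =
      Complex.exp (-(a * Complex.I)) • toH (gMinus l ρ) := by
  obtain ⟨h1, h2, h3⟩ := represents_hElem hl hρ a
  have hg : (toH (hElem l ρ a), _) ∈ (extension hl ρ a).graph :=
    (mem_graph_ext_minBoundary hl _ _ _ _).2 ⟨_, _, _, h1, h2, by ring⟩
  obtain ⟨h, e1, e2⟩ := (LinearPMap.mem_graph_iff _).1 hg
  have hρ' : (ρ : ℂ) ≠ 0 := by exact_mod_cast hρ.ne'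
  have hI := Complex.I_ne_zero
  have hc : ∀ z : ℂ, Complex.I * (ρ : ℂ) ^ 4 * (z / (2 * Complex.I * (ρ : ℂ) ^ 4)) = 1 / 2 * z := by
    intro z; field_simp
  simp only at e1 e2
  refine ⟨h, e1, ?_, ?_⟩
  · rw [e2, e1, h3, smul_sub, smul_smul, smul_smul, hc, hc]
    module
  · rw [e2, e1, h3, smul_sub, smul_smul, smul_smul, hc, hc]
    module

lemma hasCayleyTransform_extension (a : ℝ) : HasCayleyTransform l ρ a (extension hl ρ a) := by
  obtain ⟨U, hU⟩ := exists_cayley (isSelfAdjoint_extension hl hρ a) (c := ρ ^ 4)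
    (pow_ne_zero 4 hρ.ne')
  simp only [Complex.ofReal_pow] at hU
  refine ⟨U, fun x => ?_, ?_, hU⟩
  · have hle := (minBoundary hl).le_ext (condS a) (condT l ρ a)
    have e : minOp l x = extension hl ρ a ⟨x, hle.1 x.2⟩ := hle.2 rfl
    rw [e]
    exact hU ⟨x, hle.1 x.2⟩
  · obtain ⟨h, -, e1, e2⟩ := exists_hElem_extension hl hρ a
    rw [← e1, ← e2]
    exact hU h

/-- The element `h_l^a` spans the domain of the extension modulo the domain of the closure. -/
lemma hElem_spans (a : ℝ) : toH (hElem l ρ a) ∉ (minOp l).closure.domain ∧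
    (extension hl ρ a).HasCore ((minOp l).domain ⊔ Submodule.span ℂ {toH (hElem l ρ a)}) ∧
    (extension hl ρ a).domain =
      (minOp l).closure.domain ⊔ Submodule.span ℂ {toH (hElem l ρ a)} := by
  obtain ⟨h, e, -, hb⟩ := exists_hElem hl hρ a
  have hF : hFactor l ρ ≠ 0 := hFactor_ne_zero hρ
  have hst := condS_ne_zero_or l hρ a
  have hb' : (minBoundary hl).b h = (hFactor l ρ * condS a, hFactor l ρ * condT l ρ a) := hb
  have hb0 : (minBoundary hl).b h ≠ 0 := by
    rw [hb']
    intro h0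
    have h1 := congrArg Prod.fst h0
    have h2 := congrArg Prod.snd h0
    simp only [Prod.fst_zero, Prod.snd_zero, mul_eq_zero, hF, false_or,
      Complex.ofReal_eq_zero] at h1 h2
    exact hst.elim (fun k => k h1) fun k => k h2
  have hh : (condS a : ℂ) * ((minBoundary hl).b h).2 = condT l ρ a * ((minBoundary hl).b h).1 := by
    rw [hb']; ring
  rw [← e]
  refine ⟨fun hm => hb0 ?_, (minBoundary hl).hasCore_ext hst h hh hb0,
    (minBoundary hl).domain_ext hst h hh hb0⟩
  obtain ⟨x', e1, -, e2⟩ := ((minBoundary hl).mem_graph_closure_iff _ _).1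
    ((minOp l).closure.mem_graph ⟨_, hm⟩)
  rwa [Subtype.ext e1] at e2

omit hρ in
include hl in
/-- An eigenfunction of the adjoint with the imaginary eigenvalue `conj c = -c` spans the deficiency
space of `T_l² + c`. -/
lemma orthogonal_shiftedRange {c : ℂ} (hc : c ≠ 0) (hc' : starRingEnd ℂ c = -c) {u : ℝ → ℂ}
    {g : HSpace} (hg : Represents l u g (c • g)) (hg0 : g ≠ 0) :
    (shiftedRange (minOp l) c)ᗮ = Submodule.span ℂ {g} := by
  have hmem : ∀ v : HSpace, v ∈ (shiftedRange (minOp l) c)ᗮ ↔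
      (v, c • v) ∈ (minOp l).adjoint.graph := by
    intro v
    rw [mem_graph_adjoint_iff (dense_domain_minOp l), Submodule.mem_orthogonal]
    constructor
    · intro h z w hzw
      obtain ⟨x, rfl, rfl⟩ := (LinearPMap.mem_graph_iff _).1 hzw
      have h1 := h (minOp l x + c • (x : HSpace)) ⟨x, rfl⟩
      rw [inner_add_left, inner_smul_left, hc'] at h1
      rw [inner_smul_right]
      linear_combination h1
    · rintro h _ ⟨x, rfl⟩
      have h1 := h _ _ ((minOp l).mem_graph x)
      change inner ℂ (minOp l x + c • (x : HSpace)) v = 0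
      rw [inner_add_left, inner_smul_left, hc', h1, inner_smul_right]
      ring
  obtain ⟨g', rfl, eg⟩ := exists_adjoint_domain hl hg
  refine le_antisymm (fun v hv => ?_) ?_
  · obtain ⟨x, rfl, ex⟩ := (LinearPMap.mem_graph_iff _).1 ((hmem v).1 hv)
    exact (minBoundary hl).mem_span_of_eigenvector hc hc' g' x hg0 eg ex
  · rw [Submodule.span_singleton_le_iff_mem, hmem, ← eg]
    exact (minOp l).adjoint.mem_graph g'

end

end RadialBilaplace

open RadialBilaplace in
theorem mainTheorem2 (l : ℕ) (hl : l = 1 ∨ l = 2) (ρ : ℝ) (hρ : 0 < ρ) :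
    -- `T_l²` on `S_l^0` is densely defined and symmetric, with deficiency indices `(1, 1)`
    Dense ((minOp l).domain : Set HSpace) ∧
    (minOp l).IsFormalAdjoint (minOp l) ∧
    MemLp (gPlus l ρ) 2 μ₀ ∧ toH (gPlus l ρ) ≠ 0 ∧
    MemLp (gMinus l ρ) 2 μ₀ ∧ toH (gMinus l ρ) ≠ 0 ∧
    (shiftedRange (minOp l) (Complex.I * (ρ : ℂ) ^ 4))ᗮ = Submodule.span ℂ {toH (gPlus l ρ)} ∧
    (shiftedRange (minOp l) (-(Complex.I * (ρ : ℂ) ^ 4)))ᗮ =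
      Submodule.span ℂ {toH (gMinus l ρ)} ∧
    -- `κ` is a bijective parameter, with `κ = ∞` at `a = π / 4`
    Set.BijOn (kappa l ρ) (Set.Ico 0 Real.pi \ {Real.pi / 4}) Set.univ ∧
    -- the closure of `T_l²` on `S_l^0`
    IsRealizedOn l (minOp l).closure (fun u => HasBoundaryValues u 0) ∧
    -- the family of extensions
    ∃ A : ℝ → (HSpace →ₗ.[ℂ] HSpace),
      Set.BijOn A (Set.Ico 0 Real.pi) {B | IsSelfAdjoint B ∧ minOp l ≤ B} ∧
      ∀ a ∈ Set.Ico 0 Real.pi,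
        HasCayleyTransform l ρ a (A a) ∧
        -- the element `h_l^a`
        (∃ h : (A a).domain, (h : HSpace) = toH (hElem l ρ a) ∧
          A a h + (Complex.I * (ρ : ℂ) ^ 4) • (h : HSpace) =
            Complex.exp ((a : ℂ) * Complex.I) • toH (gPlus l ρ) ∧
          A a h - (Complex.I * (ρ : ℂ) ^ 4) • (h : HSpace) =
            Complex.exp (-((a : ℂ) * Complex.I)) • toH (gMinus l ρ)) ∧
        -- the direct sum of `S_l^0` and `h_l^a` is an essential domain
        toH (hElem l ρ a) ∉ (minOp l).closure.domain ∧
        (A a).HasCore ((minOp l).domain ⊔ Submodule.span ℂ {toH (hElem l ρ a)}) ∧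
        (A a).domain = (minOp l).closure.domain ⊔ Submodule.span ℂ {toH (hElem l ρ a)} ∧
        -- the boundary conditions
        (a ≠ Real.pi / 4 → IsRealizedOn l (A a) (BoundaryCond l (kappa l ρ a))) ∧
        (a = Real.pi / 4 → IsRealizedOn l (A a) (BoundaryCondInfty l)) := by
  have hc : Complex.I * (ρ : ℂ) ^ 4 ≠ 0 :=
    mul_ne_zero Complex.I_ne_zero (pow_ne_zero 4 (by exact_mod_cast hρ.ne'))
  have hc' : starRingEnd ℂ (Complex.I * (ρ : ℂ) ^ 4) = -(Complex.I * (ρ : ℂ) ^ 4) := by simp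
  have hP := (represents_gPlus hl hρ).1
  have hM := (represents_gMinus hl hρ).1
  have hP0 := toH_gPlus_ne_zero hl hρ
  have hM0 := toH_gMinus_ne_zero hl hρ
  refine ⟨dense_domain_minOp l, fun x y => ?_, hP.finite.memLp, hP0, hM.finite.memLp, hM0,
    orthogonal_shiftedRange hl hc hc' hP hP0,
    orthogonal_shiftedRange hl (neg_ne_zero.2 hc) (by rw [map_neg, hc']) hM hM0,
    bijOn_kappa l hρ, isRealizedOn_closure hl, extension hl ρ, bijOn_extension hl hρ,
    fun a ha => ⟨hasCayleyTransform_extension hl hρ a, exists_hElem_extension hl hρ a,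
      (hElem_spans hl hρ a).1, (hElem_spans hl hρ a).2.1, (hElem_spans hl hρ a).2.2,
      fun h => isRealizedOn_extension hl fun h0 => h ((condS_eq_zero_iff ha).1 h0),
      fun h => isRealizedOn_extension_infty hl hρ ((condS_eq_zero_iff ha).2 h)⟩⟩
  exact (mem_graph_adjoint_iff (dense_domain_minOp l) _ _).1
    (LinearPMap.le_graph_of_le (minOp_le_adjoint hl) ((minOp l).mem_graph y)) _ _
    ((minOp l).mem_graph x)
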